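/- Let $d\ge 2$, $\gamma,b\in\mathbb R$, $\gamma\ne0$, $\alpha=1/(d\gamma+2)$ and $P(s)=\operatorname{sign}(\gamma)s^\gamma$. For $V:\mathbb R^d\to\mathbb R$ consider nonnegative solutions $n(t,x)$ of $$\partial_t n=\nabla\cdot\big(n\nabla(p+V)\big)\ \text{ in }(0,\infty)\times\mathbb R^d,\qquad p=P(n),\qquad n(0)=n_0\in L^1(\mathbb R^d),$$ and put $u(t)=\max_x |p(t,x)|^b|\nabla p(t,x)+\nabla V(x)|^2$ and $p_0=P(n_0)$. A strong solution is one for which $n$ and $n\nabla(p+V)$ are locally integrable on $(0,\infty)\times\mathbb R^d$, the distributions $\partial_t n$ and $\nabla\cdot(n\nabla(p+V))$ are the same locally integrable function, and $n(t)\to n_0$ in $L^1$ as $t\to0^+$. It is *well-behaved* if: - (for $\gamma>0$) $n$ is continuous on $(0,\infty)\times\mathbb R^d$, $\operatorname{supp} n(t)\subset \overline B(0,R(t))$ with $R$ locally bounded on $(0,\infty)$, $n$ is $C^\infty$ on $\{t>0,\ n>0\}$, and $p\in L^\infty_{loc}((0,\infty);W^{1,\infty}(\mathbb R^d))$; - (for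 $\gamma<0$) $n>0$ and $n\in C^\infty((0,\infty)\times\mathbb R^d)$, and for each compact $J\subset(0,\infty)$ there are $k>0$, $K$, $c$ and $R>0$ such that for $t\in J$, $|x|>R$: $k(1+|x|^2)^{1/\gamma}\le n(t,x)\le K(1+|x|^2)^{1/\gamma}$ and $|\nabla n(t,x)|\le c|x|^{2/\gamma-1}$. It is *regular up to $t=0$* if these conditions other than the $C^\infty$ ones hold on $[0,\infty)$ in place of $(0,\infty)$, $n$ is continuous on $[0,\infty)\times\mathbb R^d$, $n_0$ is differentiable wherever $n_0>0$, and $\nabla n$ is continuous on $\{t\ge0,\ n>0\}$. Let $s=\sqrt{1-\gamma^2(d-1)}$. In each case below, $u(t)$ is an attained maximum for all $t>0$. 1. (Generic $V$.) Assume $1-s<\gamma b<1+s$ and either $\gamma,b>0$, $\gamma\le\min(\frac1{\sqrt d},\frac2d,\frac12)$, $\gamma\le\gamma b\le1-\gamma$; or $\gamma,b<0$, $|\gamma|<\min(\frac2d,\frac4{3+d})$, $|\gamma|<\gamma b\le\min(1+|\gamma|,2|\gamma|)$. Let $V$ be differentiable with $|\nabla V|\le A$ and $\nabla V$ $B$-Lipschitz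 (that is, $|D^2V|\le B$ in $L^\infty$), and let $n$ be a well-behaved solution with $n\le N$ on $(0,\infty)\times\mathbb R^d$. Then there are $C_1,C_2>0$, depending only on $d,\gamma,b,A,B,N$, with $u(t)\le\max(C_1,C_2t^{-1})$ for all $t>0$. If moreover $n$ is regular up to $t=0$ and $C_0:=\sup_x|p_0|^b|\nabla p_0+\nabla V|^2<\infty$, there is $C>0$, depending only on the same data and $C_0$, with $u(t)\le C$ for all $t>0$. 2. (Quadratic $V$.) Let $V(x)=|x|^2/2$. Assume $1-s\le\gamma b\le1+s$ and either $\gamma,b>0$, $\gamma<\min(\frac1{\sqrt d},\frac2d)$, $\gamma b<\min(1-\gamma,\frac2d)$; or $\gamma,b<0$, $|\gamma|<\frac2d$, $|\gamma|<\gamma b<\min(1+|\gamma|,\frac2d)$. Then there is $C>0$, depending only on $d,\gamma,b$, such that every well-behaved solution that is regular up to $t=0$ and has $C_0:=\sup_x|p_0|^b|\nabla p_0+x|^2<\infty$ satisfies $u(t)\le C_0e^{-Ct}$ for all $t>0$. 3. (Trivial $V$.) Let $V=0$. Assume $1-s<\gamma b<1+s$ and either $\gamma,b>0$, $\gamma<\frac1{\sqrt{d-1}}$;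 or $\gamma<0$, $b<-1$, $|\gamma|<\frac2d$. Then every well-behaved solution satisfies, with some $C>0$ depending only on $d,\gamma,b$ and an upper bound for $\int n_0$, $$u(t)\le C\,t^{-1-\gamma d(b+1)\alpha}\quad\text{for all }t>0.$$ The exponent is sharp: for every $c>0$ the Barenblatt solution $\mathcal B(t,x)=t^{-\alpha d}\big(c-\operatorname{sign}(\gamma)\tfrac{\alpha}{2}|xt^{-\alpha}|^2\big)_+^{1/\gamma}$, each time shift $\mathcal B(t+\tau,x)$ ($\tau>0$) of which is a well-behaved solution, satisfies $\max_x|P(\mathcal B)|^b|\nabla P(\mathcal B)|^2=\kappa\,t^{-1-\gamma d(b+1)\alpha}$ for all $t>0$, with some $\kappa>0$. Finally, if in addition $n_0\le N$ a.e., then $u(t)\le Ct^{-1}$ for all $t>0$, with some $C>0$ depending only on $d,\gamma,b,N$. -/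

import Mathlib

open Set Filter Topology MeasureTheory
open scoped ContDiff

noncomputable section

namespace NonlinearDiffusion

/-- The Euclidean space `ℝ^d`. -/
abbrev Space (d : ℕ) : Type := EuclideanSpace ℝ (Fin d)

/-- The signed power law `P(s) = sign(γ) s^γ`. -/
def pressure (γ s : ℝ) : ℝ := Real.sign γ * s ^ γ

/-- `∇q(t,x) = ∇p(t,x) + ∇V(x)`, where `p = P(n)`. It is only ever used multiplied by a factor that
vanishes wherever `n = 0` and `p` may fail to be differentiable in space. -/
def gradQ {d : ℕ} (γ : ℝ) (V : Space d → ℝ) (n : ℝ → Space d → ℝ) (t : ℝ) (x : Space d) :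
    Space d :=
  gradient (fun y => pressure γ (n t y)) x + gradient V x

/-- The quantity `|p(t,x)|^b |∇p(t,x) + ∇V(x)|²`. -/
def weightedGradSq {d : ℕ} (γ b : ℝ) (V : Space d → ℝ) (n : ℝ → Space d → ℝ) (t : ℝ)
    (x : Space d) : ℝ :=
  |pressure γ (n t x)| ^ b * ‖gradQ γ V n t x‖ ^ 2

/-- `max_x |p(t,x)|^b |∇p(t,x) + ∇V(x)|²` exists and is at most `c`. -/
def MaxLE {d : ℕ} (γ b : ℝ) (V : Space d → ℝ) (n : ℝ → Space d → ℝ) (t c : ℝ) : Prop :=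
  ∃ u, IsGreatest (range (weightedGradSq γ b V n t)) u ∧ u ≤ c

/-- Nonnegative strong solutions of `∂ₜ n = ∇·(n ∇(p + V))` on `(0,∞) × ℝ^d` with an initial
datum `n 0 ∈ L¹`, attained in `L¹`: the distributions `∂ₜ n` and `∇·(n ∇(p + V))` are given by one
and the same locally integrable function. -/
structure IsStrongSolution {d : ℕ} (γ : ℝ) (V : Space d → ℝ) (n : ℝ → Space d → ℝ) : Prop where
  nonneg : ∀ t, 0 ≤ t → ∀ x, 0 ≤ n t x
  integrable_initial : Integrable (n 0)
  initial : Tendsto (fun t => eLpNorm (fun x => n t x - n 0 x) 1 volume) (𝓝[>] 0) (𝓝 0)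
  locallyIntegrable :
    LocallyIntegrableOn (fun z : ℝ × Space d => n z.1 z.2) (Ioi 0 ×ˢ univ)
  flux_locallyIntegrable :
    LocallyIntegrableOn (fun z : ℝ × Space d => n z.1 z.2 • gradQ γ V n z.1 z.2) (Ioi 0 ×ˢ univ)
  equation : ∃ f : ℝ × Space d → ℝ, LocallyIntegrableOn f (Ioi 0 ×ˢ univ) ∧
    ∀ φ : ℝ × Space d → ℝ, ContDiff ℝ ∞ φ → HasCompactSupport φ → tsupport φ ⊆ Ioi 0 ×ˢ univ →
      (∫ z : ℝ × Space d, n z.1 z.2 * deriv (fun s => φ (s, z.2)) z.1) = -∫ z, f z * φ z ∧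
      (∫ z : ℝ × Space d, inner ℝ (n z.1 z.2 • gradQ γ V n z.1 z.2)
        (gradient (fun y => φ (z.1, y)) z.2)) = -∫ z, f z * φ z

/-- The conditions on the times in `I` for slow diffusion, `γ > 0`: `n` is continuous, its support
lies in a ball whose radius is locally bounded in time, and `p` belongs to
`L^∞_loc(I; W^{1,∞})`. -/
structure SlowBounds {d : ℕ} (γ : ℝ) (n : ℝ → Space d → ℝ) (I : Set ℝ) : Prop where
  continuousOn : ContinuousOn (fun z : ℝ × Space d => n z.1 z.2) (I ×ˢ univ)
  support : ∀ K ⊆ I, IsCompact K → ∃ R : ℝ, ∀ t ∈ K, tsupport (n t) ⊆ Metric.closedBall 0 R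
  lipschitz : ∀ K ⊆ I, IsCompact K → ∃ L : NNReal, ∀ t ∈ K,
    (∀ x, |pressure γ (n t x)| ≤ L) ∧ LipschitzWith L (fun x => pressure γ (n t x))

/-- The conditions on the times in `I` for fast diffusion, `γ < 0`: `n` is positive and, for `|x|`
large, `k (1+|x|²)^{1/γ} ≤ n ≤ K (1+|x|²)^{1/γ}` and `|∇n| ≤ c |x|^{2/γ-1}`, with constants
(`k > 0`) that are uniform on compact sets of times. -/
structure FastBounds {d : ℕ} (γ : ℝ) (n : ℝ → Space d → ℝ) (I : Set ℝ) : Prop where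
  pos : ∀ t ∈ I, ∀ x, 0 < n t x
  tail : ∀ J ⊆ I, IsCompact J → ∃ k K c R : ℝ, 0 < k ∧ 0 < R ∧ ∀ t ∈ J, ∀ x, R < ‖x‖ →
    k * (1 + ‖x‖ ^ 2) ^ (1 / γ) ≤ n t x ∧ n t x ≤ K * (1 + ‖x‖ ^ 2) ^ (1 / γ) ∧
      ‖gradient (n t) x‖ ≤ c * ‖x‖ ^ (2 / γ - 1)

/-- Well-behaved solutions of `∂ₜ n = ∇·(n ∇(p + V))`. -/
structure IsWellBehaved {d : ℕ} (γ : ℝ) (V : Space d → ℝ) (n : ℝ → Space d → ℝ) : Prop where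
  strong : IsStrongSolution γ V n
  slow : 0 < γ → SlowBounds γ n (Ioi 0) ∧
    ContDiffOn ℝ ∞ (fun z : ℝ × Space d => n z.1 z.2) {z | 0 < z.1 ∧ 0 < n z.1 z.2}
  fast : γ < 0 → FastBounds γ n (Ioi 0) ∧
    ContDiffOn ℝ ∞ (fun z : ℝ × Space d => n z.1 z.2) (Ioi 0 ×ˢ univ)

/-- Regularity up to the initial time, used only where a bound on `|p₀|^b |∇p₀ + ∇V|²` is to be
propagated: the bounds required of a well-behaved solution hold on `[0,∞)` instead of `(0,∞)`, and
`n` is continuously differentiable in space up to `t = 0`, where it is positive. -/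
structure IsRegularUpToZero {d : ℕ} (γ : ℝ) (n : ℝ → Space d → ℝ) : Prop where
  slow : 0 < γ → SlowBounds γ n (Ici 0)
  fast : γ < 0 → FastBounds γ n (Ici 0) ∧
    ContinuousOn (fun z : ℝ × Space d => n z.1 z.2) (Ici 0 ×ˢ univ)
  differentiable_initial : ∀ x, 0 < n 0 x → DifferentiableAt ℝ (n 0) x
  gradient_continuousOn :
    ContinuousOn (fun z : ℝ × Space d => gradient (n z.1) z.2) {z | 0 ≤ z.1 ∧ 0 < n z.1 z.2}

/-- `|∇V| ≤ A` and `|D²V| ≤ B` in `L^∞`; the latter says that `∇V` is `B`-Lipschitz. -/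
structure HasBoundedDerivatives {d : ℕ} (V : Space d → ℝ) (A B : ℝ) : Prop where
  differentiable : Differentiable ℝ V
  gradient_le : ∀ x, ‖gradient V x‖ ≤ A
  gradient_lipschitz : ∀ x y, ‖gradient V x - gradient V y‖ ≤ B * ‖x - y‖

/-- Admissible exponents for potentials with bounded derivatives. -/
def CoeffGeneric (d : ℕ) (γ b : ℝ) : Prop :=
  (1 - √(1 - γ ^ 2 * ((d : ℝ) - 1)) < γ * b ∧ γ * b < 1 + √(1 - γ ^ 2 * ((d : ℝ) - 1))) ∧
  ((0 < γ ∧ 0 < b ∧ γ ≤ min (1 / √(d : ℝ)) (min (2 / (d : ℝ)) (1 / 2)) ∧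
      γ ≤ γ * b ∧ γ * b ≤ 1 - γ) ∨
   (γ < 0 ∧ b < 0 ∧ |γ| < min (2 / (d : ℝ)) (4 / (3 + (d : ℝ))) ∧
      |γ| < γ * b ∧ γ * b ≤ min (1 + |γ|) (2 * |γ|)))

/-- Admissible exponents for the quadratic potential. -/
def CoeffQuadratic (d : ℕ) (γ b : ℝ) : Prop :=
  (1 - √(1 - γ ^ 2 * ((d : ℝ) - 1)) ≤ γ * b ∧ γ * b ≤ 1 + √(1 - γ ^ 2 * ((d : ℝ) - 1))) ∧
  ((0 < γ ∧ 0 < b ∧ γ < min (1 / √(d : ℝ)) (2 / (d : ℝ)) ∧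
      γ * b < min (1 - γ) (2 / (d : ℝ))) ∨
   (γ < 0 ∧ b < 0 ∧ |γ| < 2 / (d : ℝ) ∧
      |γ| < γ * b ∧ γ * b < min (1 + |γ|) (2 / (d : ℝ))))

/-- Admissible exponents for the trivial potential. -/
def CoeffTrivial (d : ℕ) (γ b : ℝ) : Prop :=
  (1 - √(1 - γ ^ 2 * ((d : ℝ) - 1)) < γ * b ∧ γ * b < 1 + √(1 - γ ^ 2 * ((d : ℝ) - 1))) ∧
  ((0 < γ ∧ 0 < b ∧ γ < 1 / √((d : ℝ) - 1)) ∨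
   (γ < 0 ∧ b < -1 ∧ |γ| < 2 / (d : ℝ)))

/-- `α = 1 / (dγ + 2)`. -/
def alpha (d : ℕ) (γ : ℝ) : ℝ := 1 / ((d : ℝ) * γ + 2)

/-- The Barenblatt solution `t^{-αd} F(x t^{-α})`, `F(ξ) = (c - sign(γ) α|ξ|²/2)₊^{1/γ}`. -/
def barenblatt (d : ℕ) (γ c t : ℝ) (x : Space d) : ℝ :=
  t ^ (-(alpha d γ * d)) *
    (max 0 (c - Real.sign γ * alpha d γ * ‖t ^ (-alpha d γ) • x‖ ^ 2 / 2)) ^ (1 / γ)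

end NonlinearDiffusion

end

open Set Filter Topology MeasureTheory
open scoped ContDiff

noncomputable section

namespace NonlinearDiffusion

/-! ### Partial derivatives, cut-offs and integration by parts -/

/-! This is Bernstein's method. Put q = p + V, β = γb and w = |p|^b |∇q|² = n^β |∇q|². The aim is a
differential inequality for w at its spatial maxima, followed by comparison with explicit functions
of time.

Where n > 0, set L = log n, h = ∇L, g = ∇q, a = |γ| n^γ and c = h·g. The equation becomes ∂ₜL = Δq +
h·g. At a spatial maximum x₁ of w the function |∇q|² - R, with R proportional to exp(-βL), is
maximal. The first order condition reads 2 D²q g = -β|g|² h. In the second order condition,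
Bochner's formula expresses Δ|∇q|² through |D²q|² and ∇q·∇Δq, and the equation removes Δq. The
prescribed image D²q g bounds |D²q|² from below (`sum_sq_ge_of_mulVec_eq`). After cancellation
(`evolution_le_of_second_order`) there remains ∂ₜw ≤ n^β (-κ a c² + (lam (βd - 2) + (βd + 2) B)
|g|²), where V is split as lam |x|²/2 plus a part whose gradient is B-Lipschitz. Here κ = (2β - β² -
γ²(d-1))/2 = (s² - (β-1)²)/2, which explains the condition |β - 1| < s.

Since V is only C^{1,1}, D²q need not exist pointwise a priori. But V solves weakly an elliptic
equation with smooth coefficients near x₁, so its mollifications solve it up to an error small in C¹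
(`exists_smooth_approximation`). The conditions are derived for the mollified problem, penalised by
|x - x₁|⁴, and the bounded Hessians converge along a subsequence (`exists_hessian_of_isLocalMax`).

The behaviour assumed of n makes w continuous and small at spatial infinity, so maxima are attained
and a first contact time with a barrier exists (`DecaysOn.lt_of_touching`). For a generic potential
and w large, ∇V is dominated by g, so a c² controls w² and ∂ₜw ≤ -c w²; this gives decay like 1/t.
For the quadratic potential lam = 1 and B = 0, so ∂ₜw ≤ (βd - 2) w. For V = 0 one has ∂ₜw ≤ -const ·
n^{-(β+γ)} w². An upper bound for n at the maximum is then needed: either n ≤ 2N, or a bound by the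
mass (`IsWellBehaved.rpow_le_of_max`). The latter holds because the gradient bound keeps n
comparable to its value at the maximum on a ball of explicit radius, which carries at most the
initial mass. Both rest on the decay of truncated masses ∫ Φ_δ(n). Inserting the second bound gives
∂ₜw ≤ -c w^{1+θ} with 1/θ = 1 + γd(b+1)α.

Barenblatt profiles satisfy ∇p = -(α/t) x on their positivity set, so they move with velocity αx/t,
and w scales self-similarly with exactly this exponent. -/

/-- The `i`-th partial derivative. -/
def pd {d : ℕ} (i : Fin d) (f : Space d → ℝ) (x : Space d) : ℝ :=
  fderiv ℝ f x (EuclideanSpace.single i 1)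

section PartialDerivatives

variable {d : ℕ} {f g : Space d → ℝ} {x : Space d}

theorem gradient_apply (f : Space d → ℝ) (x : Space d) (i : Fin d) :
    gradient f x i = pd i f x := by
  have h : inner ℝ (gradient f x) (EuclideanSpace.single i (1 : ℝ)) = pd i f x := by
    simp [gradient, pd]
  rw [← h, EuclideanSpace.inner_single_right]
  simp

theorem norm_gradient_sub (f g : Space d → ℝ) (x y : Space d) :
    ‖gradient f x - gradient g y‖ = ‖fderiv ℝ f x - fderiv ℝ g y‖ := by
  rw [gradient, gradient, ← map_sub, LinearIsometryEquiv.norm_map]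

theorem norm_gradient (f : Space d → ℝ) (x : Space d) :
    ‖gradient f x‖ = ‖fderiv ℝ f x‖ := by
  rw [gradient, LinearIsometryEquiv.norm_map]

theorem fderiv_apply_eq_sum (f : Space d → ℝ) (x a : Space d) :
    fderiv ℝ f x a = ∑ i, a i * pd i f x := by
  have h : a = ∑ i, a i • EuclideanSpace.single i (1 : ℝ) := by
    ext j; simp [Pi.single_apply]
  conv_lhs => rw [h]
  rw [map_sum]
  simp [pd]

theorem norm_sq_eq_sum (v : Space d) : ‖v‖ ^ 2 = ∑ i, v i ^ 2 := by
  rw [EuclideanSpace.real_norm_sq_eq]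

theorem contDiff_pd (hf : ContDiff ℝ ∞ f) (i : Fin d) : ContDiff ℝ ∞ (pd i f) :=
  (hf.fderiv_right (m := ∞) (by simp)).clm_apply contDiff_const

theorem differentiable_of_contDiff (hf : ContDiff ℝ ∞ f) : Differentiable ℝ f :=
  hf.differentiable (by simp)

theorem pd_congr {s : Set (Space d)} (hs : s ∈ 𝓝 x) (h : ∀ y ∈ s, f y = g y) (i : Fin d) :
    pd i f x = pd i g x := by
  rw [pd, pd, Filter.EventuallyEq.fderiv_eq (Filter.eventually_of_mem hs h)]

theorem pd_add (hf : DifferentiableAt ℝ f x) (hg : DifferentiableAt ℝ g x) (i : Fin d) :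
    pd i (fun y => f y + g y) x = pd i f x + pd i g x := by
  simp [pd, fderiv_fun_add hf hg]

theorem pd_sub (hf : DifferentiableAt ℝ f x) (hg : DifferentiableAt ℝ g x) (i : Fin d) :
    pd i (fun y => f y - g y) x = pd i f x - pd i g x := by
  simp [pd, fderiv_fun_sub hf hg]

theorem pd_mul (hf : DifferentiableAt ℝ f x) (hg : DifferentiableAt ℝ g x) (i : Fin d) :
    pd i (fun y => f y * g y) x = pd i f x * g x + f x * pd i g x := by
  simp [pd, fderiv_fun_mul hf hg]; ring

theorem pd_const_mul (hf : DifferentiableAt ℝ f x) (c : ℝ) (i : Fin d) :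
    pd i (fun y => c * f y) x = c * pd i f x := by
  simp [pd, fderiv_const_mul hf]

theorem pd_const (c : ℝ) (i : Fin d) : pd i (fun _ => c) x = 0 := by
  simp [pd]

theorem pd_sum {ι : Type*} (s : Finset ι) {F : ι → Space d → ℝ}
    (hF : ∀ j ∈ s, DifferentiableAt ℝ (F j) x) (i : Fin d) :
    pd i (fun y => ∑ j ∈ s, F j y) x = ∑ j ∈ s, pd i (F j) x := by
  simp [pd, fderiv_fun_sum hF]

theorem pd_comp {φ : ℝ → ℝ} {φ' : ℝ} (hφ : HasDerivAt φ φ' (f x)) (hf : DifferentiableAt ℝ f x)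
    (i : Fin d) : pd i (fun y => φ (f y)) x = φ' * pd i f x := by
  have h := (hφ.hasFDerivAt.comp x hf.hasFDerivAt).fderiv
  have h2 : (fun y => φ (f y)) = φ ∘ f := rfl
  rw [pd, h2, h]
  simp [pd, mul_comm]

theorem pd_exp (hf : DifferentiableAt ℝ f x) (i : Fin d) :
    pd i (fun y => Real.exp (f y)) x = Real.exp (f x) * pd i f x :=
  pd_comp (Real.hasDerivAt_exp _) hf i

theorem pd_sq (hf : DifferentiableAt ℝ f x) (i : Fin d) :
    pd i (fun y => f y ^ 2) x = 2 * f x * pd i f x := by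
  have h := hasDerivAt_pow 2 (f x)
  rw [pd_comp h hf]; norm_num

theorem pd_pd (hf : ContDiff ℝ ∞ f) (i j : Fin d) (x : Space d) :
    pd i (pd j f) x =
      fderiv ℝ (fderiv ℝ f) x (EuclideanSpace.single i 1) (EuclideanSpace.single j 1) := by
  have h : DifferentiableAt ℝ (fderiv ℝ f) x :=
    ((hf.fderiv_right (m := ∞) (by simp)).differentiable (by simp)) x
  have h2 := fderiv_clm_apply h (differentiableAt_const (EuclideanSpace.single j (1 : ℝ)))
  have h3 : pd j f = fun y => fderiv ℝ f y (EuclideanSpace.single j 1) := rfl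
  rw [h3, pd, h2]
  simp

theorem pd_comm (hf : ContDiff ℝ ∞ f) (i j : Fin d) (x : Space d) :
    pd i (pd j f) x = pd j (pd i f) x := by
  rw [pd_pd hf, pd_pd hf]
  exact (hf.contDiffAt.isSymmSndFDerivAt (by simpa using ENat.LEInfty.out)).eq _ _

theorem pd_coord (i j : Fin d) (x : Space d) :
    pd i (fun y : Space d => y j) x = if i = j then 1 else 0 := by
  have h : (fun y : Space d => y j) = (EuclideanSpace.proj j : Space d →L[ℝ] ℝ) := rfl
  rw [pd, h, ContinuousLinearMap.fderiv]
  simp [eq_comm]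

theorem contDiff_coord (j : Fin d) : ContDiff ℝ ∞ (fun y : Space d => y j) :=
  (EuclideanSpace.proj j : Space d →L[ℝ] ℝ).contDiff

theorem pd_eq_deriv (hf : Differentiable ℝ f) (i : Fin d) (x : Space d) (s : ℝ) :
    deriv (fun s : ℝ => f (x + s • EuclideanSpace.single i 1)) s =
      pd i f (x + s • EuclideanSpace.single i 1) := by
  have h1 : HasDerivAt (fun s : ℝ => x + s • EuclideanSpace.single i (1 : ℝ))
      (EuclideanSpace.single i (1 : ℝ)) s := by
    simpa using ((hasDerivAt_id s).smul_const (EuclideanSpace.single i (1 : ℝ))).const_add x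
  exact ((hf _).hasFDerivAt.comp_hasDerivAt s h1).deriv

theorem pd_eq_zero_of_isLocalMax (h : IsLocalMax f x) (i : Fin d) : pd i f x = 0 := by
  rw [pd, h.fderiv_eq_zero]; simp

/-- With a positive second derivative the point would also be a local minimum along the axis. The
function would then be constant near it on that line, and the second derivative zero. -/
theorem pd_pd_nonpos_of_isLocalMax (hf : ContDiff ℝ ∞ f) (h : IsLocalMax f x) (i : Fin d) :
    pd i (pd i f) x ≤ 0 := by
  by_contra hpos
  push Not at hpos
  set e : Space d := EuclideanSpace.single i (1 : ℝ) with he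
  set φ : ℝ → ℝ := fun s => f (x + s • e) with hφ
  have hcont : Continuous fun s : ℝ => x + s • e := by fun_prop
  have hd : deriv φ = fun s => pd i f (x + s • e) := by
    funext s; exact pd_eq_deriv (differentiable_of_contDiff hf) i x s
  have hdd : deriv (deriv φ) 0 = pd i (pd i f) x := by
    rw [hd, pd_eq_deriv (differentiable_of_contDiff (contDiff_pd hf i)) i x 0]; simp
  have hmax : IsLocalMax φ 0 := by
    have ht : Tendsto (fun s : ℝ => x + s • e) (𝓝 0) (𝓝 x) := by
      simpa using hcont.tendsto 0
    have := ht.eventually h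
    filter_upwards [this] with s hs
    simpa [hφ] using hs
  have hmin : IsLocalMin φ 0 := by
    apply isLocalMin_of_deriv_deriv_pos
    · rw [hdd]; exact hpos
    · exact hmax.deriv_eq_zero
    · exact (hf.continuous.comp hcont).continuousAt
  have hconst : φ =ᶠ[𝓝 0] fun _ => φ 0 := by
    filter_upwards [hmax, hmin] with s h1 h2
    exact le_antisymm h1 h2
  have h1 : deriv φ =ᶠ[𝓝 0] fun _ => 0 := by
    have := hconst.deriv
    filter_upwards [this] with s hs
    simpa using hs
  have h2 : deriv (deriv φ) 0 = 0 := by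
    rw [h1.deriv_eq]; simp
  rw [hdd] at h2
  exact absurd h2 hpos.ne'

end PartialDerivatives

/-! ### Products supported where one factor is regular. -/

section CutOff

variable {G : Type*} [NormedAddCommGroup G] [NormedSpace ℝ G]

theorem contDiff_mul_of_tsupport {f φ : G → ℝ} {m : WithTop ℕ∞} (hφ : ContDiff ℝ m φ)
    (hf : ∀ x ∈ tsupport φ, ContDiffAt ℝ m f x) : ContDiff ℝ m (fun x => φ x * f x) := by
  rw [contDiff_iff_contDiffAt]
  intro x
  by_cases hx : x ∈ tsupport φ
  · exact hφ.contDiffAt.mul (hf x hx)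
  · have h : (fun x => φ x * f x) =ᶠ[𝓝 x] fun _ => 0 := by
      filter_upwards [(isClosed_tsupport φ).isOpen_compl.mem_nhds hx] with y hy
      rw [image_eq_zero_of_notMem_tsupport hy, zero_mul]
    exact contDiffAt_const.congr_of_eventuallyEq h

theorem continuous_mul_of_tsupport {X : Type*} [TopologicalSpace X] {f φ : X → ℝ}
    (hφ : Continuous φ) (hf : ∀ x ∈ tsupport φ, ContinuousAt f x) :
    Continuous (fun x => φ x * f x) := by
  rw [continuous_iff_continuousAt]
  intro x
  by_cases hx : x ∈ tsupport φ
  · exact hφ.continuousAt.mul (hf x hx)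
  · have h : (fun x => φ x * f x) =ᶠ[𝓝 x] fun _ => 0 := by
      filter_upwards [(isClosed_tsupport φ).isOpen_compl.mem_nhds hx] with y hy
      rw [image_eq_zero_of_notMem_tsupport hy, zero_mul]
    exact continuousAt_const.congr h.symm

theorem tsupport_fderiv_apply_subset' (φ : G → ℝ) (v : G) :
    tsupport (fun x => fderiv ℝ φ x v) ⊆ tsupport φ :=
  tsupport_fderiv_apply_subset ℝ v

variable [MeasurableSpace G] [BorelSpace G] [FiniteDimensional ℝ G]
  {μ : Measure G} [μ.IsAddHaarMeasure]

theorem integral_mul_fderiv_of_tsupport {f φ : G → ℝ} (hφ : ContDiff ℝ 1 φ)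
    (hc : HasCompactSupport φ) (hf : ∀ x ∈ tsupport φ, ContDiffAt ℝ 1 f x) (v : G) :
    ∫ x, f x * fderiv ℝ φ x v ∂μ = -∫ x, fderiv ℝ f x v * φ x ∂μ := by
  have hφ' : Continuous fun x => fderiv ℝ φ x v :=
    (hφ.continuous_fderiv (by simp)).clm_apply continuous_const
  have hc' : HasCompactSupport fun x => fderiv ℝ φ x v := hc.fderiv_apply ℝ v
  apply integral_mul_fderiv_eq_neg_fderiv_mul_of_integrable
  · have h : Continuous fun x => φ x * fderiv ℝ f x v :=
      continuous_mul_of_tsupport hφ.continuous fun x hx =>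
        ((hf x hx).continuousAt_fderiv (by simp)).clm_apply continuousAt_const
    simpa [mul_comm] using h.integrable_of_hasCompactSupport (μ := μ) hc.mul_right
  · have h : Continuous fun x => fderiv ℝ φ x v * f x :=
      continuous_mul_of_tsupport hφ' fun x hx =>
        (hf x (tsupport_fderiv_apply_subset' φ v hx)).continuousAt
    simpa [mul_comm] using h.integrable_of_hasCompactSupport (μ := μ) hc'.mul_right
  · have h : Continuous fun x => φ x * f x :=
      continuous_mul_of_tsupport hφ.continuous fun x hx => (hf x hx).continuousAt
    simpa [mul_comm] using h.integrable_of_hasCompactSupport (μ := μ) hc.mul_right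
  · exact fun x hx => (hf x hx).differentiableAt (by simp)
  · exact fun x _ => hφ.differentiable (by simp) x

end CutOff

/-! ### Mollification -/

/-- A smooth nonnegative kernel of mass one, supported in the closed ball of radius `ε`. -/
structure IsMollifier {d : ℕ} (ρ : Space d → ℝ) (ε : ℝ) : Prop where
  contDiff : ContDiff ℝ ∞ ρ
  nonneg : ∀ z, 0 ≤ ρ z
  integral : ∫ z, ρ z = 1
  tsupport : tsupport ρ ⊆ Metric.closedBall 0 ε

theorem exists_isMollifier (d : ℕ) {ε : ℝ} (hε : 0 < ε) :
    ∃ ρ : Space d → ℝ, IsMollifier ρ ε := by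
  let f : ContDiffBump (0 : Space d) := ⟨ε / 2, ε, by positivity, by linarith⟩
  exact ⟨f.normed volume, f.contDiff_normed, f.nonneg_normed, f.integral_normed,
    f.tsupport_normed_eq.le⟩

/-- The convolution `ρ ⋆ f`. -/
def mollify {d : ℕ} (ρ f : Space d → ℝ) (x : Space d) : ℝ := ∫ z, ρ z * f (x - z)

namespace IsMollifier

variable {d : ℕ} {ρ : Space d → ℝ} {ε : ℝ}

theorem hasCompactSupport (hρ : IsMollifier ρ ε) : HasCompactSupport ρ :=
  HasCompactSupport.of_support_subset_isCompact (isCompact_closedBall 0 ε)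
    ((subset_tsupport ρ).trans hρ.tsupport)

theorem integrable (hρ : IsMollifier ρ ε) : Integrable ρ :=
  hρ.contDiff.continuous.integrable_of_hasCompactSupport hρ.hasCompactSupport

theorem integrable_mul (hρ : IsMollifier ρ ε) {F : Space d → ℝ} (hF : Continuous F) :
    Integrable fun z => ρ z * F z :=
  (hρ.contDiff.continuous.mul hF).integrable_of_hasCompactSupport hρ.hasCompactSupport.mul_right

theorem abs_integral_mul_le (hρ : IsMollifier ρ ε) {F : Space d → ℝ} {δ : ℝ}
    (hF : ∀ z, ‖z‖ ≤ ε → |F z| ≤ δ) : |∫ z, ρ z * F z| ≤ δ := by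
  have h : ‖∫ z, ρ z * F z‖ ≤ ∫ z, ρ z * δ := by
    refine norm_integral_le_of_norm_le (hρ.integrable.mul_const δ) (ae_of_all _ fun z => ?_)
    by_cases hz : ρ z = 0
    · simp [hz]
    · have hz' : ‖z‖ ≤ ε := by
        simpa using hρ.tsupport (subset_tsupport ρ hz)
      rw [norm_mul, Real.norm_of_nonneg (hρ.nonneg z)]
      exact mul_le_mul_of_nonneg_left (hF z hz') (hρ.nonneg z)
  rwa [integral_mul_const, hρ.integral, one_mul] at h

theorem contDiff_mollify (hρ : IsMollifier ρ ε) {f : Space d → ℝ} (hf : Continuous f) :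
    ContDiff ℝ ∞ (mollify ρ f) :=
  hρ.hasCompactSupport.contDiff_convolution_left (ContinuousLinearMap.mul ℝ ℝ)
    (μ := volume) hρ.contDiff hf.locallyIntegrable

/-- The derivative falls on the kernel, so `f` need only be continuous. Applied to f = ∂ᵢV this
expresses second derivatives of the mollified potential through first derivatives of V. -/
theorem pd_mollify_left (hρ : IsMollifier ρ ε) {f : Space d → ℝ} (hf : Continuous f)
    (i : Fin d) (x : Space d) :
    pd i (mollify ρ f) x = ∫ z, pd i ρ z * f (x - z) := by
  have h := hρ.hasCompactSupport.hasFDerivAt_convolution_left (ContinuousLinearMap.mul ℝ ℝ)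
    (μ := volume) (hρ.contDiff.of_le (by simp)) hf.locallyIntegrable x
  have h2 := congrArg (fun T => T (EuclideanSpace.single i 1)) h.fderiv
  refine Eq.trans h2 ?_
  have hintg : ConvolutionExistsAt (fderiv ℝ ρ) f x
      ((ContinuousLinearMap.mul ℝ ℝ).precompL (Space d)) volume := by
    apply HasCompactSupport.convolutionExists_left
    · exact hρ.hasCompactSupport.fderiv ℝ
    · exact hρ.contDiff.continuous_fderiv (by simp)
    · exact hf.locallyIntegrable
  beta_reduce
  rw [convolution_def, ContinuousLinearMap.integral_apply hintg]
  simp [pd]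

theorem fderiv_mollify (hρ : IsMollifier ρ ε) {V : Space d → ℝ} {A : ℝ}
    (hV : Differentiable ℝ V) (hV' : Continuous (fderiv ℝ V)) (hA : ∀ x, ‖fderiv ℝ V x‖ ≤ A)
    (x a : Space d) :
    fderiv ℝ (mollify ρ V) x a = mollify ρ (fun y => fderiv ℝ V y a) x := by
  have hintg : Integrable fun z => ρ z • fderiv ℝ V (x - z) :=
    (hρ.contDiff.continuous.smul (hV'.comp (by fun_prop))).integrable_of_hasCompactSupport
      hρ.hasCompactSupport.smul_right
  have h : HasFDerivAt (mollify ρ V) (∫ z, ρ z • fderiv ℝ V (x - z)) x := by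
    refine hasFDerivAt_integral_of_dominated_of_fderiv_le (s := univ)
      (F := fun x z => ρ z * V (x - z))
      (F' := fun x z => ρ z • fderiv ℝ V (x - z)) (bound := fun z => ρ z * A) univ_mem
      (Eventually.of_forall fun y => ?_) ?_ ?_ ?_ (hρ.integrable.mul_const A) ?_
    · exact (hρ.contDiff.continuous.mul
        (hV.continuous.comp (by fun_prop))).aestronglyMeasurable
    · exact hρ.integrable_mul (hV.continuous.comp (by fun_prop))
    · exact hintg.aestronglyMeasurable
    · refine ae_of_all _ fun z y _ => ?_
      rw [norm_smul, Real.norm_of_nonneg (hρ.nonneg z)]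
      exact mul_le_mul_of_nonneg_left (hA _) (hρ.nonneg z)
    · refine ae_of_all _ fun z y _ => ?_
      exact ((hasFDerivAt_comp_sub z).2 (hV (y - z)).hasFDerivAt).const_mul (ρ z)
  rw [h.fderiv, ContinuousLinearMap.integral_apply hintg]
  simp [mollify]

end IsMollifier

theorem HasBoundedDerivatives.norm_fderiv_sub_le {d : ℕ} {V : Space d → ℝ} {A B : ℝ}
    (hV : HasBoundedDerivatives V A B) (x y : Space d) :
    ‖fderiv ℝ V x - fderiv ℝ V y‖ ≤ B * ‖x - y‖ := by
  rw [← norm_gradient_sub]; exact hV.gradient_lipschitz x y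

theorem HasBoundedDerivatives.norm_fderiv_le {d : ℕ} {V : Space d → ℝ} {A B : ℝ}
    (hV : HasBoundedDerivatives V A B) (x : Space d) : ‖fderiv ℝ V x‖ ≤ A := by
  rw [← norm_gradient]; exact hV.gradient_le x

theorem continuous_fderiv_of_lipschitz {d : ℕ} {V : Space d → ℝ} {B : ℝ}
    (hB : ∀ x y, ‖fderiv ℝ V x - fderiv ℝ V y‖ ≤ B * ‖x - y‖) : Continuous (fderiv ℝ V) := by
  refine (LipschitzWith.of_dist_le_mul (K := B.toNNReal) fun x y => ?_).continuous
  rw [dist_eq_norm, dist_eq_norm]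
  exact (hB x y).trans (mul_le_mul_of_nonneg_right (Real.le_coe_toNNReal B) (norm_nonneg _))

theorem HasBoundedDerivatives.continuous_fderiv {d : ℕ} {V : Space d → ℝ} {A B : ℝ}
    (hV : HasBoundedDerivatives V A B) : Continuous (fderiv ℝ V) :=
  continuous_fderiv_of_lipschitz hV.norm_fderiv_sub_le

theorem abs_pd_le {d : ℕ} {f : Space d → ℝ} {x : Space d} {A : ℝ} (h : ‖fderiv ℝ f x‖ ≤ A)
    (i : Fin d) : |pd i f x| ≤ A := by
  have h1 := (fderiv ℝ f x).le_opNorm (EuclideanSpace.single i 1)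
  simp only [PiLp.norm_single, norm_one, mul_one, Real.norm_eq_abs] at h1
  exact h1.trans h

theorem abs_pd_sub_le {d : ℕ} {f g : Space d → ℝ} {x y : Space d} {A : ℝ}
    (h : ‖fderiv ℝ f x - fderiv ℝ g y‖ ≤ A) (i : Fin d) : |pd i f x - pd i g y| ≤ A := by
  have h1 := (fderiv ℝ f x - fderiv ℝ g y).le_opNorm (EuclideanSpace.single i 1)
  simp only [PiLp.norm_single, norm_one, mul_one, Real.norm_eq_abs] at h1
  exact h1.trans h

/-- The mean value inequality is applied to u ↦ a(u - z) - a(u), whose derivative is at most a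
constant times ‖z‖ because the derivative of `a` is Lipschitz on the ball. It is used on the ball
intersected with its translate, which is again convex. -/
theorem exists_second_difference_bound {d : ℕ} {a : Space d → ℝ} (ha : ContDiff ℝ ∞ a)
    (c : Space d) (r : ℝ) :
    ∃ C : ℝ, 0 ≤ C ∧
      (∀ x ∈ Metric.closedBall c r, ∀ y ∈ Metric.closedBall c r, |a x - a y| ≤ C * ‖x - y‖) ∧
      ∀ x y z, x ∈ Metric.closedBall c r → y ∈ Metric.closedBall c r →
        x - z ∈ Metric.closedBall c r → y - z ∈ Metric.closedBall c r →
          |a (x - z) - a x - (a (y - z) - a y)| ≤ C * ‖z‖ * ‖x - y‖ := by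
  obtain ⟨K₁, hK₁⟩ := ha.contDiffOn.exists_lipschitzOnWith (s := Metric.closedBall c r) (by simp)
    (convex_closedBall c r) (isCompact_closedBall c r)
  obtain ⟨K₂, hK₂⟩ := (ha.fderiv_right (m := ∞) (by simp)).contDiffOn.exists_lipschitzOnWith
    (s := Metric.closedBall c r) (by simp) (convex_closedBall c r) (isCompact_closedBall c r)
  refine ⟨K₁ + K₂, by positivity, fun x hx y hy => ?_, fun x y z hx hy hxz hyz => ?_⟩
  · have h := hK₁.norm_sub_le hx hy
    rw [Real.norm_eq_abs] at h
    exact h.trans (mul_le_mul_of_nonneg_right (by simp) (norm_nonneg _))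
  · set s : Set (Space d) := Metric.closedBall c r ∩ (fun u => u - z) ⁻¹' Metric.closedBall c r
    have hs : Convex ℝ s := by
      refine (convex_closedBall c r).inter ?_
      have : (fun u : Space d => u - z) ⁻¹' Metric.closedBall c r =
          Metric.closedBall (c + z) r := by
        ext u; simp [dist_eq_norm, sub_sub, add_comm]
      rw [this]; exact convex_closedBall _ _
    have had : Differentiable ℝ a := ha.differentiable (by simp)
    have hder : ∀ u, HasFDerivAt (fun u => a (u - z) - a u)
        (fderiv ℝ a (u - z) - fderiv ℝ a u) u := fun u =>
      ((hasFDerivAt_comp_sub z).2 (had (u - z)).hasFDerivAt).sub (had u).hasFDerivAt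
    have h := hs.norm_image_sub_le_of_norm_hasFDerivWithin_le (f := fun u => a (u - z) - a u)
      (C := K₂ * ‖z‖) (x := y) (y := x)
      (fun u hu => (hder u).hasFDerivWithinAt) (fun u hu => ?_) ⟨hy, hyz⟩ ⟨hx, hxz⟩
    · rw [Real.norm_eq_abs] at h
      refine h.trans ?_
      gcongr
      simp
    · have := hK₂.norm_sub_le hu.2 hu.1
      simpa using this

/-- A `C^{1,1}` weak solution of `ΔV + h·∇V = ℓ` near `x₁` is approximated by smooth functions
solving the equation up to an error that is small in `C¹`. -/
theorem exists_smooth_approximation {d : ℕ} {V : Space d → ℝ} {A B : ℝ}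
    (hV : HasBoundedDerivatives V A B) {ℓ : Space d → ℝ} {h : Fin d → Space d → ℝ}
    (hℓ : ContDiff ℝ ∞ ℓ) (hh : ∀ i, ContDiff ℝ ∞ (h i)) {x₁ : Space d} {r : ℝ}
    (hweak : ∀ ψ : Space d → ℝ, ContDiff ℝ ∞ ψ → HasCompactSupport ψ →
      tsupport ψ ⊆ Metric.ball x₁ r →
        ∫ x, ∑ i, pd i V x * pd i ψ x = ∫ x, (∑ i, h i x * pd i V x - ℓ x) * ψ x) :
    ∃ K : ℝ, ∀ ε > 0, ε < r / 2 → ∃ W : Space d → ℝ, ContDiff ℝ ∞ W ∧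
      (∀ x i, |pd i W x - pd i V x| ≤ K * ε) ∧
      (∀ x a : Space d, ‖fderiv ℝ (fun y => fderiv ℝ W y a) x‖ ≤ B * ‖a‖) ∧
      ∀ x ∈ Metric.ball x₁ (r / 2),
        |∑ i, pd i (pd i W) x + ∑ i, h i x * pd i W x - ℓ x| ≤ K * ε ∧
        ∀ j, |pd j (fun y => ∑ i, pd i (pd i W) y + ∑ i, h i y * pd i W y - ℓ y) x| ≤ K * ε := by
  have hA0 : 0 ≤ A := (norm_nonneg _).trans (hV.norm_fderiv_le x₁)
  have hV'c := hV.continuous_fderiv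
  have hpdc : ∀ i, Continuous (pd i V) := fun i => hV'c.clm_apply continuous_const
  obtain ⟨C₀, hC₀, hℓ1, hℓ2⟩ := exists_second_difference_bound hℓ x₁ r
  choose C hC hh1 hh2 using fun i => exists_second_difference_bound (hh i) x₁ r
  set B' := max B 0 with hB'
  have hBB : 0 ≤ B' := le_max_right _ _
  have hlipB : ∀ x y, ‖fderiv ℝ V x - fderiv ℝ V y‖ ≤ B' * ‖x - y‖ := fun x y =>
    (hV.norm_fderiv_sub_le x y).trans
      (mul_le_mul_of_nonneg_right (le_max_left _ _) (norm_nonneg _))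
  -- One constant serves all error bounds: B' for the gradients, C₀ for differences of ℓ, and the
  -- sum for differences of the coefficients h multiplied by ∇V or by differences of ∇V.
  set K : ℝ := B' + C₀ + ∑ i, (C i * A + C i * B') with hK
  have hS1 : 0 ≤ ∑ i, C i * A := Finset.sum_nonneg fun i _ => mul_nonneg (hC i) hA0
  have hS2 : 0 ≤ ∑ i, C i * B' := Finset.sum_nonneg fun i _ => mul_nonneg (hC i) hBB
  rw [Finset.sum_add_distrib] at hK
  refine ⟨K, fun ε hε hεr => ?_⟩
  obtain ⟨ρ, hρ⟩ := exists_isMollifier d hε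
  set W := mollify ρ V with hW
  have hWs : ContDiff ℝ ∞ W := hρ.contDiff_mollify hV.differentiable.continuous
  have hfd : ∀ x a, fderiv ℝ W x a = mollify ρ (fun y => fderiv ℝ V y a) x :=
    hρ.fderiv_mollify hV.differentiable hV'c hV.norm_fderiv_le
  have hpd : ∀ i, pd i W = mollify ρ (pd i V) := fun i => by
    funext x; exact hfd x _
  have hpdV : ∀ x y i, |pd i V x - pd i V y| ≤ B' * ‖x - y‖ := fun x y i =>
    abs_pd_sub_le (hlipB x y) i
  refine ⟨W, hWs, fun x i => ?_, fun x a => ?_, ?_⟩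
  · have h1 : pd i W x - pd i V x = ∫ z, ρ z * (pd i V (x - z) - pd i V x) := by
      simp_rw [mul_sub]
      have i1 : Integrable fun z => ρ z * pd i V (x - z) := hρ.integrable_mul (by fun_prop)
      rw [integral_sub i1 (hρ.integrable.mul_const _), integral_mul_const, hρ.integral,
        one_mul, hpd]
      rfl
    rw [h1]
    refine hρ.abs_integral_mul_le fun z hz => (hpdV _ _ i).trans ?_
    rw [sub_sub_cancel_left, norm_neg]
    have : B' * ‖z‖ ≤ B' * ε := mul_le_mul_of_nonneg_left hz hBB
    refine this.trans (mul_le_mul_of_nonneg_right ?_ hε.le)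
    linarith
  · have hB0 : ∀ x y : Space d, 0 ≤ B * ‖x - y‖ := fun x y =>
      (norm_nonneg _).trans (hV.norm_fderiv_sub_le x y)
    have hlip : LipschitzWith (B * ‖a‖).toNNReal (fun x => fderiv ℝ W x a) := by
      refine LipschitzWith.of_dist_le_mul fun x y => ?_
      rw [Real.dist_eq, dist_eq_norm, hfd, hfd, mollify, mollify,
        ← integral_sub (hρ.integrable_mul (by fun_prop)) (hρ.integrable_mul (by fun_prop))]
      simp_rw [← mul_sub]
      refine hρ.abs_integral_mul_le fun z _ => ?_
      have h1 := (fderiv ℝ V (x - z) - fderiv ℝ V (y - z)).le_of_opNorm_le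
        (hV.norm_fderiv_sub_le (x - z) (y - z)) a
      rw [sub_sub_sub_cancel_right] at h1
      simp only [_root_.sub_apply, Real.norm_eq_abs] at h1
      refine h1.trans ?_
      calc B * ‖x - y‖ * ‖a‖ = B * ‖a‖ * ‖x - y‖ := by ring
        _ ≤ _ := mul_le_mul_of_nonneg_right (Real.le_coe_toNNReal _) (norm_nonneg _)
    have h2 := norm_fderiv_le_of_lipschitz ℝ hlip (x₀ := x)
    have hBa : 0 ≤ B * ‖a‖ := by simpa using hB0 a 0
    rwa [Real.coe_toNNReal _ hBa] at h2
  -- The residual of the mollified equation is the ρ-average of this commutator. It contains only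
  -- increments of the smooth functions ℓ and h, and undifferentiated ∇V. Hence it is O(ε) together
  -- with its Lipschitz constant in x, although D²V is merely bounded.
  · set F : Space d → Space d → ℝ := fun x z => ℓ (x - z) - ℓ x -
      ∑ i, (h i (x - z) - h i x) * pd i V (x - z) with hF
    have hℓc : Continuous ℓ := hℓ.continuous
    have hhc : ∀ i, Continuous (h i) := fun i => (hh i).continuous
    have hFc : ∀ x, Continuous (F x) := fun x => by
      simp only [hF]; fun_prop
    have hlap : ∀ x ∈ Metric.ball x₁ (r / 2),
        ∑ i, pd i (pd i W) x = ∫ z, ρ z * (ℓ (x - z) - ∑ i, h i (x - z) * pd i V (x - z)) := by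
      intro x hx
      -- Testing the weak equation with y ↦ ρ(x - y) makes it a pointwise identity for W at x. The
      -- support stays in the ball because ε < r/2.
      have hψs : ContDiff ℝ ∞ fun y => ρ (x - y) :=
        hρ.contDiff.comp (contDiff_const.sub contDiff_id)
      have hψt : tsupport (fun y => ρ (x - y)) ⊆ Metric.closedBall x ε := by
        apply closure_minimal _ Metric.isClosed_closedBall
        intro y hy
        have := hρ.tsupport (subset_tsupport ρ hy)
        simpa [dist_eq_norm, norm_sub_rev] using this
      have hψc : HasCompactSupport fun y => ρ (x - y) :=
        HasCompactSupport.of_support_subset_isCompact (isCompact_closedBall x ε)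
          ((subset_tsupport _).trans hψt)
      have hψb : tsupport (fun y => ρ (x - y)) ⊆ Metric.ball x₁ r := by
        refine hψt.trans fun y hy => ?_
        rw [Metric.mem_closedBall] at hy
        rw [Metric.mem_ball] at hx ⊢
        linarith [dist_triangle y x x₁]
      have hpdψ : ∀ i y, pd i (fun y => ρ (x - y)) y = -pd i ρ (x - y) := fun i y => by
        have h1 : HasFDerivAt (fun y : Space d => x - y) (-ContinuousLinearMap.id ℝ (Space d)) y :=
          (hasFDerivAt_id y).const_sub x
        have h2 := ((differentiable_of_contDiff hρ.contDiff) (x - y)).hasFDerivAt.comp y h1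
        have h3 : (fun y => ρ (x - y)) = ρ ∘ fun y => x - y := rfl
        rw [pd, h3, h2.fderiv]
        simp [pd]
      have hw := hweak _ hψs hψc hψb
      have hintg : ∀ i, Integrable fun z => pd i ρ z * pd i V (x - z) := fun i =>
        (((contDiff_pd hρ.contDiff i).continuous).mul
          ((hpdc i).comp (by fun_prop))).integrable_of_hasCompactSupport
            (HasCompactSupport.mul_right (hρ.hasCompactSupport.fderiv_apply ℝ _))
      calc ∑ i, pd i (pd i W) x = ∑ i, ∫ z, pd i ρ z * pd i V (x - z) := by
            refine Finset.sum_congr rfl fun i _ => ?_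
            rw [hpd, hρ.pd_mollify_left (hpdc i)]
        _ = ∫ z, ∑ i, pd i ρ z * pd i V (x - z) := (integral_finsetSum _ fun i _ => hintg i).symm
        _ = ∫ y, ∑ i, pd i ρ (x - y) * pd i V y := by
            rw [← integral_sub_left_eq_self _ volume x]
            simp
        _ = -∫ y, ∑ i, pd i V y * pd i (fun y => ρ (x - y)) y := by
            rw [← integral_neg]
            refine integral_congr_ae (ae_of_all _ fun y => ?_)
            simp only [hpdψ, ← Finset.sum_neg_distrib]
            exact Finset.sum_congr rfl fun i _ => by ring
        _ = ∫ y, ρ (x - y) * (ℓ y - ∑ i, h i y * pd i V y) := by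
            rw [hw, ← integral_neg]
            refine integral_congr_ae (ae_of_all _ fun y => ?_)
            simp only []; ring
        _ = _ := by
            rw [← integral_sub_left_eq_self _ volume x]
            simp
    have hr : ∀ x ∈ Metric.ball x₁ (r / 2),
        ∑ i, pd i (pd i W) x + ∑ i, h i x * pd i W x - ℓ x = ∫ z, ρ z * F x z := by
      intro x hx
      have h1 : ∑ i, h i x * pd i W x = ∫ z, ρ z * ∑ i, h i x * pd i V (x - z) := by
        have : ∀ i, h i x * pd i W x = ∫ z, h i x * (ρ z * pd i V (x - z)) := fun i => by
          rw [integral_const_mul, hpd]; rfl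
        rw [Finset.sum_congr rfl fun i _ => this i, ← integral_finsetSum]
        · refine integral_congr_ae (ae_of_all _ fun z => ?_)
          simp only [Finset.mul_sum]
          exact Finset.sum_congr rfl fun i _ => by ring
        · exact fun i _ => (hρ.integrable_mul ((hpdc i).comp (by fun_prop))).const_mul _
      have h2 : ℓ x = ∫ z, ρ z * ℓ x := by rw [integral_mul_const, hρ.integral, one_mul]
      have i1 : Integrable fun z => ρ z * (ℓ (x - z) - ∑ i, h i (x - z) * pd i V (x - z)) :=
        hρ.integrable_mul (by fun_prop)
      have i2 : Integrable fun z => ρ z * ∑ i, h i x * pd i V (x - z) :=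
        hρ.integrable_mul (by fun_prop)
      rw [hlap x hx, h1]
      conv_lhs => rw [h2]
      have i3 : Integrable fun z => ρ z * (ℓ (x - z) - ∑ i, h i (x - z) * pd i V (x - z)) +
          ρ z * ∑ i, h i x * pd i V (x - z) := i1.add i2
      rw [← integral_add i1 i2, ← integral_sub i3 (hρ.integrable.mul_const _)]
      refine integral_congr_ae (ae_of_all _ fun z => ?_)
      simp only [hF, sub_mul, Finset.sum_sub_distrib]
      ring
    have hmem : ∀ x ∈ Metric.ball x₁ (r / 2), ∀ z : Space d, ‖z‖ ≤ ε →
        x ∈ Metric.closedBall x₁ r ∧ x - z ∈ Metric.closedBall x₁ r := by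
      intro x hx z hz
      rw [mem_ball_iff_norm] at hx
      rw [mem_closedBall_iff_norm, mem_closedBall_iff_norm]
      constructor
      · linarith [norm_nonneg z]
      · have : x - z - x₁ = (x - x₁) - z := by abel
        rw [this]
        linarith [norm_sub_le (x - x₁) z]
    have hFx : ∀ x ∈ Metric.ball x₁ (r / 2), ∀ z, ‖z‖ ≤ ε → |F x z| ≤ K * ε := by
      intro x hx z hz
      obtain ⟨m1, m2⟩ := hmem x hx z hz
      have e1 : |ℓ (x - z) - ℓ x| ≤ C₀ * ε := by
        refine (hℓ1 _ m2 _ m1).trans ?_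
        rw [sub_sub_cancel_left, norm_neg]
        exact mul_le_mul_of_nonneg_left hz hC₀
      have e2 : |∑ i, (h i (x - z) - h i x) * pd i V (x - z)| ≤ ∑ i, C i * A * ε := by
        refine (Finset.abs_sum_le_sum_abs _ _).trans (Finset.sum_le_sum fun i _ => ?_)
        rw [abs_mul]
        have e3 : |h i (x - z) - h i x| ≤ C i * ε := by
          refine (hh1 i _ m2 _ m1).trans ?_
          rw [sub_sub_cancel_left, norm_neg]
          exact mul_le_mul_of_nonneg_left hz (hC i)
        have e4 := abs_pd_le (hV.norm_fderiv_le (x - z)) i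
        calc _ ≤ C i * ε * A := mul_le_mul e3 e4 (abs_nonneg _) (mul_nonneg (hC i) hε.le)
          _ = _ := by ring
      rw [← Finset.sum_mul] at e2
      refine (abs_sub _ _).trans ((add_le_add e1 e2).trans ?_)
      rw [← add_mul]
      refine mul_le_mul_of_nonneg_right ?_ hε.le
      linarith
    have hFxy : ∀ x ∈ Metric.ball x₁ (r / 2), ∀ y ∈ Metric.ball x₁ (r / 2), ∀ z, ‖z‖ ≤ ε →
        |F x z - F y z| ≤ K * ε * ‖x - y‖ := by
      intro x hx y hy z hz
      obtain ⟨m1, m2⟩ := hmem x hx z hz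
      obtain ⟨m3, m4⟩ := hmem y hy z hz
      have hxy := norm_nonneg (x - y)
      have e1 : |ℓ (x - z) - ℓ x - (ℓ (y - z) - ℓ y)| ≤ C₀ * ε * ‖x - y‖ := by
        refine (hℓ2 x y z m1 m3 m2 m4).trans ?_
        gcongr
      have e2 : |∑ i, ((h i (x - z) - h i x - (h i (y - z) - h i y)) * pd i V (x - z)
          + (h i (y - z) - h i y) * (pd i V (x - z) - pd i V (y - z)))| ≤
          ∑ i, (C i * A + C i * B') * (ε * ‖x - y‖) := by
        refine (Finset.abs_sum_le_sum_abs _ _).trans (Finset.sum_le_sum fun i _ => ?_)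
        have e3 : |h i (x - z) - h i x - (h i (y - z) - h i y)| ≤ C i * ε * ‖x - y‖ := by
          refine (hh2 i x y z m1 m3 m2 m4).trans ?_
          have := hC i
          gcongr
        have e4 := abs_pd_le (hV.norm_fderiv_le (x - z)) i
        have e5 : |h i (y - z) - h i y| ≤ C i * ε := by
          refine (hh1 i _ m4 _ m3).trans ?_
          rw [sub_sub_cancel_left, norm_neg]
          exact mul_le_mul_of_nonneg_left hz (hC i)
        have e6 := hpdV (x - z) (y - z) i
        rw [sub_sub_sub_cancel_right] at e6
        have hCi := hC i
        refine (abs_add_le _ _).trans ?_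
        rw [abs_mul, abs_mul]
        calc _ ≤ C i * ε * ‖x - y‖ * A + C i * ε * (B' * ‖x - y‖) :=
              add_le_add (mul_le_mul e3 e4 (abs_nonneg _) (by positivity))
                (mul_le_mul e5 e6 (abs_nonneg _) (by positivity))
          _ = _ := by ring
      have e7 : F x z - F y z = (ℓ (x - z) - ℓ x - (ℓ (y - z) - ℓ y)) -
          ∑ i, ((h i (x - z) - h i x - (h i (y - z) - h i y)) * pd i V (x - z)
          + (h i (y - z) - h i y) * (pd i V (x - z) - pd i V (y - z))) := by
        have : ∑ i, ((h i (x - z) - h i x - (h i (y - z) - h i y)) * pd i V (x - z)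
          + (h i (y - z) - h i y) * (pd i V (x - z) - pd i V (y - z))) =
          ∑ i, (h i (x - z) - h i x) * pd i V (x - z) -
          ∑ i, (h i (y - z) - h i y) * pd i V (y - z) := by
          rw [← Finset.sum_sub_distrib]
          exact Finset.sum_congr rfl fun i _ => by ring
        rw [this]
        simp only [hF]; ring
      rw [← Finset.sum_mul, Finset.sum_add_distrib (f := fun i => C i * A)] at e2
      rw [e7]
      refine (abs_sub _ _).trans ((add_le_add e1 e2).trans ?_)
      have : C₀ * ε * ‖x - y‖ + (∑ i, C i * A + ∑ i, C i * B') * (ε * ‖x - y‖) =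
        (C₀ + (∑ i, C i * A + ∑ i, C i * B')) * (ε * ‖x - y‖) := by ring
      rw [this, mul_assoc]
      refine mul_le_mul_of_nonneg_right ?_ (by positivity)
      linarith
    have hK0 : 0 ≤ K := by linarith
    intro x hx
    refine ⟨?_, fun j => ?_⟩
    · rw [hr x hx]
      exact hρ.abs_integral_mul_le (hFx x hx)
    -- The derivative of the residual is bounded by its Lipschitz constant, which is read off from
    -- the increments of F.
    · have hlip : LipschitzOnWith (K * ε).toNNReal
          (fun y => ∑ i, pd i (pd i W) y + ∑ i, h i y * pd i W y - ℓ y)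
          (Metric.ball x₁ (r / 2)) := by
        refine LipschitzOnWith.of_dist_le_mul fun y hy y' hy' => ?_
        rw [Real.dist_eq, dist_eq_norm, hr y hy, hr y' hy',
          ← integral_sub (hρ.integrable_mul (hFc y)) (hρ.integrable_mul (hFc y')),
          Real.coe_toNNReal _ (by positivity)]
        simp_rw [← mul_sub]
        exact hρ.abs_integral_mul_le (hFxy y hy y' hy')
      have h1 := norm_fderiv_le_of_lipschitzOn ℝ (Metric.isOpen_ball.mem_nhds hx) hlip
      rw [Real.coe_toNNReal _ (by positivity)] at h1
      exact abs_pd_le h1 j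

/-! ### Second order conditions at a maximum of `|∇q|² - R` -/

section Bochner

variable {d : ℕ} {q : Space d → ℝ}

theorem pd_sum_sq_pd (hq : ContDiff ℝ ∞ q) (i : Fin d) (x : Space d) :
    pd i (fun y => ∑ j, pd j q y ^ 2) x = 2 * ∑ j, pd j q x * pd i (pd j q) x := by
  have hd := fun j => differentiable_of_contDiff (contDiff_pd hq j)
  rw [pd_sum _ fun j _ => ((hd j) x).fun_pow 2, Finset.mul_sum]
  refine Finset.sum_congr rfl fun j _ => ?_
  rw [pd_sq (hd j x)]; ring

theorem pd_pd_sum_sq_pd (hq : ContDiff ℝ ∞ q) (i : Fin d) (x : Space d) :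
    pd i (pd i (fun y => ∑ j, pd j q y ^ 2)) x =
      2 * ∑ j, (pd i (pd j q) x ^ 2 + pd j q x * pd i (pd i (pd j q)) x) := by
  have hd := fun j => differentiable_of_contDiff (contDiff_pd hq j)
  have hdd := fun j => differentiable_of_contDiff (contDiff_pd (contDiff_pd hq j) i)
  have h1 : pd i (fun y => ∑ j, pd j q y ^ 2) = fun x => 2 * ∑ j, pd j q x * pd i (pd j q) x :=
    funext fun y => pd_sum_sq_pd hq i y
  rw [h1, pd_const_mul (DifferentiableAt.fun_sum fun j _ => (hd j x).fun_mul (hdd j x)),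
    pd_sum _ fun j _ => (hd j x).fun_mul (hdd j x)]
  congr 1
  refine Finset.sum_congr rfl fun j _ => ?_
  rw [pd_mul (hd j x) (hdd j x)]; ring

/-- The Laplacian of `|∇q|²`, by Bochner's formula. -/
theorem sum_pd_pd_sum_sq_pd (hq : ContDiff ℝ ∞ q) (x : Space d) :
    ∑ i, pd i (pd i (fun y => ∑ j, pd j q y ^ 2)) x =
      2 * ∑ i, ∑ j, pd i (pd j q) x ^ 2 +
        2 * ∑ j, pd j q x * pd j (fun y => ∑ i, pd i (pd i q) y) x := by
  have h1 : ∀ j, pd j (fun y => ∑ i, pd i (pd i q) y) x = ∑ i, pd i (pd i (pd j q)) x := by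
    intro j
    rw [pd_sum _ fun i _ => differentiable_of_contDiff (contDiff_pd (contDiff_pd hq i) i) x]
    refine Finset.sum_congr rfl fun i _ => ?_
    have h2 : pd i (pd j q) = pd j (pd i q) := funext fun y => pd_comm hq i j y
    rw [pd_comm (contDiff_pd hq i), h2]
  simp_rw [pd_pd_sum_sq_pd hq, h1, Finset.sum_add_distrib, mul_add, Finset.sum_add_distrib,
    Finset.mul_sum]
  congr 1
  rw [Finset.sum_comm]

theorem fderiv_fderiv_apply_eq_sum {W : Space d → ℝ} (hW : ContDiff ℝ ∞ W) (x a : Space d) :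
    fderiv ℝ (fun y => fderiv ℝ W y a) x a = ∑ i, ∑ j, pd i (pd j W) x * a i * a j := by
  have h5 : (fun x => fderiv ℝ W x a) = fun x => ∑ j, a j * pd j W x := by
    funext y; exact fderiv_apply_eq_sum W y a
  rw [h5, fderiv_apply_eq_sum]
  refine Finset.sum_congr rfl fun i _ => ?_
  rw [pd_sum _ fun j _ => ((differentiable_of_contDiff (contDiff_pd hW j)) x).const_mul _,
    Finset.mul_sum]
  refine Finset.sum_congr rfl fun j _ => ?_
  rw [pd_const_mul ((differentiable_of_contDiff (contDiff_pd hW j)) x)]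
  ring

/-- `|x - c|²` in coordinates. -/
def sqDist (c x : Space d) : ℝ := ∑ i, (x i - c i) ^ 2

theorem sqDist_eq (c x : Space d) : sqDist c x = ‖x - c‖ ^ 2 := by
  rw [norm_sq_eq_sum]; rfl

theorem contDiff_sqDist (c : Space d) : ContDiff ℝ ∞ (sqDist c) :=
  ContDiff.sum fun i _ => ((contDiff_coord i).sub contDiff_const).pow 2

theorem pd_coord_sub (c : Space d) (i j : Fin d) (x : Space d) :
    pd i (fun y : Space d => y j - c j) x = if i = j then 1 else 0 := by
  rw [pd_sub (differentiable_of_contDiff (contDiff_coord j) x) (differentiableAt_const _),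
    pd_coord, pd_const, sub_zero]

theorem pd_sqDist (c : Space d) (i : Fin d) (x : Space d) :
    pd i (sqDist c) x = 2 * (x i - c i) := by
  have hd : ∀ j : Fin d, DifferentiableAt ℝ (fun y : Space d => y j - c j) x := fun j =>
    (differentiable_of_contDiff (contDiff_coord j) x).sub_const _
  have h : sqDist c = fun y => ∑ j, (y j - c j) ^ 2 := rfl
  rw [h, pd_sum _ fun j _ => (hd j).fun_pow 2,
    Finset.sum_congr rfl fun j _ => pd_sq (hd j) i]
  simp [pd_coord_sub]

theorem pd_sqDist_sq (c : Space d) (i : Fin d) (x : Space d) :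
    pd i (fun y => sqDist c y ^ 2) x = 4 * sqDist c x * (x i - c i) := by
  rw [pd_sq (differentiable_of_contDiff (contDiff_sqDist c) x), pd_sqDist]; ring

theorem pd_pd_sqDist_sq (c : Space d) (i : Fin d) (x : Space d) :
    pd i (pd i (fun y => sqDist c y ^ 2)) x = 8 * (x i - c i) ^ 2 + 4 * sqDist c x := by
  have h : pd i (fun y => sqDist c y ^ 2) = fun x => 4 * sqDist c x * (x i - c i) :=
    funext fun y => pd_sqDist_sq c i y
  have hs := differentiable_of_contDiff (contDiff_sqDist c) x
  rw [h, pd_mul (hs.const_mul 4) ((differentiable_of_contDiff (contDiff_coord i) x).sub_const _),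
    pd_const_mul hs, pd_sqDist, pd_coord_sub]
  simp; ring

end Bochner

/-- First and second order conditions at a local maximum of `|∇(S + V)|² - R`, where `V` is only
`C^{1,1}` but `S + V` solves `Δq + h·∇q = k` weakly. The matrix `H` plays the role of the Hessian
of `S + V`. -/
theorem exists_hessian_of_isLocalMax {d : ℕ} {V : Space d → ℝ} {A B : ℝ}
    (hV : HasBoundedDerivatives V A B) {S k R : Space d → ℝ} {h : Fin d → Space d → ℝ}
    (hS : ContDiff ℝ ∞ S) (hk : ContDiff ℝ ∞ k) (hR : ContDiff ℝ ∞ R)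
    (hh : ∀ i, ContDiff ℝ ∞ (h i)) {x₁ : Space d} {r : ℝ} (hr : 0 < r)
    (hweak : ∀ ψ : Space d → ℝ, ContDiff ℝ ∞ ψ → HasCompactSupport ψ →
      tsupport ψ ⊆ Metric.ball x₁ r →
        ∫ x, ∑ i, (pd i S x + pd i V x) * pd i ψ x =
          ∫ x, (∑ i, h i x * (pd i S x + pd i V x) - k x) * ψ x)
    (hmax : IsLocalMax (fun x => ∑ i, (pd i S x + pd i V x) ^ 2 - R x) x₁) :
    ∃ H : Fin d → Fin d → ℝ, (∀ i j, H i j = H j i) ∧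
      ∑ i, H i i + ∑ i, h i x₁ * (pd i S x₁ + pd i V x₁) = k x₁ ∧
      (∀ i, 2 * ∑ j, (pd j S x₁ + pd j V x₁) * H i j = pd i R x₁) ∧
      2 * ∑ i, ∑ j, H i j ^ 2 + 2 * ∑ j, (pd j S x₁ + pd j V x₁) * (pd j k x₁ -
        ∑ i, (pd j (h i) x₁ * (pd i S x₁ + pd i V x₁) + h i x₁ * H j i)) ≤
          ∑ i, pd i (pd i R) x₁ ∧
      ∀ a : Space d, |∑ i, ∑ j, (H i j - pd i (pd j S) x₁) * a i * a j| ≤ B * ‖a‖ ^ 2 := by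
  have hVc := hV.continuous_fderiv
  have hpdV : ∀ i, Continuous (pd i V) := fun i => hVc.clm_apply continuous_const
  have hSd := fun i => contDiff_pd hS i
  have hSdd := fun i j => contDiff_pd (contDiff_pd hS j) i
  have hpdS : ∀ i, Continuous (pd i S) := fun i => (hSd i).continuous
  have hpdR : ∀ i, Continuous (pd i R) := fun i => (contDiff_pd hR i).continuous
  have hpdk : ∀ i, Continuous (pd i k) := fun i => (contDiff_pd hk i).continuous
  have hpdh : ∀ i j, Continuous (pd i (h j)) := fun i j => (contDiff_pd (hh j) i).continuous
  have hhc : ∀ i, Continuous (h i) := fun i => (hh i).continuous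
  -- Subtracting the smooth part S from the equation for S + V leaves ΔV + h·∇V = ℓ, with ℓ smooth.
  set ℓ : Space d → ℝ := fun x => k x - ∑ i, h i x * pd i S x - ∑ i, pd i (pd i S) x with hℓdef
  have hℓ : ContDiff ℝ ∞ ℓ :=
    (hk.sub (ContDiff.sum fun i _ => (hh i).mul (hSd i))).sub
      (ContDiff.sum fun i _ => hSdd i i)
  have hweakV : ∀ ψ : Space d → ℝ, ContDiff ℝ ∞ ψ → HasCompactSupport ψ →
      tsupport ψ ⊆ Metric.ball x₁ r →
        ∫ x, ∑ i, pd i V x * pd i ψ x = ∫ x, (∑ i, h i x * pd i V x - ℓ x) * ψ x := by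
    intro ψ hψ hψc hψt
    have hpdψ : ∀ i, Continuous (pd i ψ) := fun i => (contDiff_pd hψ i).continuous
    have hpdψc : ∀ i, HasCompactSupport (pd i ψ) := fun i => hψc.fderiv_apply ℝ _
    have iS : ∀ i, Integrable fun x => pd i S x * pd i ψ x := fun i =>
      ((hpdS i).mul (hpdψ i)).integrable_of_hasCompactSupport (hpdψc i).mul_left
    have iV : ∀ i, Integrable fun x => pd i V x * pd i ψ x := fun i =>
      ((hpdV i).mul (hpdψ i)).integrable_of_hasCompactSupport (hpdψc i).mul_left
    have iΔ : ∀ i, Integrable fun x => pd i (pd i S) x * ψ x := fun i =>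
      ((hSdd i i).continuous.mul hψ.continuous).integrable_of_hasCompactSupport hψc.mul_left
    have e1 : ∫ x, ∑ i, pd i S x * pd i ψ x = -∫ x, (∑ i, pd i (pd i S) x) * ψ x := by
      simp_rw [Finset.sum_mul]
      rw [integral_finsetSum _ fun i _ => iS i, integral_finsetSum _ fun i _ => iΔ i,
        ← Finset.sum_neg_distrib]
      refine Finset.sum_congr rfl fun i _ => ?_
      exact integral_mul_fderiv_of_tsupport (hψ.of_le (by simp)) hψc
        (fun x _ => ((hSd i).of_le (by simp)).contDiffAt) _
    have e2 : ∫ x, ∑ i, pd i V x * pd i ψ x =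
        (∫ x, ∑ i, (pd i S x + pd i V x) * pd i ψ x) - ∫ x, ∑ i, pd i S x * pd i ψ x := by
      have j1 : Integrable fun x => ∑ i, (pd i S x + pd i V x) * pd i ψ x :=
        integrable_finsetSum _ fun i _ => by
          simp only [add_mul]; exact (iS i).add (iV i)
      rw [← integral_sub j1 (integrable_finsetSum _ fun i _ => iS i)]
      refine integral_congr_ae (ae_of_all _ fun x => ?_)
      simp only [← Finset.sum_sub_distrib]
      exact Finset.sum_congr rfl fun i _ => by ring
    rw [e2, hweak ψ hψ hψc hψt, e1, sub_neg_eq_add, ← integral_add]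
    · refine integral_congr_ae (ae_of_all _ fun x => ?_)
      simp only [hℓdef, mul_add, Finset.sum_add_distrib]
      ring
    · exact Continuous.integrable_of_hasCompactSupport
        (((continuous_finsetSum _ fun i _ => (hhc i).mul ((hpdS i).add (hpdV i))).sub
          hk.continuous).mul hψ.continuous) hψc.mul_left
    · exact Continuous.integrable_of_hasCompactSupport
        ((continuous_finsetSum _ fun i _ => (hSdd i i).continuous).mul hψ.continuous) hψc.mul_left
  obtain ⟨K, hK⟩ := exists_smooth_approximation hV hℓ hh hweakV
  -- a closed ball on which `x₁` is a maximum
  obtain ⟨r₁, hr₁, hr₁r, hmax₁⟩ : ∃ r₁ > 0, r₁ < r / 2 ∧ ∀ x ∈ Metric.closedBall x₁ r₁,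
      ∑ i, (pd i S x + pd i V x) ^ 2 - R x ≤ ∑ i, (pd i S x₁ + pd i V x₁) ^ 2 - R x₁ := by
    obtain ⟨s, hs, hs'⟩ := Metric.eventually_nhds_iff.1 hmax
    refine ⟨min (s / 2) (r / 4), by positivity, ?_, fun x hx => hs' ?_⟩
    · exact (min_le_right _ _).trans_lt (by linarith)
    · rw [Metric.mem_closedBall] at hx
      exact hx.trans_lt ((min_le_left _ _).trans_lt (by linarith))
  have hcpt : IsCompact (Metric.closedBall x₁ r₁) := isCompact_closedBall _ _
  obtain ⟨G, hG⟩ : ∃ G : ℝ, ∀ x ∈ Metric.closedBall x₁ r₁, ∀ i, |pd i S x + pd i V x| ≤ G := by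
    have : ∀ i, ∃ G : ℝ, ∀ x ∈ Metric.closedBall x₁ r₁, |pd i S x + pd i V x| ≤ G := fun i => by
      obtain ⟨G, hG⟩ := hcpt.exists_bound_of_continuousOn ((hpdS i).add (hpdV i)).continuousOn
      exact ⟨G, fun x hx => by simpa using hG x hx⟩
    choose G hG using this
    refine ⟨∑ i, |G i|, fun x hx i => (hG i x hx).trans ((le_abs_self _).trans ?_)⟩
    exact Finset.single_le_sum (f := fun i => |G i|) (fun j _ => abs_nonneg _) (Finset.mem_univ i)
  set ε : ℕ → ℝ := fun m => r / 4 / ((m : ℝ) + 1) with hεdef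
  have hε0 : ∀ m, 0 < ε m := fun m => by positivity
  have hεr : ∀ m, ε m < r / 2 := fun m => by
    have : ε m ≤ r / 4 := div_le_self (by positivity) (by linarith [m.cast_nonneg (α := ℝ)])
    linarith
  have hεlim : Tendsto ε atTop (𝓝 0) := by
    have := (tendsto_one_div_add_atTop_nhds_zero_nat (𝕜 := ℝ)).const_mul (r / 4)
    simpa [hεdef, div_eq_mul_inv] using this
  choose W hWs hW1 hW2 hW3 using fun m => hK (ε m) (hε0 m) (hεr m)
  set q : ℕ → Space d → ℝ := fun m x => S x + W m x with hqdef
  have hq : ∀ m, ContDiff ℝ ∞ (q m) := fun m => hS.add (hWs m)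
  have hpdq : ∀ m i, pd i (q m) = fun x => pd i S x + pd i (W m) x := fun m i =>
    funext fun x => pd_add (differentiable_of_contDiff hS x)
      (differentiable_of_contDiff (hWs m) x) i
  have hpdpdq : ∀ m i j, pd i (pd j (q m)) = fun x => pd i (pd j S) x + pd i (pd j (W m)) x :=
    fun m i j => by
      rw [hpdq]
      exact funext fun x => pd_add (differentiable_of_contDiff (hSd j) x)
        (differentiable_of_contDiff (contDiff_pd (hWs m) j) x) i
  -- The penalty |x - x₁|⁴ forces the maximum points of the approximations to converge to x₁. Its
  -- first and second derivatives vanish at x₁, so it leaves no trace in the limit.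
  set Φ : ℕ → Space d → ℝ := fun m x =>
    ∑ i, pd i (q m) x ^ 2 - R x - sqDist x₁ x ^ 2 with hΦdef
  have hQs : ∀ m, ContDiff ℝ ∞ fun x => ∑ i, pd i (q m) x ^ 2 := fun m =>
    ContDiff.sum fun i _ => (contDiff_pd (hq m) i).pow 2
  have hΦs : ∀ m, ContDiff ℝ ∞ (Φ m) := fun m =>
    ((hQs m).sub hR).sub ((contDiff_sqDist x₁).pow 2)
  have hex : ∀ m, ∃ x ∈ Metric.closedBall x₁ r₁, ∀ y ∈ Metric.closedBall x₁ r₁, Φ m y ≤ Φ m x :=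
    fun m => hcpt.exists_isMaxOn ⟨x₁, Metric.mem_closedBall_self hr₁.le⟩
      (hΦs m).continuous.continuousOn
  choose x hxm hxmax using hex
  -- the maximum points converge to `x₁`
  have hx1lim : Tendsto (fun m => sqDist x₁ (x m) ^ 2) atTop (𝓝 0) := by
    have hcl : ∀ m, ∀ y ∈ Metric.closedBall x₁ r₁,
        |∑ i, pd i (q m) y ^ 2 - ∑ i, (pd i S y + pd i V y) ^ 2| ≤
          ∑ _i : Fin d, (K * ε m) * (2 * G + K * ε m) := by
      intro m y hy
      rw [← Finset.sum_sub_distrib]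
      refine (Finset.abs_sum_le_sum_abs _ _).trans (Finset.sum_le_sum fun i _ => ?_)
      have h1 := hW1 m y i
      have h2 := hG y hy i
      have h3 : pd i (q m) y ^ 2 - (pd i S y + pd i V y) ^ 2 =
          (pd i (W m) y - pd i V y) *
            (2 * (pd i S y + pd i V y) + (pd i (W m) y - pd i V y)) := by
        rw [hpdq]; ring
      rw [h3, abs_mul]
      refine mul_le_mul h1 ((abs_add_le _ _).trans (add_le_add ?_ h1)) (abs_nonneg _)
        ((abs_nonneg _).trans h1)
      rw [abs_mul, abs_two]; linarith
    have hbd : ∀ m, sqDist x₁ (x m) ^ 2 ≤ 2 * ∑ _i : Fin d, (K * ε m) * (2 * G + K * ε m) := by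
      intro m
      have h0 : x₁ ∈ Metric.closedBall x₁ r₁ := Metric.mem_closedBall_self hr₁.le
      have h1 := hxmax m x₁ h0
      have h2 := abs_le.1 (hcl m (x m) (hxm m))
      have h3 := abs_le.1 (hcl m x₁ h0)
      have h4 := hmax₁ (x m) (hxm m)
      have h5 : sqDist x₁ x₁ = 0 := by simp [sqDist]
      simp only [hΦdef, h5] at h1
      linarith [h2.2, h3.1]
    have hlim : Tendsto (fun m => 2 * ∑ _i : Fin d, (K * ε m) * (2 * G + K * ε m)) atTop (𝓝 0) := by
      have h1 : Tendsto (fun m => K * ε m) atTop (𝓝 0) := by simpa using hεlim.const_mul K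
      have h2 := h1.mul (h1.const_add (2 * G))
      have h3 := (tendsto_finsetSum (Finset.univ : Finset (Fin d)) fun i _ => h2).const_mul 2
      simpa using h3
    exact squeeze_zero (fun m => sq_nonneg _) hbd hlim
  have hNlim : Tendsto (fun m => sqDist x₁ (x m)) atTop (𝓝 0) := by
    have h1 := (Real.continuous_sqrt.tendsto 0).comp hx1lim
    rw [Real.sqrt_zero] at h1
    refine h1.congr fun m => ?_
    have : 0 ≤ sqDist x₁ (x m) := by rw [sqDist_eq]; positivity
    simp [Real.sqrt_sq this]
  have hxlim : Tendsto x atTop (𝓝 x₁) := by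
    rw [tendsto_iff_norm_sub_tendsto_zero]
    have h1 := (Real.continuous_sqrt.tendsto 0).comp hNlim
    rw [Real.sqrt_zero] at h1
    refine h1.congr fun m => ?_
    simp [sqDist_eq]
  have hlocmax : ∀ᶠ m in atTop, IsLocalMax (Φ m) (x m) := by
    filter_upwards [hxlim.eventually (Metric.ball_mem_nhds x₁ hr₁)] with m hm
    filter_upwards [Metric.isOpen_ball.mem_nhds hm] with y hy
    exact hxmax m y (Metric.ball_subset_closedBall hy)
  -- extract a limit of the Hessians
  obtain ⟨M, -, φ, hφ, hMlim⟩ := tendsto_subseq_of_bounded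
    (x := fun m => (fun i j => pd i (pd j (W m)) (x m) : Fin d → Fin d → ℝ))
    (s := Metric.closedBall 0 |B|) Metric.isBounded_closedBall (fun m => by
      rw [mem_closedBall_zero_iff, pi_norm_le_iff_of_nonneg (abs_nonneg B)]
      intro i
      rw [pi_norm_le_iff_of_nonneg (abs_nonneg B)]
      intro j
      have h1 := hW2 m (x m) (EuclideanSpace.single j 1)
      have h2 := abs_pd_le h1 i
      simp only [PiLp.norm_single, norm_one, mul_one] at h2
      exact h2.trans (le_abs_self B))
  have hMlim' : ∀ i j, Tendsto (fun m => pd i (pd j (W (φ m))) (x (φ m))) atTop (𝓝 (M i j)) :=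
    fun i j => (tendsto_pi_nhds.1 (tendsto_pi_nhds.1 hMlim i)) j
  have hyx : Tendsto (fun m => x (φ m)) atTop (𝓝 x₁) := hxlim.comp hφ.tendsto_atTop
  have hεφ : Tendsto (fun m => K * ε (φ m)) atTop (𝓝 0) := by
    simpa using (hεlim.comp hφ.tendsto_atTop).const_mul K
  have hNφ : Tendsto (fun m => sqDist x₁ (x (φ m))) atTop (𝓝 0) := hNlim.comp hφ.tendsto_atTop
  have hc : ∀ {f : Space d → ℝ}, Continuous f → Tendsto (fun m => f (x (φ m))) atTop (𝓝 (f x₁)) :=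
    fun hf => (hf.tendsto x₁).comp hyx
  have hglim : ∀ i, Tendsto (fun m => pd i (q (φ m)) (x (φ m))) atTop
      (𝓝 (pd i S x₁ + pd i V x₁)) := by
    intro i
    have h1 : Tendsto (fun m => pd i (W (φ m)) (x (φ m)) - pd i V (x (φ m))) atTop (𝓝 0) :=
      squeeze_zero_norm (fun m => hW1 (φ m) (x (φ m)) i) hεφ
    have h2 := (hc (hpdS i)).add (h1.add (hc (hpdV i)))
    rw [zero_add] at h2
    refine h2.congr fun m => ?_
    rw [hpdq]; ring
  set H : Fin d → Fin d → ℝ := fun i j => pd i (pd j S) x₁ + M i j with hHdef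
  have hHlim : ∀ i j, Tendsto (fun m => pd i (pd j (q (φ m))) (x (φ m))) atTop (𝓝 (H i j)) := by
    intro i j
    refine ((hc (hSdd i j).continuous).add (hMlim' i j)).congr fun m => ?_
    rw [hpdpdq]
  set res : ℕ → Space d → ℝ := fun m y =>
    ∑ i, pd i (pd i (W m)) y + ∑ i, h i y * pd i (W m) y - ℓ y with hresdef
  have hress : ∀ m, ContDiff ℝ ∞ (res m) := fun m =>
    ((ContDiff.sum fun i _ => contDiff_pd (contDiff_pd (hWs m) i) i).add
      (ContDiff.sum fun i _ => (hh i).mul (contDiff_pd (hWs m) i))).sub hℓ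
  have hxball : ∀ m, x m ∈ Metric.ball x₁ (r / 2) := fun m =>
    Metric.closedBall_subset_ball hr₁r (hxm m)
  have hres0 : Tendsto (fun m => res (φ m) (x (φ m))) atTop (𝓝 0) :=
    squeeze_zero_norm (fun m => (hW3 (φ m) _ (hxball (φ m))).1) hεφ
  have hres1 : ∀ j, Tendsto (fun m => pd j (res (φ m)) (x (φ m))) atTop (𝓝 0) := fun j =>
    squeeze_zero_norm (fun m => (hW3 (φ m) _ (hxball (φ m))).2 j) hεφ
  -- The third derivatives of q in Bochner's formula occur only as ∇Δq. The equation turns them into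
  -- second derivatives of q and the gradient of the residual, which tends to zero.
  have hlap : ∀ m y, ∑ i, pd i (pd i (q m)) y = res m y + k y - ∑ i, h i y * pd i (q m) y := by
    intro m y
    simp only [hpdpdq m]
    simp only [hpdq, hresdef, hℓdef, Finset.sum_add_distrib, mul_add]
    ring
  have hlapd : ∀ m j y, pd j (fun y => ∑ i, pd i (pd i (q m)) y) y = pd j (res m) y + pd j k y -
      ∑ i, (pd j (h i) y * pd i (q m) y + h i y * pd j (pd i (q m)) y) := by
    intro m j y
    have dres := differentiable_of_contDiff (hress m) y
    have dk := differentiable_of_contDiff hk y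
    have dh := fun i => differentiable_of_contDiff (hh i) y
    have dq := fun i => differentiable_of_contDiff (contDiff_pd (hq m) i) y
    rw [funext (hlap m), pd_sub (dres.fun_add dk)
      (DifferentiableAt.fun_sum fun i _ => (dh i).fun_mul (dq i)), pd_add dres dk,
      pd_sum _ fun i _ => (dh i).fun_mul (dq i)]
    congr 1
    exact Finset.sum_congr rfl fun i _ => pd_mul (dh i) (dq i) j
  refine ⟨H, fun i j => ?_, ?_, fun i => ?_, ?_, fun a => ?_⟩
  · refine tendsto_nhds_unique (hHlim i j) ((hHlim j i).congr fun m => ?_)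
    exact pd_comm (hq _) j i _
  · have h1 := (tendsto_finsetSum Finset.univ fun i _ => hHlim i i).add
      (tendsto_finsetSum Finset.univ fun i _ => (hc (hhc i)).mul (hglim i))
    have h2 := hres0.add (hc hk.continuous)
    rw [zero_add] at h2
    refine tendsto_nhds_unique h1 (h2.congr fun m => ?_)
    rw [hlap]; ring
  · have h1 := (tendsto_finsetSum Finset.univ fun j _ => (hglim j).mul (hHlim i j)).const_mul 2
    have h2 := (hc (hpdR i)).add ((hNφ.const_mul 4).mul (hc
      ((contDiff_coord i).continuous.sub (continuous_const (y := x₁ i)))))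
    simp only [mul_zero, zero_mul, add_zero] at h2
    simp only [Pi.sub_apply] at h2
    refine tendsto_nhds_unique h1 (h2.congr' ?_)
    filter_upwards [hφ.tendsto_atTop.eventually hlocmax] with m hm
    have h3 := pd_eq_zero_of_isLocalMax hm i
    simp only [hΦdef] at h3
    rw [pd_sub ((differentiable_of_contDiff ((hQs _).sub hR)) _)
      (differentiable_of_contDiff ((contDiff_sqDist x₁).pow 2) _),
      pd_sub ((differentiable_of_contDiff (hQs _)) _) (differentiable_of_contDiff hR _),
      pd_sum_sq_pd (hq _), pd_sqDist_sq] at h3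
    linarith
  · have h1 := ((tendsto_finsetSum Finset.univ fun i _ => tendsto_finsetSum Finset.univ fun j _ =>
      (hHlim i j).pow 2).const_mul 2).add ((tendsto_finsetSum Finset.univ fun j _ =>
        (hglim j).mul (((hres1 j).add (hc (hpdk j))).sub (tendsto_finsetSum Finset.univ fun i _ =>
          ((hc (hpdh j i)).mul (hglim i)).add ((hc (hhc i)).mul (hHlim j i))))).const_mul 2)
    simp only [zero_add] at h1
    -- The factor 8 + 4d comes from Δ|x - x₁|⁴ = (8 + 4d)|x - x₁|².
    have h2 := (tendsto_finsetSum Finset.univ fun i _ =>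
      hc (contDiff_pd (contDiff_pd hR i) i).continuous).add
        (hNφ.const_mul (8 + 4 * (d : ℝ)))
    rw [mul_zero, add_zero] at h2
    refine le_of_tendsto_of_tendsto h1 h2 ?_
    filter_upwards [hφ.tendsto_atTop.eventually hlocmax] with m hm
    have h3 : ∑ i, pd i (pd i (Φ (φ m))) (x (φ m)) ≤ 0 :=
      Finset.sum_nonpos fun i _ => pd_pd_nonpos_of_isLocalMax (hΦs _) hm i
    have hQ' := fun i => contDiff_pd (hQs (φ m)) i
    have hR' := fun i => contDiff_pd hR i
    have hN' := fun i => contDiff_pd ((contDiff_sqDist x₁).pow 2) i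
    have e1 : ∀ i, pd i (Φ (φ m)) = fun y => pd i (fun y => ∑ i, pd i (q (φ m)) y ^ 2) y -
        pd i R y - pd i (fun y => sqDist x₁ y ^ 2) y := fun i => funext fun y => by
      simp only [hΦdef]
      rw [pd_sub ((differentiable_of_contDiff ((hQs _).sub hR)) _)
        (differentiable_of_contDiff ((contDiff_sqDist x₁).pow 2) _),
        pd_sub ((differentiable_of_contDiff (hQs _)) _) (differentiable_of_contDiff hR _)]
    have e2 : ∀ i, pd i (pd i (Φ (φ m))) (x (φ m)) =
        pd i (pd i (fun y => ∑ i, pd i (q (φ m)) y ^ 2)) (x (φ m)) - pd i (pd i R) (x (φ m)) -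
        pd i (pd i (fun y => sqDist x₁ y ^ 2)) (x (φ m)) := fun i => by
      rw [e1, pd_sub ((differentiable_of_contDiff ((hQ' i).sub (hR' i))) _)
        (differentiable_of_contDiff (hN' i) _),
        pd_sub ((differentiable_of_contDiff (hQ' i)) _) (differentiable_of_contDiff (hR' i) _)]
    simp only [e2, Finset.sum_sub_distrib, sum_pd_pd_sum_sq_pd (hq _), pd_pd_sqDist_sq,
      Finset.sum_add_distrib, ← Finset.mul_sum, Finset.sum_const, Finset.card_univ,
      Fintype.card_fin, nsmul_eq_mul, hlapd] at h3
    have e3 : ∑ i, (x (φ m) i - x₁ i) ^ 2 = sqDist x₁ (x (φ m)) := rfl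
    rw [e3] at h3
    simp only [Finset.sum_add_distrib] at h3 ⊢
    linarith
  · have h1 : Tendsto (fun m => |∑ i, ∑ j, pd i (pd j (W (φ m))) (x (φ m)) * a i * a j|) atTop
        (𝓝 |∑ i, ∑ j, (H i j - pd i (pd j S) x₁) * a i * a j|) := by
      refine (tendsto_finsetSum Finset.univ fun i _ => tendsto_finsetSum Finset.univ fun j _ =>
        ?_).abs
      have : H i j - pd i (pd j S) x₁ = M i j := by simp [hHdef]
      rw [this]
      exact ((hMlim' i j).mul_const _).mul_const _
    refine le_of_tendsto' h1 fun m => ?_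
    rw [← fderiv_fderiv_apply_eq_sum (hWs _)]
    have h2 := ContinuousLinearMap.le_of_opNorm_le _ (hW2 (φ m) (x (φ m)) a) a
    rw [Real.norm_eq_abs] at h2
    exact h2.trans (le_of_eq (by ring))

/-! ### The differential inequality at a spatial maximum -/

theorem sum_sum_const_mul {d : ℕ} (c : ℝ) (f : Fin d → Fin d → ℝ) :
    ∑ i, ∑ j, c * f i j = c * ∑ i, ∑ j, f i j := by
  simp only [Finset.mul_sum]

/-- The condition on H g fixes every entry of H in which the direction g takes part; these
contribute β²G|h|²/2 - β²c²/4. On the orthogonal complement of g, of dimension d - 1, a matrix A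
satisfies |A|² ≥ 2μ tr A - (d-1)μ². Both parts are obtained at once by expanding |H + (β/2)(h⊗g +
g⊗h) + η g⊗g - μ I|² ≥ 0, where η is chosen so that this matrix annihilates g. The multiplier μ =
γc/2 is the one for which the trace terms cancel in the evolution inequality. -/
theorem sum_sq_ge_of_mulVec_eq {d : ℕ} {H : Fin d → Fin d → ℝ} {g h : Fin d → ℝ}
    {G h2 c β γ : ℝ} (hsymm : ∀ i j, H i j = H j i) (hG : ∑ i, g i ^ 2 = G)
    (hh : ∑ i, h i ^ 2 = h2) (hc : ∑ i, h i * g i = c) (hG0 : G ≠ 0)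
    (hHg : ∀ i, 2 * ∑ j, g j * H i j = -(β * G * h i)) :
    β ^ 2 * G * h2 / 2 - β ^ 2 * c ^ 2 / 4 + γ * c * (∑ i, H i i + β * c / 2)
      - γ ^ 2 * c ^ 2 * ((d : ℝ) - 1) / 4 ≤ ∑ i, ∑ j, H i j ^ 2 := by
  set μ := γ * c / 2 with hμ
  set η := (μ - β / 2 * c) / G with hη
  have hηG : η * G = μ - β / 2 * c := by rw [hη]; field_simp
  have s1 : ∑ i, ∑ j, H i j * h i * g j = -(β * G * h2 / 2) := by
    have : ∀ i, ∑ j, H i j * h i * g j = -(β * G / 2) * h i ^ 2 := fun i => by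
      have := hHg i
      calc ∑ j, H i j * h i * g j = h i * ∑ j, g j * H i j := by
            rw [Finset.mul_sum]; exact Finset.sum_congr rfl fun j _ => by ring
        _ = _ := by linear_combination h i / 2 * this
    simp_rw [this, ← Finset.mul_sum, hh]; ring
  have s2 : ∑ i, ∑ j, H i j * g i * h j = -(β * G * h2 / 2) := by
    rw [Finset.sum_comm, ← s1]
    exact Finset.sum_congr rfl fun i _ => Finset.sum_congr rfl fun j _ => by
      rw [hsymm j i]; ring
  have s3 : ∑ i, ∑ j, H i j * g i * g j = -(β * G * c / 2) := by
    have : ∀ i, ∑ j, H i j * g i * g j = -(β * G / 2) * (h i * g i) := fun i => by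
      have := hHg i
      calc ∑ j, H i j * g i * g j = g i * ∑ j, g j * H i j := by
            rw [Finset.mul_sum]; exact Finset.sum_congr rfl fun j _ => by ring
        _ = _ := by linear_combination g i / 2 * this
    simp_rw [this, ← Finset.mul_sum, hc]; ring
  have p1 : ∑ i, ∑ j, h i ^ 2 * g j ^ 2 = h2 * G := by
    rw [← Finset.sum_mul_sum, hh, hG]
  have p2 : ∑ i, ∑ j, g i ^ 2 * h j ^ 2 = G * h2 := by
    rw [← Finset.sum_mul_sum, hh, hG]
  have p3 : ∑ i, ∑ j, (h i * g i) * (h j * g j) = c * c := by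
    rw [← Finset.sum_mul_sum, hc]
  have p4 : ∑ i, ∑ j, g i ^ 2 * g j ^ 2 = G * G := by
    rw [← Finset.sum_mul_sum, hG]
  have p5 : ∑ i, ∑ j, (h i * g i) * g j ^ 2 = c * G := by
    rw [← Finset.sum_mul_sum, hc, hG]
  have p6 : ∑ i, ∑ j, g i ^ 2 * (h j * g j) = G * c := by
    rw [← Finset.sum_mul_sum, hc, hG]
  have d1 : ∑ i, ∑ j, (if i = j then (1 : ℝ) else 0) * H i j = ∑ i, H i i := by simp
  have d2 : ∑ i, ∑ j, (if i = j then (1 : ℝ) else 0) * (h i * g j) = c := by simp [hc]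
  have d3 : ∑ i, ∑ j, (if i = j then (1 : ℝ) else 0) * (g i * h j) = c := by
    simp [← hc, mul_comm]
  have d4 : ∑ i, ∑ j, (if i = j then (1 : ℝ) else 0) * (g i * g j) = G := by
    simp [← hG, sq]
  have d5 : ∑ i : Fin d, ∑ j, (if i = j then (1 : ℝ) else 0) = d := by simp
  have hnn : 0 ≤ ∑ i, ∑ j, (H i j + β / 2 * (h i * g j + g i * h j) + η * (g i * g j)
      - μ * (if i = j then (1 : ℝ) else 0)) ^ 2 :=
    Finset.sum_nonneg fun i _ => Finset.sum_nonneg fun j _ => sq_nonneg _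
  have hexp : ∀ i j, (H i j + β / 2 * (h i * g j + g i * h j) + η * (g i * g j)
      - μ * (if i = j then (1 : ℝ) else 0)) ^ 2 =
      H i j ^ 2 + β * (H i j * h i * g j) + β * (H i j * g i * h j)
      + (2 * η) * (H i j * g i * g j)
      + (-(2 * μ)) * ((if i = j then (1 : ℝ) else 0) * H i j)
      + (β ^ 2 / 4) * (h i ^ 2 * g j ^ 2) + (β ^ 2 / 4) * (g i ^ 2 * h j ^ 2)
      + (β ^ 2 / 2) * ((h i * g i) * (h j * g j)) + η ^ 2 * (g i ^ 2 * g j ^ 2)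
      + (β * η) * ((h i * g i) * g j ^ 2) + (β * η) * (g i ^ 2 * (h j * g j))
      + (-(β * μ)) * ((if i = j then (1 : ℝ) else 0) * (h i * g j))
      + (-(β * μ)) * ((if i = j then (1 : ℝ) else 0) * (g i * h j))
      + (-(2 * η * μ)) * ((if i = j then (1 : ℝ) else 0) * (g i * g j))
      + μ ^ 2 * (if i = j then (1 : ℝ) else 0) := by
    intro i j
    split_ifs <;> ring
  simp only [hexp, Finset.sum_add_distrib, sum_sum_const_mul, s1, s2, s3, p1, p2, p3, p4, p5, p6,
    d1, d2, d3, d4, d5] at hnn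
  have e : η ^ 2 * (G * G) = (μ - β / 2 * c) ^ 2 := by rw [← hηG]; ring
  have e2 : 2 * η * -(β * G * c / 2) = -(β * c) * (μ - β / 2 * c) := by rw [← hηG]; ring
  have e3 : β * η * (c * G) = β * c * (μ - β / 2 * c) := by rw [← hηG]; ring
  have e4 : β * η * (G * c) = β * c * (μ - β / 2 * c) := by rw [← hηG]; ring
  have e5 : -(2 * η * μ) * G = -(2 * μ) * (μ - β / 2 * c) := by rw [← hηG]; ring
  rw [e, e2, e3, e4, e5] at hnn
  rw [hμ] at hnn
  nlinarith [hnn]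

/-- The left side is the time derivative of w divided by n^β, with k = ∂ₜL. The second order
condition bounds g·∇k, the trace condition bounds ΔL, the quadratic form bounds D²L(g, g), and the
matrix inequality bounds |H|². All terms containing k cancel. The remainder aβ(1-γ)(G|h|² - c²) is
nonnegative by Cauchy–Schwarz and γ ≤ 1, and absorbing it produces the coefficient of c². -/
theorem evolution_le_of_second_order {d : ℕ} {H D₂L : Fin d → Fin d → ℝ} {g h dk : Fin d → ℝ}
    {G h2 c β γ a lam B k : ℝ} (hsymm : ∀ i j, H i j = H j i) (hG : ∑ i, g i ^ 2 = G)
    (hh : ∑ i, h i ^ 2 = h2) (hc : ∑ i, h i * g i = c) (hG0 : 0 < G)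
    (ha : 0 < a) (hβ : 0 ≤ β) (hγ : γ ≤ 1)
    (hk : ∑ i, H i i + c = k)
    (hHg : ∀ i, 2 * ∑ j, g j * H i j = -(β * G * h i))
    (hlap : 2 * ∑ i, ∑ j, H i j ^ 2 +
      2 * ∑ j, g j * (dk j - ∑ i, (D₂L j i * g i + h i * H j i)) ≤
        G * (β ^ 2 * h2 - β * ∑ i, D₂L i i))
    (hform : -(B * G) ≤ ∑ i, ∑ j, H i j * g i * g j -
      (a * (γ * c ^ 2 + ∑ i, ∑ j, D₂L i j * g i * g j) + lam * G))
    (htrace : ∑ i, H i i - (a * (γ * h2 + ∑ i, D₂L i i) + lam * d) ≤ d * B) :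
    β * k * G + 2 * a * ∑ i, g i * (γ * k * h i + dk i) ≤
      -((2 * β - β ^ 2 - γ ^ 2 * ((d : ℝ) - 1)) / 2) * a * c ^ 2 +
        (lam * (β * d - 2) + (β * d + 2) * B) * G := by
  have hmat := sum_sq_ge_of_mulVec_eq (γ := γ) hsymm hG hh hc hG0.ne' hHg
  have s3 : ∑ i, ∑ j, H i j * g i * g j = -(β * G * c / 2) := by
    have : ∀ i, ∑ j, H i j * g i * g j = -(β * G / 2) * (h i * g i) := fun i => by
      have := hHg i
      calc ∑ j, H i j * g i * g j = g i * ∑ j, g j * H i j := by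
            rw [Finset.mul_sum]; exact Finset.sum_congr rfl fun j _ => by ring
        _ = _ := by linear_combination g i / 2 * this
    simp_rw [this, ← Finset.mul_sum, hc]; ring
  have s4 : ∑ j, ∑ i, g j * (h i * H j i) = -(β * G * h2 / 2) := by
    rw [Finset.sum_comm]
    have : ∀ i, ∑ j, g j * (h i * H j i) = -(β * G / 2) * h i ^ 2 := fun i => by
      have := hHg i
      calc ∑ j, g j * (h i * H j i) = h i * ∑ j, g j * H i j := by
            rw [Finset.mul_sum]; exact Finset.sum_congr rfl fun j _ => by rw [hsymm j i]; ring
        _ = _ := by linear_combination h i / 2 * this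
    simp_rw [this, ← Finset.mul_sum, hh]; ring
  have s5 : ∑ j, g j * (dk j - ∑ i, (D₂L j i * g i + h i * H j i)) =
      ∑ j, g j * dk j - ∑ i, ∑ j, D₂L i j * g i * g j + β * G * h2 / 2 := by
    have e1 : ∀ j, g j * (dk j - ∑ i, (D₂L j i * g i + h i * H j i)) =
        g j * dk j - ∑ i, D₂L j i * g j * g i - ∑ i, g j * (h i * H j i) := fun j => by
      rw [Finset.sum_add_distrib, mul_sub, mul_add, Finset.mul_sum, Finset.mul_sum]
      have : ∑ i, g j * (D₂L j i * g i) = ∑ i, D₂L j i * g j * g i :=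
        Finset.sum_congr rfl fun i _ => by ring
      rw [this]; ring
    simp_rw [e1, Finset.sum_sub_distrib, s4]; ring
  have s6 : ∑ i, g i * (γ * k * h i + dk i) = γ * k * c + ∑ i, g i * dk i := by
    rw [← hc, Finset.mul_sum, ← Finset.sum_add_distrib]
    exact Finset.sum_congr rfl fun i _ => by ring
  have hcs : c ^ 2 ≤ G * h2 := by
    have := Finset.sum_mul_sq_le_sq_mul_sq Finset.univ h g
    rw [hc, hh, hG] at this; linarith
  rw [s5] at hlap
  rw [s3] at hform
  rw [s6]
  generalize ∑ j, g j * dk j = gk at *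
  generalize ∑ i, ∑ j, D₂L i j * g i * g j = LL at *
  generalize ∑ i, D₂L i i = trL at *
  generalize ∑ i, H i i = T at *
  generalize ∑ i, ∑ j, H i j ^ 2 = HH at *
  subst hk
  have m1 := mul_le_mul_of_nonneg_left hlap ha.le
  have m2 := mul_le_mul_of_nonneg_left htrace (mul_nonneg hβ hG0.le)
  have m3 := mul_le_mul_of_nonneg_left hmat ha.le
  have m4 := mul_nonneg (mul_nonneg ha.le (mul_nonneg hβ (sub_nonneg.2 hγ)))
    (sub_nonneg.2 hcs)
  linarith [m1, m2, m3, m4, hform]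

/-! ### Slices of smooth functions of time and space. -/

section SpaceTime

variable {d : ℕ} {L : ℝ × Space d → ℝ}

theorem contDiff_slice (hL : ContDiff ℝ ∞ L) (t : ℝ) : ContDiff ℝ ∞ fun y => L (t, y) :=
  hL.comp (contDiff_const.prodMk contDiff_id)

theorem contDiff_fderiv_apply (hL : ContDiff ℝ ∞ L) (v : ℝ × Space d) :
    ContDiff ℝ ∞ fun z => fderiv ℝ L z v :=
  (hL.fderiv_right (m := ∞) (by simp)).clm_apply contDiff_const

theorem pd_slice_of_differentiableAt {t : ℝ} {x : Space d} (hL : DifferentiableAt ℝ L (t, x))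
    (i : Fin d) :
    pd i (fun y => L (t, y)) x = fderiv ℝ L (t, x) (0, EuclideanSpace.single i 1) := by
  have h1 : HasFDerivAt (fun y : Space d => (t, y)) (ContinuousLinearMap.inr ℝ ℝ (Space d)) x :=
    hasFDerivAt_prodMk_right t x
  have h2 := hL.hasFDerivAt.comp x h1
  have h3 : (fun y => L (t, y)) = L ∘ fun y => (t, y) := rfl
  rw [pd, h3, h2.fderiv]
  simp

theorem hasDerivAt_slice {t : ℝ} {x : Space d} (hL : DifferentiableAt ℝ L (t, x)) :
    HasDerivAt (fun s => L (s, x)) (fderiv ℝ L (t, x) (1, 0)) t := by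
  have h1 : HasDerivAt (fun s : ℝ => (s, x)) ((1 : ℝ), (0 : Space d)) t :=
    (hasDerivAt_id t).prodMk (hasDerivAt_const t x)
  exact hL.hasFDerivAt.comp_hasDerivAt t h1

/-- Time and space derivatives commute by symmetry of the second derivative on space-time. -/
theorem hasDerivAt_pd_slice (hL : ContDiff ℝ ∞ L) (i : Fin d) (t : ℝ) (x : Space d) :
    HasDerivAt (fun s => pd i (fun y => L (s, y)) x)
      (pd i (fun y => fderiv ℝ L (t, y) (1, 0)) x) t := by
  have hLd : Differentiable ℝ L := hL.differentiable (by simp)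
  have h1 : (fun s => pd i (fun y => L (s, y)) x) =
      fun s => fderiv ℝ L (s, x) (0, EuclideanSpace.single i 1) :=
    funext fun s => pd_slice_of_differentiableAt (hLd _) i
  have hd : ∀ v, Differentiable ℝ fun z => fderiv ℝ L z v := fun v =>
    (contDiff_fderiv_apply hL v).differentiable (by simp)
  have hdd : DifferentiableAt ℝ (fderiv ℝ L) (t, x) :=
    (hL.fderiv_right (m := ∞) (by simp)).differentiable (by simp) _
  have h2 := hasDerivAt_slice (hd (0, EuclideanSpace.single i 1) (t, x))
  rw [h1]
  convert h2 using 1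
  rw [pd_slice_of_differentiableAt (L := fun z => fderiv ℝ L z (1, 0)) (hd _ _)]
  have e : ∀ v w, fderiv ℝ (fun z => fderiv ℝ L z v) (t, x) w =
      fderiv ℝ (fderiv ℝ L) (t, x) w v := fun v w => by
    rw [fderiv_clm_apply hdd (differentiableAt_const v)]; simp
  rw [e, e]
  exact (hL.contDiffAt.isSymmSndFDerivAt (by simpa using ENat.LEInfty.out)).eq _ _

end SpaceTime

/-- The `i`-th component of `∇p + lam x + ∇V`, in terms of `L = log n`. -/
def fluxComp {d : ℕ} (γ lam : ℝ) (V : Space d → ℝ) (L : ℝ × Space d → ℝ) (t : ℝ) (i : Fin d)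
    (x : Space d) : ℝ :=
  |γ| * Real.exp (γ * L (t, x)) * pd i (fun y => L (t, y)) x + (lam * x i + pd i V x)

/-- The differential inequality for `|p|^b |∇p + ∇(lam |x|²/2 + V)|²` at a spatial maximum, written
in terms of `L = log n`, with `β = γ b`. -/
theorem exists_hasDerivAt_le_of_isLocalMax {d : ℕ} {V : Space d → ℝ} {A B : ℝ}
    (hV : HasBoundedDerivatives V A B) {L : ℝ × Space d → ℝ} (hL : ContDiff ℝ ∞ L)
    {γ β lam : ℝ} (hγ0 : γ ≠ 0) (hγ : γ ≤ 1) (hβ : 0 ≤ β) {t₁ : ℝ} {x₁ : Space d} {r : ℝ}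
    (hr : 0 < r)
    (hweak : ∀ ψ : Space d → ℝ, ContDiff ℝ ∞ ψ → HasCompactSupport ψ →
      tsupport ψ ⊆ Metric.ball x₁ r →
        ∫ x, ∑ i, fluxComp γ lam V L t₁ i x * pd i ψ x =
          ∫ x, (∑ i, pd i (fun y => L (t₁, y)) x * fluxComp γ lam V L t₁ i x -
            fderiv ℝ L (t₁, x) (1, 0)) * ψ x)
    (hmax : IsLocalMax (fun x => Real.exp (β * L (t₁, x)) *
      ∑ i, fluxComp γ lam V L t₁ i x ^ 2) x₁)
    (hpos : 0 < ∑ i, fluxComp γ lam V L t₁ i x₁ ^ 2) :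
    ∃ D, HasDerivAt (fun t => Real.exp (β * L (t, x₁)) * ∑ i, fluxComp γ lam V L t i x₁ ^ 2) D t₁ ∧
      D ≤ Real.exp (β * L (t₁, x₁)) *
        (-((2 * β - β ^ 2 - γ ^ 2 * ((d : ℝ) - 1)) / 2) * (|γ| * Real.exp (γ * L (t₁, x₁))) *
          (∑ i, pd i (fun y => L (t₁, y)) x₁ * fluxComp γ lam V L t₁ i x₁) ^ 2 +
          (lam * (β * d - 2) + (β * d + 2) * B) * ∑ i, fluxComp γ lam V L t₁ i x₁ ^ 2) := by
  have hσ : Real.sign γ * γ = |γ| := by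
    rcases lt_or_gt_of_ne hγ0 with h | h
    · simp [Real.sign_of_neg h, abs_of_neg h]
    · simp [Real.sign_of_pos h, abs_of_pos h]
  set Lt : Space d → ℝ := fun y => L (t₁, y) with hLt
  have hLs : ContDiff ℝ ∞ Lt := contDiff_slice hL t₁
  have hLd := differentiable_of_contDiff hLs
  have hhs := fun i => contDiff_pd hLs i
  set k : Space d → ℝ := fun x => fderiv ℝ L (t₁, x) (1, 0) with hk
  have hks : ContDiff ℝ ∞ k := contDiff_slice (contDiff_fderiv_apply hL (1, 0)) t₁
  set a : Space d → ℝ := fun x => |γ| * Real.exp (γ * Lt x) with ha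
  have has : ContDiff ℝ ∞ a := contDiff_const.mul (contDiff_const.mul hLs).exp
  have hpda : ∀ i x, pd i a x = γ * a x * pd i Lt x := fun i x => by
    simp only [ha]
    rw [pd_const_mul ((hLd x).const_mul γ).exp, pd_exp ((hLd x).const_mul γ),
      pd_const_mul (hLd x)]
    ring
  set S : Space d → ℝ := fun x => Real.sign γ * Real.exp (γ * Lt x) + lam / 2 * sqDist 0 x with hS
  have hSs : ContDiff ℝ ∞ S :=
    (contDiff_const.mul (contDiff_const.mul hLs).exp).add
      (contDiff_const.mul (contDiff_sqDist 0))
  have hpdS : ∀ i, pd i S = fun x => a x * pd i Lt x + lam * x i := fun i => funext fun x => by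
    simp only [hS]
    have d1 : DifferentiableAt ℝ (fun y => Real.exp (γ * Lt y)) x := ((hLd x).const_mul γ).exp
    have d2 : DifferentiableAt ℝ (sqDist (0 : Space d)) x :=
      differentiable_of_contDiff (contDiff_sqDist 0) x
    rw [pd_add (d1.const_mul _) (d2.const_mul _), pd_const_mul d1, pd_const_mul d2,
      pd_exp ((hLd x).const_mul γ), pd_const_mul (hLd x), pd_sqDist, ha, ← hσ]
    simp; ring
  have hpdpdS : ∀ i j x, pd i (pd j S) x = a x * (γ * (pd i Lt x * pd j Lt x) +
      pd i (pd j Lt) x) + lam * (if i = j then 1 else 0) := fun i j x => by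
    have d1 := differentiable_of_contDiff has x
    have d2 := differentiable_of_contDiff (hhs j) x
    have d3 := differentiable_of_contDiff (contDiff_coord j) x
    rw [hpdS, pd_add (d1.fun_mul d2) (d3.const_mul lam), pd_mul d1 d2, pd_const_mul d3, pd_coord,
      hpda]
    ring
  set g : Fin d → Space d → ℝ := fun i x => fluxComp γ lam V L t₁ i x with hg
  have hgS : ∀ i x, g i x = pd i S x + pd i V x := fun i x => by
    rw [hpdS]; simp only [hg, fluxComp, ha, hLt]; ring
  set G := ∑ i, g i x₁ ^ 2 with hG
  -- Maximality of exp(βL)|g|² at x₁ says |g|² ≤ R with equality at x₁. The weight is thereby moved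
  -- into a smooth function that does not involve V.
  set R : Space d → ℝ := fun x => G * Real.exp (-β * (Lt x - Lt x₁)) with hR
  have hRs : ContDiff ℝ ∞ R :=
    contDiff_const.mul (contDiff_const.mul (hLs.sub contDiff_const)).exp
  have hpdR : ∀ i, pd i R = fun x => -β * R x * pd i Lt x := fun i => funext fun x => by
    have d1 : DifferentiableAt ℝ (fun y => -β * (Lt y - Lt x₁)) x :=
      ((hLd x).sub_const _).const_mul _
    simp only [hR]
    rw [pd_const_mul d1.exp, pd_exp d1, pd_const_mul ((hLd x).sub_const _),
      pd_sub (hLd x) (differentiableAt_const _), pd_const]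
    ring
  have hR1 : R x₁ = G := by simp [hR]
  have hpdpdR : ∀ i, pd i (pd i R) x₁ = G * (β ^ 2 * pd i Lt x₁ ^ 2 - β * pd i (pd i Lt) x₁) :=
    fun i => by
      have d1 := differentiable_of_contDiff hRs x₁
      have d2 := differentiable_of_contDiff (hhs i) x₁
      rw [hpdR, pd_mul (d1.const_mul _) d2, pd_const_mul d1, hpdR]
      simp only [hR1]; ring
  have hmaxR : IsLocalMax (fun x => ∑ i, (pd i S x + pd i V x) ^ 2 - R x) x₁ := by
    filter_upwards [hmax] with x hx
    have e1 : ∀ y, ∑ i, (pd i S y + pd i V y) ^ 2 = ∑ i, g i y ^ 2 := fun y =>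
      Finset.sum_congr rfl fun i _ => by rw [hgS]
    rw [e1, e1, hR1, hG, sub_self, sub_nonpos]
    have e2 : Real.exp (β * Lt x) * ∑ i, g i x ^ 2 ≤ Real.exp (β * Lt x₁) * G := hx
    have e3 : R x = Real.exp (-(β * Lt x)) * (Real.exp (β * Lt x₁) * G) := by
      simp only [hR]
      rw [← mul_assoc, ← Real.exp_add]
      ring_nf
    rw [e3]
    have e4 := mul_le_mul_of_nonneg_left e2 (Real.exp_pos (-(β * Lt x))).le
    rwa [← mul_assoc, ← Real.exp_add, neg_add_cancel, Real.exp_zero, one_mul] at e4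
  obtain ⟨H, hsymm, hH1, hH2, hH3, hH4⟩ := exists_hessian_of_isLocalMax hV hSs hks hRs hhs hr
    (fun ψ h1 h2 h3 => by
      have := hweak ψ h1 h2 h3
      simpa only [← hgS] using this) hmaxR
  simp only [← hgS] at hH1 hH2 hH3
  have hpos' : 0 < G := hpos
  have hHg : ∀ i, 2 * ∑ j, g j x₁ * H i j = -(β * G * pd i Lt x₁) := fun i => by
    rw [hH2 i, hpdR]; simp only [hR1]; ring
  have hnormg : ‖WithLp.toLp 2 (fun i => g i x₁)‖ ^ 2 = G := by
    rw [norm_sq_eq_sum]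
  refine ⟨Real.exp (β * Lt x₁) * (β * k x₁ * G + 2 * a x₁ * ∑ i, g i x₁ *
    (γ * k x₁ * pd i Lt x₁ + pd i k x₁)), ?_, ?_⟩
  · have t1 : HasDerivAt (fun t => L (t, x₁)) (k x₁) t₁ :=
      hasDerivAt_slice (hL.differentiable (by simp) _)
    have t2 := fun i => hasDerivAt_pd_slice hL i t₁ x₁
    have t3 : ∀ i, HasDerivAt (fun t => fluxComp γ lam V L t i x₁)
        (a x₁ * (γ * k x₁ * pd i Lt x₁ + pd i k x₁)) t₁ := fun i => by
      have := ((((t1.const_mul γ).exp).const_mul |γ|).mul (t2 i)).add_const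
        (lam * x₁ i + pd i V x₁)
      refine this.congr_deriv ?_
      simp only [ha, hLt, hk]; ring
    have t4 : HasDerivAt (fun t => ∑ i, fluxComp γ lam V L t i x₁ ^ 2)
        (∑ i, 2 * g i x₁ * (a x₁ * (γ * k x₁ * pd i Lt x₁ + pd i k x₁))) t₁ :=
      HasDerivAt.fun_sum fun i _ => by simpa using (t3 i).fun_pow 2
    have t5 := ((t1.const_mul β).exp).mul t4
    refine t5.congr_deriv ?_
    have e1 : ∑ i, 2 * g i x₁ * (a x₁ * (γ * k x₁ * pd i Lt x₁ + pd i k x₁)) =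
        2 * a x₁ * ∑ i, g i x₁ * (γ * k x₁ * pd i Lt x₁ + pd i k x₁) := by
      rw [Finset.mul_sum]; exact Finset.sum_congr rfl fun i _ => by ring
    rw [e1]
    simp only [hG, hg, hLt]; ring
  · refine mul_le_mul_of_nonneg_left ?_ (Real.exp_pos _).le
    refine evolution_le_of_second_order (H := H) (D₂L := fun i j => pd i (pd j Lt) x₁)
      (g := fun i => g i x₁) (h := fun i => pd i Lt x₁) (dk := fun i => pd i k x₁)
      (h2 := ∑ i, pd i Lt x₁ ^ 2) hsymm rfl rfl rfl hpos' (by positivity) hβ hγ hH1 hHg ?_ ?_ ?_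
    · refine hH3.trans (le_of_eq ?_)
      simp_rw [hpdpdR, Finset.mul_sum, ← Finset.sum_sub_distrib, Finset.mul_sum]
    · have h1 := (abs_le.1 (hH4 (WithLp.toLp 2 (fun i => g i x₁)))).1
      rw [hnormg] at h1
      refine h1.trans (le_of_eq ?_)
      have e1 : ∀ i j, (H i j - pd i (pd j S) x₁) * g i x₁ * g j x₁ =
          H i j * g i x₁ * g j x₁ - (a x₁ * γ) * ((pd i Lt x₁ * g i x₁) * (pd j Lt x₁ * g j x₁))
          - a x₁ * (pd i (pd j Lt) x₁ * g i x₁ * g j x₁)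
          - lam * ((if i = j then 1 else 0) * (g i x₁ * g j x₁)) := fun i j => by
        rw [hpdpdS]; ring
      have e2 : ∑ i, ∑ j, (if i = j then (1 : ℝ) else 0) * (g i x₁ * g j x₁) = G := by
        simp [hG, sq]
      have e3 : ∑ i, ∑ j, (pd i Lt x₁ * g i x₁) * (pd j Lt x₁ * g j x₁) =
          (∑ i, pd i Lt x₁ * g i x₁) ^ 2 := by rw [← Finset.sum_mul_sum, sq]
      simp only [e1, Finset.sum_sub_distrib, sum_sum_const_mul, e2, e3]
      ring
    -- The form bound at the coordinate vectors controls each diagonal entry, and summation gives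
    -- the trace condition with constant dB.
    · have h1 : ∀ i, H i i - pd i (pd i S) x₁ ≤ B := fun i => by
        have := (abs_le.1 (hH4 (EuclideanSpace.single i 1))).2
        simpa [Pi.single_apply, Finset.sum_ite_eq] using this
      have h2 := Finset.sum_le_sum fun i (_ : i ∈ Finset.univ) => h1 i
      simp only [hpdpdS, Finset.sum_const, Finset.card_univ, Fintype.card_fin, nsmul_eq_mul,
        Finset.sum_sub_distrib, Finset.sum_add_distrib, ← Finset.mul_sum, if_true, ← sq] at h2
      linarith

/-! ### The equation on the positivity set -/

/-- The positivity set of `n` in `(0,∞) × ℝ^d`. -/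
def posSet {d : ℕ} (n : ℝ → Space d → ℝ) : Set (ℝ × Space d) := {z | 0 < z.1 ∧ 0 < n z.1 z.2}

/-! ### The signed power law and its gradient. -/

section Pressure

theorem sign_mul_self_eq_abs {γ : ℝ} : Real.sign γ * γ = |γ| := by
  rcases lt_trichotomy γ 0 with h | h | h
  · simp [Real.sign_of_neg h, abs_of_neg h]
  · simp [h]
  · simp [Real.sign_of_pos h, abs_of_pos h]

theorem abs_sign_of_ne_zero {γ : ℝ} (h : γ ≠ 0) : |Real.sign γ| = 1 := by
  rcases lt_or_gt_of_ne h with h | h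
  · simp [Real.sign_of_neg h]
  · simp [Real.sign_of_pos h]

theorem abs_pressure {γ s : ℝ} (h : γ ≠ 0) (hs : 0 ≤ s) : |pressure γ s| = s ^ γ := by
  rw [pressure, abs_mul, abs_sign_of_ne_zero h, one_mul, abs_of_nonneg (Real.rpow_nonneg hs γ)]

theorem hasDerivAt_pressure {γ s : ℝ} (hs : 0 < s) :
    HasDerivAt (pressure γ) (|γ| * s ^ (γ - 1)) s := by
  have h := (Real.hasDerivAt_rpow_const (x := s) (p := γ) (Or.inl hs.ne')).const_mul (Real.sign γ)
  rwa [← mul_assoc, sign_mul_self_eq_abs] at h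

variable {d : ℕ} {γ : ℝ} {W : Space d → ℝ} {n : ℝ → Space d → ℝ} {t : ℝ} {x : Space d}

theorem gradQ_apply (i : Fin d) :
    gradQ γ W n t x i = pd i (fun y => pressure γ (n t y)) x + pd i W x := by
  rw [gradQ, PiLp.add_apply, gradient_apply, gradient_apply]

theorem gradQ_apply_of_pos (hx : 0 < n t x) (hd : DifferentiableAt ℝ (n t) x) (i : Fin d) :
    gradQ γ W n t x i = |γ| * n t x ^ (γ - 1) * pd i (n t) x + pd i W x := by
  rw [gradQ_apply, pd_comp (hasDerivAt_pressure hx) hd]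

theorem gradient_pressure_of_pos (hx : 0 < n t x) (hd : DifferentiableAt ℝ (n t) x) :
    gradient (fun y => pressure γ (n t y)) x = (|γ| * n t x ^ (γ - 1)) • gradient (n t) x := by
  ext i
  rw [gradient_apply, pd_comp (hasDerivAt_pressure hx) hd, PiLp.smul_apply, gradient_apply,
    smul_eq_mul]

theorem weightedGradSq_of_pos {b : ℝ} (hγ : γ ≠ 0) (hx : 0 < n t x) :
    weightedGradSq γ b W n t x = n t x ^ (γ * b) * ‖gradQ γ W n t x‖ ^ 2 := by
  rw [weightedGradSq, abs_pressure hγ hx.le, ← Real.rpow_mul hx.le]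

end Pressure

/-! ### Smoothness on the positivity set and the weak equation at one time. -/

section Slice

variable {d : ℕ} {γ : ℝ} {W : Space d → ℝ} {n : ℝ → Space d → ℝ}

theorem IsWellBehaved.isOpen_posSet (hn : IsWellBehaved γ W n) (hγ : γ ≠ 0) :
    IsOpen (posSet n) := by
  rcases lt_or_gt_of_ne hγ with h | h
  · have : posSet n = Ioi 0 ×ˢ univ := by
      ext z
      simp only [posSet, mem_ofPred_eq, mem_prod, mem_Ioi, mem_univ, and_true]
      exact ⟨fun h => h.1, fun h' => ⟨h', (hn.fast h).1.pos _ h' _⟩⟩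
    rw [this]
    exact isOpen_Ioi.prod isOpen_univ
  · have h1 := (hn.slow h).1.continuousOn.isOpen_inter_preimage
      (isOpen_Ioi.prod isOpen_univ) (isOpen_Ioi (a := (0 : ℝ)))
    convert h1 using 1
    ext z
    simp [posSet]

theorem IsWellBehaved.contDiffAt (hn : IsWellBehaved γ W n) (hγ : γ ≠ 0) {z : ℝ × Space d}
    (hz : z ∈ posSet n) : ContDiffAt ℝ ∞ (fun z : ℝ × Space d => n z.1 z.2) z := by
  rcases lt_or_gt_of_ne hγ with h | h
  · exact (hn.fast h).2.contDiffAt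
      ((isOpen_Ioi.prod isOpen_univ).mem_nhds ⟨hz.1, mem_univ _⟩)
  · exact (hn.slow h).2.contDiffAt ((hn.isOpen_posSet hγ).mem_nhds hz)

theorem IsWellBehaved.differentiableAt (hn : IsWellBehaved γ W n) (hγ : γ ≠ 0)
    {z : ℝ × Space d} (hz : z ∈ posSet n) :
    DifferentiableAt ℝ (fun z : ℝ × Space d => n z.1 z.2) z :=
  (hn.contDiffAt hγ hz).differentiableAt (by simp)

theorem IsWellBehaved.contDiffAt_slice (hn : IsWellBehaved γ W n) (hγ : γ ≠ 0) {t : ℝ}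
    {x : Space d} (hz : (t, x) ∈ posSet n) : ContDiffAt ℝ ∞ (n t) x :=
  (hn.contDiffAt hγ hz).comp (f := fun y : Space d => (t, y)) x
    (contDiffAt_const.prodMk contDiffAt_id)

theorem IsWellBehaved.continuousAt_flux (hn : IsWellBehaved γ W n) (hγ : γ ≠ 0)
    (hW : ∀ i, Continuous (pd i W)) {z : ℝ × Space d} (hz : z ∈ posSet n) (i : Fin d) :
    ContinuousAt (fun z : ℝ × Space d => n z.1 z.2 * gradQ γ W n z.1 z.2 i) z := by
  have h1 : (fun z : ℝ × Space d => n z.1 z.2 * gradQ γ W n z.1 z.2 i) =ᶠ[𝓝 z]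
      fun z => n z.1 z.2 * (|γ| * n z.1 z.2 ^ (γ - 1) *
        fderiv ℝ (fun z : ℝ × Space d => n z.1 z.2) z (0, EuclideanSpace.single i 1) +
          pd i W z.2) := by
    filter_upwards [(hn.isOpen_posSet hγ).mem_nhds hz] with y hy
    have hy' : (y.1, y.2) ∈ posSet n := hy
    rw [gradQ_apply_of_pos hy.2 ((hn.contDiffAt_slice hγ hy').differentiableAt (by simp)),
      ← pd_slice_of_differentiableAt (L := fun z : ℝ × Space d => n z.1 z.2)
        (hn.differentiableAt hγ hy') i]
  refine ContinuousAt.congr ?_ h1.symm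
  have hc := (hn.contDiffAt hγ hz).continuousAt
  have hd : ContinuousAt (fun z => fderiv ℝ (fun z : ℝ × Space d => n z.1 z.2) z
      (0, EuclideanSpace.single i 1)) z :=
    ((hn.contDiffAt hγ hz).continuousAt_fderiv (by simp)).clm_apply continuousAt_const
  exact hc.mul (((continuousAt_const.mul (hc.rpow_const (Or.inl hz.2.ne'))).mul hd).add
    ((hW i).comp continuous_snd).continuousAt)

theorem continuousAt_mul_snd {I : Set ℝ} {χ : Space d → ℝ} {F : ℝ × Space d → ℝ}
    (hχ : Continuous χ) (hF : ∀ t ∈ I, ∀ x ∈ tsupport χ, ContinuousAt F (t, x))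
    {z : ℝ × Space d} (hz : z.1 ∈ I) : ContinuousAt (fun z : ℝ × Space d => χ z.2 * F z) z := by
  by_cases hx : z.2 ∈ tsupport χ
  · exact ((hχ.comp continuous_snd).continuousAt).mul (hF z.1 hz z.2 hx)
  · have h : (fun z : ℝ × Space d => χ z.2 * F z) =ᶠ[𝓝 z] fun _ => 0 := by
      have := continuous_snd.continuousAt.preimage_mem_nhds
        ((isClosed_tsupport χ).isOpen_compl.mem_nhds hx)
      filter_upwards [this] with y hy
      rw [image_eq_zero_of_notMem_tsupport hy, zero_mul]
    exact continuousAt_const.congr h.symm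

theorem tsupport_prod_mul_subset (η : ℝ → ℝ) (χ : Space d → ℝ) :
    tsupport (fun z : ℝ × Space d => η z.1 * χ z.2) ⊆ tsupport η ×ˢ tsupport χ := by
  refine closure_minimal (fun z hz => ?_) ((isClosed_tsupport η).prod (isClosed_tsupport χ))
  have hz' : η z.1 * χ z.2 ≠ 0 := hz
  exact ⟨subset_tsupport _ (left_ne_zero_of_mul hz'), subset_tsupport _ (right_ne_zero_of_mul hz')⟩

theorem isAddHaarMeasure_volume_prod (d : ℕ) :
    (volume : Measure (ℝ × Space d)).IsAddHaarMeasure := by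
  rw [Measure.volume_eq_prod]; infer_instance

/-- The weak equation at a fixed time, for test functions supported where `n > 0`. -/
theorem IsWellBehaved.integral_slice (hn : IsWellBehaved γ W n) (hγ : γ ≠ 0)
    (hW : ∀ i, Continuous (pd i W)) {t₁ : ℝ} (ht₁ : 0 < t₁) {ψ : Space d → ℝ}
    (hψ : ContDiff ℝ ∞ ψ) (hψc : HasCompactSupport ψ) (hψt : ∀ x ∈ tsupport ψ, 0 < n t₁ x) :
    ∫ x, fderiv ℝ (fun z : ℝ × Space d => n z.1 z.2) (t₁, x) (1, 0) * ψ x =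
      -∫ x, ∑ i, n t₁ x * gradQ γ W n t₁ x i * pd i ψ x := by
  set N : ℝ × Space d → ℝ := fun z => n z.1 z.2 with hN
  have hO := hn.isOpen_posSet hγ
  -- By compactness of the support of ψ, its product with a short time interval stays in the open
  -- positivity set.
  obtain ⟨I, K, hI, -, htI, hKK, hIK⟩ := generalized_tube_lemma (isCompact_singleton (x := t₁))
    hψc.isCompact hO (by
      rintro ⟨t, x⟩ ⟨ht, hx⟩
      rw [mem_singleton_iff] at ht
      subst ht
      exact ⟨ht₁, hψt x hx⟩)
  have htI : t₁ ∈ I := htI rfl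
  have hIψ : ∀ t ∈ I, ∀ x ∈ tsupport ψ, (t, x) ∈ posSet n := fun t ht x hx =>
    hIK ⟨ht, hKK hx⟩
  have hpdψc : ∀ i, HasCompactSupport (pd i ψ) := fun i => hψc.fderiv_apply ℝ _
  have hpdψ : ∀ i, Continuous (pd i ψ) := fun i => (contDiff_pd hψ i).continuous
  have hpdψt : ∀ i, tsupport (pd i ψ) ⊆ tsupport ψ := fun i =>
    tsupport_fderiv_apply_subset' ψ _
  have hdtc : ∀ z ∈ posSet n, ContinuousAt (fun z => fderiv ℝ N z (1, 0)) z := fun z hz =>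
    ((hn.contDiffAt hγ hz).continuousAt_fderiv (by simp)).clm_apply continuousAt_const
  have hflc : ∀ i, ∀ z ∈ posSet n,
      ContinuousAt (fun z : ℝ × Space d => n z.1 z.2 * gradQ γ W n z.1 z.2 i) z :=
    fun i z hz => hn.continuousAt_flux hγ hW hz i
  -- Testing with η(t)ψ(x) shows that ∫ Γ(t, x) dx is orthogonal to every η supported in I. This
  -- integral is continuous in t, so it vanishes at t₁ and not only for almost every time.
  set Γ : ℝ → Space d → ℝ := fun t x => ψ x * fderiv ℝ N (t, x) (1, 0) +
    ∑ i, pd i ψ x * (n t x * gradQ γ W n t x i) with hΓ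
  have hΓc : ContinuousOn (Function.uncurry Γ) (I ×ˢ univ) := by
    intro z hz
    apply ContinuousAt.continuousWithinAt
    refine ContinuousAt.add ?_ (tendsto_finsetSum _ fun i _ => ?_)
    · exact continuousAt_mul_snd (I := I) hψ.continuous
        (fun t ht x hx => hdtc _ (hIψ t ht x hx)) hz.1
    · exact continuousAt_mul_snd (I := I) (hpdψ i)
        (fun t ht x hx => hflc i _ (hIψ t ht x (hpdψt i hx))) hz.1
  have hΓ0 : ∀ t x, t ∈ I → x ∉ tsupport ψ → Γ t x = 0 := by
    intro t x _ hx
    simp only [hΓ]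
    rw [image_eq_zero_of_notMem_tsupport hx, zero_mul, zero_add]
    refine Finset.sum_eq_zero fun i _ => ?_
    rw [image_eq_zero_of_notMem_tsupport fun h => hx (hpdψt i h), zero_mul]
  have hGc : ContinuousOn (fun t => ∫ x, Γ t x) I :=
    continuousOn_integral_of_compact_support hψc.isCompact hΓc hΓ0
  have hzero : ∀ η : ℝ → ℝ, ContDiff ℝ ∞ η → HasCompactSupport η → tsupport η ⊆ I →
      ∫ t, η t • ∫ x, Γ t x = 0 := by
    intro η hη hηc hηt
    set φ : ℝ × Space d → ℝ := fun z => η z.1 * ψ z.2 with hφ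
    have hφs : ContDiff ℝ ∞ φ := (hη.comp contDiff_fst).mul (hψ.comp contDiff_snd)
    have hsub : ∀ χ : Space d → ℝ, tsupport χ ⊆ tsupport ψ →
        tsupport (fun z : ℝ × Space d => η z.1 * χ z.2) ⊆ posSet n := fun χ hχ z hz =>
      hIψ z.1 (hηt (tsupport_prod_mul_subset η χ hz).1) z.2
        (hχ (tsupport_prod_mul_subset η χ hz).2)
    have hcs : ∀ χ : Space d → ℝ, tsupport χ ⊆ tsupport ψ →
        HasCompactSupport (fun z : ℝ × Space d => η z.1 * χ z.2) := fun χ hχ =>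
      (hηc.isCompact.prod hψc.isCompact).of_isClosed_subset (isClosed_tsupport _)
        ((tsupport_prod_mul_subset η χ).trans (prod_mono_right hχ))
    have hφc := hcs ψ subset_rfl
    have hφt := hsub ψ subset_rfl
    obtain ⟨f, -, hf⟩ := hn.strong.equation
    obtain ⟨e1, e2⟩ := hf φ hφs hφc (fun z hz => ⟨(hφt hz).1, mem_univ _⟩)
    have e3 : ∫ z : ℝ × Space d, n z.1 z.2 * deriv (fun s => φ (s, z.2)) z.1 =
        ∫ z, N z * fderiv ℝ φ z (1, 0) := by
      refine integral_congr_ae (ae_of_all _ fun z => ?_)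
      simp only [hN]
      rw [(hasDerivAt_slice (t := z.1) (x := z.2) (hφs.differentiable (by simp) _)).deriv]
    have : (volume : Measure (ℝ × Space d)).IsAddHaarMeasure := isAddHaarMeasure_volume_prod d
    have e4 : ∫ z, N z * fderiv ℝ φ z (1, 0) = -∫ z, fderiv ℝ N z (1, 0) * φ z :=
      integral_mul_fderiv_of_tsupport (hφs.of_le (by simp)) hφc
        (fun z hz => (hn.contDiffAt hγ (hφt hz)).of_le (by simp)) _
    have e5 : ∫ z : ℝ × Space d, inner ℝ (n z.1 z.2 • gradQ γ W n z.1 z.2)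
        (gradient (fun y => φ (z.1, y)) z.2) =
        ∫ z : ℝ × Space d, ∑ i, (η z.1 * pd i ψ z.2) * (n z.1 z.2 * gradQ γ W n z.1 z.2 i) := by
      refine integral_congr_ae (ae_of_all _ fun z => ?_)
      simp only []
      rw [PiLp.inner_apply]
      refine Finset.sum_congr rfl fun i _ => ?_
      have : pd i (fun y => φ (z.1, y)) z.2 = η z.1 * pd i ψ z.2 :=
        pd_const_mul (x := z.2) (differentiable_of_contDiff hψ _) (η z.1) i
      rw [gradient_apply, this]
      simp
    have i1 : Integrable fun z => φ z * fderiv ℝ N z (1, 0) :=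
      (continuous_mul_of_tsupport hφs.continuous fun z hz =>
        hdtc z (hφt hz)).integrable_of_hasCompactSupport hφc.mul_right
    have i2 : ∀ i, Integrable fun z : ℝ × Space d =>
        (η z.1 * pd i ψ z.2) * (n z.1 z.2 * gradQ γ W n z.1 z.2 i) := fun i =>
      (continuous_mul_of_tsupport ((hη.continuous.comp continuous_fst).mul
        ((hpdψ i).comp continuous_snd)) fun z hz =>
        hflc i z (hsub _ (hpdψt i) hz)).integrable_of_hasCompactSupport
          (hcs _ (hpdψt i)).mul_right
    have i3 : Integrable fun z : ℝ × Space d =>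
        ∑ i, (η z.1 * pd i ψ z.2) * (n z.1 z.2 * gradQ γ W n z.1 z.2 i) :=
      integrable_finsetSum _ fun i _ => i2 i
    have e6 : ∫ z : ℝ × Space d, (φ z * fderiv ℝ N z (1, 0) +
        ∑ i, (η z.1 * pd i ψ z.2) * (n z.1 z.2 * gradQ γ W n z.1 z.2 i)) = 0 := by
      rw [integral_add i1 i3, ← e5, e2, ← e1, e3, e4]
      simp [mul_comm]
    have i4 := i1.add i3
    have e7 : (fun z : ℝ × Space d => φ z * fderiv ℝ N z (1, 0) +
        ∑ i, (η z.1 * pd i ψ z.2) * (n z.1 z.2 * gradQ γ W n z.1 z.2 i)) =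
        fun z => η z.1 * Γ z.1 z.2 := by
      funext z
      simp only [hΓ, hφ, mul_add, Finset.mul_sum]
      congr 1
      · ring
      · exact Finset.sum_congr rfl fun i _ => by ring
    have i5 : Integrable (fun z : ℝ × Space d => η z.1 * Γ z.1 z.2) := by
      rw [← e7]; exact i4
    rw [e7, Measure.volume_eq_prod, integral_prod _ (by rwa [← Measure.volume_eq_prod])] at e6
    simp only [integral_const_mul] at e6
    simpa using e6
  have hae := hI.ae_eq_zero_of_integral_contDiff_smul_eq_zero
    (hGc.locallyIntegrableOn hI.measurableSet) hzero
  have hEq := Measure.eqOn_open_of_ae_eq (μ := volume) (f := fun t => ∫ x, Γ t x)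
    (g := fun _ => 0) ((ae_restrict_iff' hI.measurableSet).2 hae) hI hGc continuousOn_const
  have h0 : ∫ x, Γ t₁ x = 0 := hEq htI
  have j1 : Integrable fun x => ψ x * fderiv ℝ N (t₁, x) (1, 0) :=
    (continuous_mul_of_tsupport hψ.continuous fun x hx =>
      ContinuousAt.comp (f := fun y : Space d => (t₁, y)) (hdtc _ (hIψ t₁ htI x hx))
        (by fun_prop)).integrable_of_hasCompactSupport hψc.mul_right
  have j2 : ∀ i, Integrable fun x => pd i ψ x * (n t₁ x * gradQ γ W n t₁ x i) := fun i =>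
    (continuous_mul_of_tsupport (hpdψ i) fun x hx =>
      ContinuousAt.comp (f := fun y : Space d => (t₁, y))
        (hflc i _ (hIψ t₁ htI x (hpdψt i hx)))
        (by fun_prop)).integrable_of_hasCompactSupport (hpdψc i).mul_right
  simp only [hΓ] at h0
  rw [integral_add j1 (integrable_finsetSum _ fun i _ => j2 i)] at h0
  have h1 := eq_neg_of_add_eq_zero_left h0
  have h2 : ∀ x, ∑ i, n t₁ x * gradQ γ W n t₁ x i * pd i ψ x =
      ∑ i, pd i ψ x * (n t₁ x * gradQ γ W n t₁ x i) := fun x =>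
    Finset.sum_congr rfl fun i _ => by ring
  simp_rw [h2, mul_comm _ (ψ _)]
  exact h1

end Slice

/-! ### Evolution of the weighted gradient at a spatial maximum -/

section Evolution

variable {d : ℕ} {γ : ℝ} {W : Space d → ℝ} {n : ℝ → Space d → ℝ}

theorem IsWellBehaved.exists_log (hn : IsWellBehaved γ W n) (hγ : γ ≠ 0) {z₁ : ℝ × Space d}
    (hz : z₁ ∈ posSet n) :
    ∃ L : ℝ × Space d → ℝ, ContDiff ℝ ∞ L ∧ ∃ r > 0, ∀ z ∈ Metric.ball z₁ r,
      z ∈ posSet n ∧ n z.1 z.2 = Real.exp (L z) := by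
  obtain ⟨r, hr, hrs⟩ := Metric.nhds_basis_closedBall.mem_iff.1
    ((hn.isOpen_posSet hγ).mem_nhds hz)
  -- Multiplication by a bump equal to 1 near z₁ makes the logarithm smooth on all of space-time, so
  -- the local analysis may assume a global L.
  let f : ContDiffBump z₁ := ⟨r / 2, r, by positivity, by linarith⟩
  refine ⟨fun z => f z * Real.log (n z.1 z.2), contDiff_mul_of_tsupport f.contDiff fun z hz => ?_,
    r / 2, by positivity, fun z hz => ?_⟩
  · rw [f.tsupport_eq] at hz
    exact (hn.contDiffAt hγ (hrs hz)).log (hrs hz).2.ne'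
  · have h1 : f z = 1 := f.one_of_mem_closedBall (Metric.ball_subset_closedBall hz)
    have h2 : z ∈ posSet n := hrs (Metric.closedBall_subset_closedBall (by linarith)
      (Metric.ball_subset_closedBall hz))
    exact ⟨h2, by simp only [h1, one_mul, Real.exp_log h2.2]⟩

/-- At a positive spatial maximum of `w = |p|^b |∇p + ∇W|²`,
`∂ₜ w ≤ n^{γb} (-κ ⟨∇p, ∇q⟩² / (|γ| |p|) + (lam (γbd - 2) + (γbd + 2) B) |∇q|²)`, where
`W = lam |x|²/2 + V` and `∇V` is `B`-Lipschitz. -/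
theorem IsWellBehaved.exists_hasDerivAt_le (hn : IsWellBehaved γ W n) (hγ : γ ≠ 0) (hγ1 : γ ≤ 1)
    {b lam A B : ℝ} (hβ : 0 ≤ γ * b) {V : Space d → ℝ} (hV : HasBoundedDerivatives V A B)
    (hWV : ∀ x i, pd i W x = lam * x i + pd i V x)
    {t₁ : ℝ} {x₁ : Space d} (hz : (t₁, x₁) ∈ posSet n)
    (hmax : ∀ y, weightedGradSq γ b W n t₁ y ≤ weightedGradSq γ b W n t₁ x₁)
    (hpos : 0 < weightedGradSq γ b W n t₁ x₁) :
    ∃ D, HasDerivAt (fun t => weightedGradSq γ b W n t x₁) D t₁ ∧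
      D ≤ n t₁ x₁ ^ (γ * b) *
        (-((2 * (γ * b) - (γ * b) ^ 2 - γ ^ 2 * ((d : ℝ) - 1)) / 2) *
          (inner ℝ (gradQ γ W n t₁ x₁ - gradient W x₁) (gradQ γ W n t₁ x₁) ^ 2 /
            (|γ| * n t₁ x₁ ^ γ)) +
          (lam * (γ * b * d - 2) + (γ * b * d + 2) * B) * ‖gradQ γ W n t₁ x₁‖ ^ 2) := by
  obtain ⟨L, hL, r, hr, hLr⟩ := hn.exists_log hγ hz
  have hpdV : ∀ i, Continuous (pd i V) := fun i =>
    hV.continuous_fderiv.clm_apply continuous_const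
  have hpdW : ∀ i, Continuous (pd i W) := fun i => by
    have : pd i W = fun x => lam * x i + pd i V x := funext fun x => hWV x i
    rw [this]
    exact (continuous_const.mul (contDiff_coord i).continuous).add (hpdV i)
  have hmem : ∀ {t : ℝ} {x : Space d}, t ∈ Metric.ball t₁ r → x ∈ Metric.ball x₁ r →
      (t, x) ∈ Metric.ball (t₁, x₁) r := fun ht hx => by
    rw [← ball_prod_same]; exact ⟨ht, hx⟩
  have ht₁ : t₁ ∈ Metric.ball t₁ r := Metric.mem_ball_self hr
  have hx₁ : x₁ ∈ Metric.ball x₁ r := Metric.mem_ball_self hr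
  have hnL : ∀ t ∈ Metric.ball t₁ r, ∀ x ∈ Metric.ball x₁ r, n t x = Real.exp (L (t, x)) :=
    fun t ht x hx => (hLr _ (hmem ht hx)).2
  have hnp : ∀ t ∈ Metric.ball t₁ r, ∀ x ∈ Metric.ball x₁ r, (t, x) ∈ posSet n :=
    fun t ht x hx => (hLr _ (hmem ht hx)).1
  have hpdn : ∀ t ∈ Metric.ball t₁ r, ∀ x ∈ Metric.ball x₁ r, ∀ i,
      pd i (n t) x = Real.exp (L (t, x)) * pd i (fun y => L (t, y)) x := by
    intro t ht x hx i
    rw [pd_congr (Metric.isOpen_ball.mem_nhds hx) (fun y hy => hnL t ht y hy),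
      pd_exp (differentiable_of_contDiff (contDiff_slice hL t) x)]
  have hflux : ∀ t ∈ Metric.ball t₁ r, ∀ x ∈ Metric.ball x₁ r, ∀ i,
      gradQ γ W n t x i = fluxComp γ lam V L t i x := by
    intro t ht x hx i
    have hp := hnp t ht x hx
    rw [gradQ_apply_of_pos hp.2 ((hn.contDiffAt_slice hγ hp).differentiableAt (by simp)),
      hpdn t ht x hx, hnL t ht x hx, fluxComp, hWV, ← Real.exp_mul]
    have : Real.exp (L (t, x) * (γ - 1)) * Real.exp (L (t, x)) = Real.exp (γ * L (t, x)) := by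
      rw [← Real.exp_add]; ring_nf
    rw [← this]; ring
  have hw : ∀ t ∈ Metric.ball t₁ r, ∀ x ∈ Metric.ball x₁ r, weightedGradSq γ b W n t x =
      Real.exp (γ * b * L (t, x)) * ∑ i, fluxComp γ lam V L t i x ^ 2 := by
    intro t ht x hx
    rw [weightedGradSq_of_pos hγ (hnp t ht x hx).2, hnL t ht x hx, ← Real.exp_mul, norm_sq_eq_sum,
      mul_comm (L (t, x))]
    congr 1
    exact Finset.sum_congr rfl fun i _ => by rw [hflux t ht x hx]
  have hLt := contDiff_slice hL t₁
  have hfc : ∀ i, Continuous (fluxComp γ lam V L t₁ i) := fun i => by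
    have h1 := (contDiff_pd hLt i).continuous
    have h2 := hLt.continuous
    have h3 := (contDiff_coord i).continuous
    have h4 := hpdV i
    unfold fluxComp
    fun_prop
  have hkc : Continuous fun x : Space d => fderiv ℝ L (t₁, x) (1, 0) :=
    (contDiff_slice (contDiff_fderiv_apply hL (1, 0)) t₁).continuous
  have hweak : ∀ ψ : Space d → ℝ, ContDiff ℝ ∞ ψ → HasCompactSupport ψ →
      tsupport ψ ⊆ Metric.ball x₁ r →
        ∫ x, ∑ i, fluxComp γ lam V L t₁ i x * pd i ψ x =
          ∫ x, (∑ i, pd i (fun y => L (t₁, y)) x * fluxComp γ lam V L t₁ i x -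
            fderiv ℝ L (t₁, x) (1, 0)) * ψ x := by
    intro ψ hψ hψc hψt
    have hexp : ContDiff ℝ ∞ fun x => Real.exp (-L (t₁, x)) := hLt.neg.exp
    -- Dividing the test function by n = exp(L) converts the divergence form into Δq + ∇L·∇q = ∂ₜL,
    -- in the weak sense.
    have hψ's : ContDiff ℝ ∞ fun x => ψ x * Real.exp (-L (t₁, x)) := hψ.mul hexp
    have hψ't : tsupport (fun x => ψ x * Real.exp (-L (t₁, x))) ⊆ tsupport ψ :=
      tsupport_mul_subset_left
    have hψ'c : HasCompactSupport fun x => ψ x * Real.exp (-L (t₁, x)) := hψc.mul_right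
    have hmain := hn.integral_slice hγ hpdW hz.1 hψ's hψ'c
      (fun x hx => (hnp t₁ ht₁ x (hψt (hψ't hx))).2)
    have e1 : ∀ x, fderiv ℝ (fun z : ℝ × Space d => n z.1 z.2) (t₁, x) (1, 0) *
        (ψ x * Real.exp (-L (t₁, x))) = fderiv ℝ L (t₁, x) (1, 0) * ψ x := by
      intro x
      by_cases hx : x ∈ tsupport ψ
      · have hxb := hψt hx
        have h1 : (fun z : ℝ × Space d => n z.1 z.2) =ᶠ[𝓝 (t₁, x)] fun z => Real.exp (L z) := by
          filter_upwards [Metric.isOpen_ball.mem_nhds (hmem ht₁ hxb)] with z hz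
          exact (hLr z hz).2
        rw [h1.fderiv_eq, fderiv_exp (hL.differentiable (by simp) _)]
        simp only [smul_apply, smul_eq_mul]
        rw [Real.exp_neg]
        field_simp
      · rw [image_eq_zero_of_notMem_tsupport hx]; simp
    have e2 : ∀ x, ∑ i, n t₁ x * gradQ γ W n t₁ x i *
        pd i (fun x => ψ x * Real.exp (-L (t₁, x))) x =
        ∑ i, fluxComp γ lam V L t₁ i x * pd i ψ x -
          (∑ i, pd i (fun y => L (t₁, y)) x * fluxComp γ lam V L t₁ i x) * ψ x := by
      intro x
      rw [Finset.sum_mul, ← Finset.sum_sub_distrib]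
      refine Finset.sum_congr rfl fun i _ => ?_
      have d1 := differentiable_of_contDiff hψ x
      have d2 := differentiable_of_contDiff hLt x
      have d3 : DifferentiableAt ℝ (fun y => -1 * L (t₁, y)) x := d2.const_mul (-1)
      have h2 : pd i (fun x => Real.exp (-L (t₁, x))) x =
          -Real.exp (-L (t₁, x)) * pd i (fun y => L (t₁, y)) x := by
        have h3 : (fun x => Real.exp (-L (t₁, x))) = fun x => Real.exp (-1 * L (t₁, x)) := by
          funext y; rw [neg_one_mul]
        rw [h3, pd_exp d3, pd_const_mul d2, neg_one_mul]; ring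
      rw [pd_mul d1 (differentiable_of_contDiff hexp x), h2]
      by_cases hx : x ∈ tsupport ψ
      · have hxb := hψt hx
        rw [hflux t₁ ht₁ x hxb, hnL t₁ ht₁ x hxb, Real.exp_neg]
        field_simp
        ring
      · have h4 : pd i ψ x = 0 := image_eq_zero_of_notMem_tsupport fun h =>
          hx (tsupport_fderiv_apply_subset' ψ _ h)
        rw [image_eq_zero_of_notMem_tsupport hx, h4]; simp
    simp_rw [e1, e2] at hmain
    have j1 : Integrable fun x => ∑ i, fluxComp γ lam V L t₁ i x * pd i ψ x :=
      integrable_finsetSum _ fun i _ =>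
        ((hfc i).mul (contDiff_pd hψ i).continuous).integrable_of_hasCompactSupport
          (HasCompactSupport.mul_left (hψc.fderiv_apply ℝ _))
    have j2 : Integrable fun x =>
        (∑ i, pd i (fun y => L (t₁, y)) x * fluxComp γ lam V L t₁ i x) * ψ x :=
      ((continuous_finsetSum _ fun i _ => ((contDiff_pd hLt i).continuous.mul
        (hfc i))).mul hψ.continuous).integrable_of_hasCompactSupport hψc.mul_left
    have j3 : Integrable fun x => fderiv ℝ L (t₁, x) (1, 0) * ψ x :=
      (hkc.mul hψ.continuous).integrable_of_hasCompactSupport hψc.mul_left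
    rw [integral_sub j1 j2] at hmain
    simp_rw [sub_mul]
    rw [integral_sub j2 j3, hmain]
    ring
  have hG : ‖gradQ γ W n t₁ x₁‖ ^ 2 = ∑ i, fluxComp γ lam V L t₁ i x₁ ^ 2 := by
    rw [norm_sq_eq_sum]
    exact Finset.sum_congr rfl fun i _ => by rw [hflux t₁ ht₁ x₁ hx₁]
  have hmax' : IsLocalMax (fun x => Real.exp (γ * b * L (t₁, x)) *
      ∑ i, fluxComp γ lam V L t₁ i x ^ 2) x₁ := by
    filter_upwards [Metric.ball_mem_nhds x₁ hr] with x hx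
    rw [← hw t₁ ht₁ x hx, ← hw t₁ ht₁ x₁ hx₁]
    exact hmax x
  have hpos' : 0 < ∑ i, fluxComp γ lam V L t₁ i x₁ ^ 2 := by
    rw [hw t₁ ht₁ x₁ hx₁] at hpos
    exact pos_of_mul_pos_right hpos (Real.exp_pos _).le
  obtain ⟨D, hD, hDle⟩ := exists_hasDerivAt_le_of_isLocalMax hV hL hγ hγ1 hβ hr hweak hmax' hpos'
  refine ⟨D, hD.congr_of_eventuallyEq ?_, hDle.trans (le_of_eq ?_)⟩
  · filter_upwards [Metric.ball_mem_nhds t₁ hr] with t ht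
    exact hw t ht x₁ hx₁
  · have hn1 := hnL t₁ ht₁ x₁ hx₁
    rw [hG, hn1, ← Real.exp_mul, ← Real.exp_mul, mul_comm (L (t₁, x₁)) (γ * b),
      mul_comm (L (t₁, x₁)) γ]
    -- Since ∇p = a∇L with a = |γ| n^γ, one has ⟨∇p, ∇q⟩ = a c, and so a c² = ⟨∇p, ∇q⟩²/a.
    have hinner : inner ℝ (gradQ γ W n t₁ x₁ - gradient W x₁) (gradQ γ W n t₁ x₁) =
        |γ| * Real.exp (γ * L (t₁, x₁)) *
          ∑ i, pd i (fun y => L (t₁, y)) x₁ * fluxComp γ lam V L t₁ i x₁ := by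
      rw [PiLp.inner_apply, Finset.mul_sum]
      refine Finset.sum_congr rfl fun i _ => ?_
      rw [PiLp.sub_apply, hflux t₁ ht₁ x₁ hx₁, gradient_apply, hWV]
      simp only [fluxComp, RCLike.inner_apply, conj_trivial]
      ring
    have ha : |γ| * Real.exp (γ * L (t₁, x₁)) ≠ 0 := by positivity
    rw [hinner]
    congr 2
    field_simp

end Evolution

/-! ### Continuity and decay of the weighted gradient; the comparison principle -/

/-- `w` is continuous on `I × ℝ^d` and vanishes at spatial infinity, uniformly on compact sets of
times. -/
structure DecaysOn {d : ℕ} (w : ℝ → Space d → ℝ) (I : Set ℝ) : Prop where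
  continuousOn : ContinuousOn (fun z : ℝ × Space d => w z.1 z.2) (I ×ˢ univ)
  decay : ∀ K ⊆ I, IsCompact K → ∀ ε > 0, ∃ R : ℝ, ∀ t ∈ K, ∀ x, R < ‖x‖ → w t x < ε

theorem neg_deriv_contradiction {f : ℝ → ℝ} {f' t₁ s : ℝ} (hf : HasDerivAt f f' t₁) (hst : s < t₁)
    (h0 : f t₁ = 0) (hneg : ∀ t ∈ Ioo s t₁, f t < 0) : 0 ≤ f' := by
  have h1 : Tendsto (slope f t₁) (𝓝[<] t₁) (𝓝 f') :=
    (hasDerivAt_iff_tendsto_slope.1 hf).mono_left (nhdsWithin_mono _ fun t ht => ne_of_lt ht)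
  refine ge_of_tendsto h1 ?_
  filter_upwards [Ioo_mem_nhdsLT hst] with t ht
  rw [slope_def_field, h0, sub_zero]
  exact div_nonneg_of_nonpos (hneg t ht).le (by linarith [ht.2])

/-- Comparison principle: a function that stays below `U` initially and whose time derivative is
smaller than `U'` wherever a spatial maximum touches `U`, stays below `U`. -/
theorem DecaysOn.lt_of_touching {d : ℕ} {w : ℝ → Space d → ℝ} {s T : ℝ} {I : Set ℝ}
    (hw : DecaysOn w I) (hI : Icc s T ⊆ I) {U U' : ℝ → ℝ} (hUc : ContinuousOn U (Icc s T))
    (hUpos : ∀ t ∈ Icc s T, 0 < U t) (hU' : ∀ t ∈ Ioc s T, HasDerivAt U (U' t) t)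
    (h0 : ∀ x, w s x < U s)
    (htouch : ∀ t ∈ Ioc s T, ∀ x, (∀ y, w t y ≤ w t x) → w t x = U t →
      ∃ D, HasDerivAt (fun τ => w τ x) D t ∧ D < U' t) :
    ∀ t ∈ Icc s T, ∀ x, w t x < U t := by
  by_contra hcon
  push Not at hcon
  obtain ⟨t₀, ht₀, x₀, hx₀⟩ := hcon
  have hwc : ContinuousOn (fun z : ℝ × Space d => w z.1 z.2) (Icc s T ×ˢ univ) :=
    hw.continuousOn.mono (prod_mono_left hI)
  -- The minimum of U is positive, so outside a fixed ball w lies below U at all times in the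
  -- interval. Contact can only happen in a compact set.
  obtain ⟨tm, htm, hmin⟩ := isCompact_Icc.exists_isMinOn ⟨t₀, ht₀⟩ hUc
  obtain ⟨R, hR⟩ := hw.decay _ hI isCompact_Icc (U tm) (hUpos tm htm)
  have hlarge : ∀ t ∈ Icc s T, ∀ x, R < ‖x‖ → w t x < U t := fun t ht x hx =>
    (hR t ht x hx).trans_le (hmin ht)
  set Kc : Set (ℝ × Space d) := Icc s T ×ˢ Metric.closedBall 0 R with hKc
  have hKcc : IsCompact Kc := isCompact_Icc.prod (isCompact_closedBall _ _)
  set S : Set (ℝ × Space d) := Kc ∩ (fun z => w z.1 z.2 - U z.1) ⁻¹' Ici 0 with hS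
  have hScl : IsClosed S := by
    refine ContinuousOn.preimage_isClosed_of_isClosed ?_ hKcc.isClosed isClosed_Ici
    exact (hwc.mono (prod_mono_right (subset_univ _))).sub
      (hUc.comp continuousOn_fst fun z hz => hz.1)
  have hSc : IsCompact S := hKcc.of_isClosed_subset hScl inter_subset_left
  have hmemS : ∀ t ∈ Icc s T, ∀ x, U t ≤ w t x → (t, x) ∈ S := by
    intro t ht x hx
    refine ⟨⟨ht, ?_⟩, by simpa using hx⟩
    rw [mem_closedBall_zero_iff]
    by_contra hxR
    exact absurd (hlarge t ht x (not_le.1 hxR)) (not_lt.2 hx)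
  -- This is a point of first contact. By continuity w(t₁, ·) ≤ U(t₁) everywhere, so x₁ is a spatial
  -- maximum; as w - U was negative before t₁, its time derivative there is nonnegative, against D <
  -- U'.
  obtain ⟨⟨t₁, x₁⟩, hz₁, hz₁min⟩ := hSc.exists_isMinOn ⟨_, hmemS t₀ ht₀ x₀ hx₀⟩
    continuous_fst.continuousOn
  have ht₁ : t₁ ∈ Icc s T := hz₁.1.1
  have hge : U t₁ ≤ w t₁ x₁ := by simpa using hz₁.2
  have hbefore : ∀ t ∈ Ico s t₁, ∀ x, w t x < U t := by
    intro t ht x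
    by_contra hx
    have := hz₁min (hmemS t ⟨ht.1, ht.2.le.trans ht₁.2⟩ x (not_lt.1 hx))
    exact absurd ht.2 (not_lt.2 this)
  have hst₁ : s < t₁ := by
    rcases eq_or_lt_of_le ht₁.1 with h | h
    · subst h; exact absurd (h0 x₁) (not_lt.2 hge)
    · exact h
  have hle : ∀ y, w t₁ y ≤ U t₁ := by
    intro y
    have hmem : Ico s t₁ ∈ 𝓝[<] t₁ := Ico_mem_nhdsLT hst₁
    have hsub : Icc s T ∈ 𝓝[<] t₁ :=
      mem_of_superset hmem fun t ht => ⟨ht.1, ht.2.le.trans ht₁.2⟩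
    have c1 : ContinuousWithinAt (fun t => w t y) (Icc s T) t₁ :=
      (hwc (t₁, y) ⟨ht₁, mem_univ _⟩).comp (f := fun t : ℝ => (t, y))
        (by fun_prop) fun t ht => ⟨ht, mem_univ _⟩
    have c2 := (c1.mono_of_mem_nhdsWithin hsub).tendsto
    have c3 := ((hUc t₁ ht₁).mono_of_mem_nhdsWithin hsub).tendsto
    refine le_of_tendsto_of_tendsto c2 c3 ?_
    filter_upwards [hmem] with t ht using (hbefore t ht y).le
  have heq : w t₁ x₁ = U t₁ := le_antisymm (hle x₁) hge
  obtain ⟨D, hD, hDU⟩ := htouch t₁ ⟨hst₁, ht₁.2⟩ x₁ (fun y => heq ▸ hle y) heq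
  have := neg_deriv_contradiction (hD.sub (hU' t₁ ⟨hst₁, ht₁.2⟩)) hst₁ (by simp [heq])
    (fun t ht => by simpa using hbefore t ⟨ht.1.le, ht.2⟩ x₁)
  linarith

theorem DecaysOn.bounded {d : ℕ} {w : ℝ → Space d → ℝ} {s T : ℝ} {I : Set ℝ}
    (hw : DecaysOn w I) (hI : Icc s T ⊆ I) : ∃ m : ℝ, 0 < m ∧ ∀ t ∈ Icc s T, ∀ x, w t x < m := by
  obtain ⟨R, hR⟩ := hw.decay _ hI isCompact_Icc 1 one_pos
  have hKcc : IsCompact (Icc s T ×ˢ Metric.closedBall (0 : Space d) R) :=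
    isCompact_Icc.prod (isCompact_closedBall _ _)
  obtain ⟨M, hM⟩ := hKcc.exists_bound_of_continuousOn
    (hw.continuousOn.mono (prod_mono hI (subset_univ _)))
  refine ⟨|M| + 1, by positivity, fun t ht x => ?_⟩
  by_cases hx : R < ‖x‖
  · exact (hR t ht x hx).trans_le (by linarith [abs_nonneg M])
  · have h1 := hM (t, x) ⟨ht, by simpa using hx⟩
    have h2 := le_abs_self (w t x)
    rw [Real.norm_eq_abs] at h1
    linarith [le_abs_self M]

/-- If w is positive somewhere, decay confines the search for the maximum to a compact ball.
Otherwise w is identically zero and every point is a maximum. -/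
theorem maxLE_of_forall_le {d : ℕ} {γ b t c : ℝ} {V : Space d → ℝ} {n : ℝ → Space d → ℝ}
    {I : Set ℝ} (hw : DecaysOn (weightedGradSq γ b V n) I) (ht : t ∈ I)
    (hle : ∀ x, weightedGradSq γ b V n t x ≤ c) : MaxLE γ b V n t c := by
  have hnn : ∀ x, 0 ≤ weightedGradSq γ b V n t x := fun x => by
    rw [weightedGradSq]; positivity
  suffices h : ∃ x, ∀ y, weightedGradSq γ b V n t y ≤ weightedGradSq γ b V n t x by
    obtain ⟨x, hx⟩ := h
    exact ⟨_, ⟨mem_range_self x, by rintro _ ⟨y, rfl⟩; exact hx y⟩, hle x⟩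
  by_cases h0 : ∃ x₀, 0 < weightedGradSq γ b V n t x₀
  · obtain ⟨x₀, hx₀⟩ := h0
    obtain ⟨R, hR⟩ := hw.decay {t} (singleton_subset_iff.2 ht) isCompact_singleton _ hx₀
    have hx₀R : ‖x₀‖ ≤ R := by
      by_contra h
      exact lt_irrefl _ (hR t rfl x₀ (not_le.1 h))
    have hc : ContinuousOn (weightedGradSq γ b V n t) (Metric.closedBall 0 R) :=
      hw.continuousOn.comp (f := fun x : Space d => (t, x)) (by fun_prop)
        fun x _ => ⟨ht, mem_univ _⟩
    obtain ⟨x, -, hx⟩ := (isCompact_closedBall (0 : Space d) R).exists_isMaxOn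
      ⟨x₀, by simpa using hx₀R⟩ hc
    refine ⟨x, fun y => ?_⟩
    by_cases hy : R < ‖y‖
    · exact (hR t rfl y hy).le.trans (hx (by simpa using hx₀R))
    · exact hx (by simpa using hy)
  · push Not at h0
    exact ⟨0, fun y => (h0 y).trans (hnn 0)⟩

section Decay

variable {d : ℕ} {γ b : ℝ} {W : Space d → ℝ} {n : ℝ → Space d → ℝ} {I : Set ℝ}

theorem continuousWithinAt_weightedGradSq (hγ : γ ≠ 0)
    (hc : ContinuousOn (fun z : ℝ × Space d => n z.1 z.2) (I ×ˢ univ))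
    (hdiff : ∀ t ∈ I, ∀ x, 0 < n t x → DifferentiableAt ℝ (n t) x)
    (hgrad : ContinuousOn (fun z : ℝ × Space d => gradient (n z.1) z.2)
      {z | z.1 ∈ I ∧ 0 < n z.1 z.2})
    (hW : Continuous (gradient W)) {z : ℝ × Space d} (hz : z.1 ∈ I) (hzp : 0 < n z.1 z.2) :
    ContinuousWithinAt (fun z : ℝ × Space d => weightedGradSq γ b W n z.1 z.2) (I ×ˢ univ) z := by
  have hcz : ContinuousWithinAt (fun z : ℝ × Space d => n z.1 z.2) (I ×ˢ univ) z :=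
    hc z ⟨hz, mem_univ _⟩
  have hmem : {z : ℝ × Space d | z.1 ∈ I ∧ 0 < n z.1 z.2} ∈ 𝓝[I ×ˢ univ] z := by
    filter_upwards [hcz.tendsto.eventually (lt_mem_nhds hzp), self_mem_nhdsWithin] with y h1 h2
    exact ⟨h2.1, h1⟩
  have hgz : ContinuousWithinAt (fun z : ℝ × Space d => gradient (n z.1) z.2) (I ×ˢ univ) z :=
    (hgrad z ⟨hz, hzp⟩).mono_of_mem_nhdsWithin hmem
  have heq : ∀ y : ℝ × Space d, y.1 ∈ I → 0 < n y.1 y.2 → weightedGradSq γ b W n y.1 y.2 =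
      n y.1 y.2 ^ (γ * b) * ‖(|γ| * n y.1 y.2 ^ (γ - 1)) • gradient (n y.1) y.2 +
        gradient W y.2‖ ^ 2 := fun y hy hyp => by
    rw [weightedGradSq_of_pos hγ hyp, gradQ, gradient_pressure_of_pos hyp (hdiff _ hy _ hyp)]
  have hmain : ContinuousWithinAt (fun y : ℝ × Space d =>
      n y.1 y.2 ^ (γ * b) * ‖(|γ| * n y.1 y.2 ^ (γ - 1)) • gradient (n y.1) y.2 +
        gradient W y.2‖ ^ 2) (I ×ˢ univ) z := by
    refine (hcz.rpow_const (Or.inl hzp.ne')).mul (ContinuousWithinAt.pow ?_ 2)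
    refine ((((hcz.rpow_const (Or.inl hzp.ne')).const_mul _).smul hgz).add ?_).norm
    exact (hW.comp continuous_snd).continuousWithinAt
  refine hmain.congr_of_eventuallyEq ?_ (heq z hz hzp)
  filter_upwards [hmem] with y hy using heq y hy.1 hy.2

/-- At points where n = 0 the gradient of p may not exist. There w is squeezed by n^{γb}(M + |∇W|)²,
where M is a Lipschitz constant of p, and this tends to zero. The assumption on the time set
supplies such an M uniformly at nearby times. -/
theorem decaysOn_of_slowBounds (hγ : 0 < γ) (hb : 0 < b)
    (hI : ∀ t ∈ I, ∃ K ⊆ I, IsCompact K ∧ K ∈ 𝓝[I] t) (hS : SlowBounds γ n I)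
    (hnn : ∀ t ∈ I, ∀ x, 0 ≤ n t x)
    (hdiff : ∀ t ∈ I, ∀ x, 0 < n t x → DifferentiableAt ℝ (n t) x)
    (hgrad : ContinuousOn (fun z : ℝ × Space d => gradient (n z.1) z.2)
      {z | z.1 ∈ I ∧ 0 < n z.1 z.2})
    (hW : Continuous (gradient W)) : DecaysOn (weightedGradSq γ b W n) I := by
  have hzero : ∀ t x, n t x = 0 → weightedGradSq γ b W n t x = 0 := fun t x h => by
    rw [weightedGradSq, h, pressure, Real.zero_rpow hγ.ne', mul_zero, abs_zero,
      Real.zero_rpow hb.ne', zero_mul]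
  refine ⟨fun z hz => ?_, fun K hK hKc ε hε => ?_⟩
  · rcases (hnn z.1 hz.1 z.2).lt_or_eq with hp | hp
    · exact continuousWithinAt_weightedGradSq hγ.ne' hS.continuousOn hdiff hgrad hW hz.1 hp
    · obtain ⟨K, hKI, hKc, hKn⟩ := hI z.1 hz.1
      obtain ⟨M, hM⟩ := hS.lipschitz K hKI hKc
      have hcz : ContinuousWithinAt (fun z : ℝ × Space d => n z.1 z.2) (I ×ˢ univ) z :=
        hS.continuousOn z hz
      have hbd : ContinuousWithinAt (fun y : ℝ × Space d =>
          (n y.1 y.2 ^ γ) ^ b * (M + ‖gradient W y.2‖) ^ 2) (I ×ˢ univ) z := by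
        refine ((hcz.rpow_const (Or.inr hγ.le)).rpow_const (Or.inr hb.le)).mul ?_
        exact ((continuous_const.add (hW.comp continuous_snd).norm).pow 2).continuousWithinAt
      have hz0 : (n z.1 z.2 ^ γ) ^ b * (M + ‖gradient W z.2‖) ^ 2 = 0 := by
        rw [← hp, Real.zero_rpow hγ.ne', Real.zero_rpow hb.ne', zero_mul]
      have ht := hbd.tendsto
      rw [hz0] at ht
      rw [ContinuousWithinAt, hzero z.1 z.2 hp.symm]
      refine squeeze_zero' (Eventually.of_forall fun y => ?_) ?_ ht
      · rw [weightedGradSq]; positivity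
      · have h1 : ∀ᶠ y : ℝ × Space d in 𝓝[I ×ˢ univ] z, y.1 ∈ K := by
          have : Tendsto (fun y : ℝ × Space d => y.1) (𝓝[I ×ˢ univ] z) (𝓝[I] z.1) :=
            continuousWithinAt_fst.tendsto_nhdsWithin fun y hy => hy.1
          exact this hKn
        filter_upwards [h1, self_mem_nhdsWithin] with y hyK hyI
        rw [weightedGradSq, abs_pressure hγ.ne' (hnn y.1 hyI.1 y.2)]
        have h2 : ‖gradQ γ W n y.1 y.2‖ ≤ M + ‖gradient W y.2‖ := by
          refine (norm_add_le _ _).trans (add_le_add ?_ le_rfl)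
          rw [norm_gradient]
          exact norm_fderiv_le_of_lipschitz ℝ (hM y.1 hyK).2
        have h3 : 0 ≤ (n y.1 y.2 ^ γ) ^ b :=
          Real.rpow_nonneg (Real.rpow_nonneg (hnn y.1 hyI.1 y.2) _) _
        gcongr
  · obtain ⟨R, hR⟩ := hS.support K hK hKc
    refine ⟨R, fun t ht x hx => ?_⟩
    have h0 : n t x = 0 := image_eq_zero_of_notMem_tsupport fun h => by
      have := hR t ht h
      rw [mem_closedBall_zero_iff] at this
      linarith
    rw [hzero t x h0]; exact hε

/-- As γ - 1 < 0, the lower bound on n gives n^{γ-1} ≲ |x|^{2-2/γ}. Multiplied by |∇n| ≲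
|x|^{2/γ-1}, this leaves linear growth. -/
theorem norm_gradient_pressure_le_of_tail {k c : ℝ} {x : Space d} {t : ℝ} (hγ : γ < 0) (hk : 0 < k)
    (hx : 1 ≤ ‖x‖) (hd : DifferentiableAt ℝ (n t) x)
    (hlow : k * (1 + ‖x‖ ^ 2) ^ (1 / γ) ≤ n t x)
    (hg : ‖gradient (n t) x‖ ≤ c * ‖x‖ ^ (2 / γ - 1)) :
    ‖gradient (fun y => pressure γ (n t y)) x‖ ≤
      |γ| * k ^ (γ - 1) * (2 : ℝ) ^ (1 - 1 / γ) * c * ‖x‖ := by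
  have hx0 : 0 < ‖x‖ := by linarith
  have hq : 0 < 1 + ‖x‖ ^ 2 := by positivity
  have hq2 : 1 + ‖x‖ ^ 2 ≤ 2 * ‖x‖ ^ 2 := by nlinarith
  have hlow0 : 0 < k * (1 + ‖x‖ ^ 2) ^ (1 / γ) := by positivity
  have hnp : 0 < n t x := hlow0.trans_le hlow
  have hc : 0 ≤ c * ‖x‖ ^ (2 / γ - 1) := (norm_nonneg _).trans hg
  have hexp : 0 ≤ 1 - 1 / γ := by
    have : 1 / γ < 0 := one_div_neg.2 hγ
    linarith
  have h1 : n t x ^ (γ - 1) ≤ k ^ (γ - 1) * (2 ^ (1 - 1 / γ) * ‖x‖ ^ (2 - 2 / γ)) := by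
    calc n t x ^ (γ - 1) ≤ (k * (1 + ‖x‖ ^ 2) ^ (1 / γ)) ^ (γ - 1) :=
          Real.rpow_le_rpow_of_nonpos hlow0 hlow (by linarith)
      _ = k ^ (γ - 1) * (1 + ‖x‖ ^ 2) ^ (1 - 1 / γ) := by
          rw [Real.mul_rpow hk.le (by positivity), ← Real.rpow_mul hq.le]
          congr 2
          have := hγ.ne
          field_simp
      _ ≤ k ^ (γ - 1) * (2 * ‖x‖ ^ 2) ^ (1 - 1 / γ) := by gcongr
      _ = _ := by
          rw [Real.mul_rpow (by norm_num) (by positivity), ← Real.rpow_natCast ‖x‖ 2,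
            ← Real.rpow_mul hx0.le]
          congr 3
          push_cast; ring
  rw [gradient_pressure_of_pos hnp hd, norm_smul, Real.norm_of_nonneg (by positivity)]
  calc |γ| * n t x ^ (γ - 1) * ‖gradient (n t) x‖
      ≤ |γ| * (k ^ (γ - 1) * (2 ^ (1 - 1 / γ) * ‖x‖ ^ (2 - 2 / γ))) *
        (c * ‖x‖ ^ (2 / γ - 1)) := by gcongr
    _ = |γ| * k ^ (γ - 1) * (2 : ℝ) ^ (1 - 1 / γ) * c *
        (‖x‖ ^ (2 - 2 / γ) * ‖x‖ ^ (2 / γ - 1)) := by ring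
    _ = _ := by
        rw [← Real.rpow_add hx0]
        ring_nf
        simp

/-- In the tail n^{γb} ≲ |x|^{2b} and |∇q|² ≲ |x|², so w ≲ |x|^{2(b+1)}. This is where b < -1
enters. -/
theorem decaysOn_of_fastBounds (hγ : γ < 0) (hb : b < -1) (hF : FastBounds γ n I)
    (hc : ContinuousOn (fun z : ℝ × Space d => n z.1 z.2) (I ×ˢ univ))
    (hdiff : ∀ t ∈ I, ∀ x, 0 < n t x → DifferentiableAt ℝ (n t) x)
    (hgrad : ContinuousOn (fun z : ℝ × Space d => gradient (n z.1) z.2)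
      {z | z.1 ∈ I ∧ 0 < n z.1 z.2})
    (hW : Continuous (gradient W)) {CW : ℝ} (hWg : ∀ x, ‖gradient W x‖ ≤ CW * (1 + ‖x‖)) :
    DecaysOn (weightedGradSq γ b W n) I := by
  refine ⟨fun z hz => continuousWithinAt_weightedGradSq hγ.ne hc hdiff hgrad hW hz.1
    (hF.pos z.1 hz.1 z.2), fun J hJ hJc ε hε => ?_⟩
  obtain ⟨k, K, c, R, hk, hR, htail⟩ := hF.tail J hJ hJc
  have hCW : 0 ≤ CW := by simpa using (norm_nonneg _).trans (hWg 0)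
  set C₁ := |γ| * k ^ (γ - 1) * (2 : ℝ) ^ (1 - 1 / γ) * c + 2 * CW with hC₁
  set C₂ := K ^ (γ * b) * C₁ ^ 2 with hC₂
  have hlim : Tendsto (fun r : ℝ => C₂ * (r ^ (-(-(2 * (b + 1)))))) atTop (𝓝 0) := by
    simpa using (tendsto_rpow_neg_atTop (y := -(2 * (b + 1))) (by linarith)).const_mul C₂
  obtain ⟨R₁, hR₁⟩ := eventually_atTop.1 (hlim.eventually (gt_mem_nhds hε))
  refine ⟨max (max R 1) R₁, fun t ht x hx => ?_⟩
  have hxR : R < ‖x‖ := (le_max_left _ _).trans_lt ((le_max_left _ _).trans_lt hx)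
  have hx1 : 1 < ‖x‖ := (le_max_right _ _).trans_lt ((le_max_left _ _).trans_lt hx)
  have hxR₁ : R₁ ≤ ‖x‖ := ((le_max_right _ _).trans_lt hx).le
  have hx0 : 0 < ‖x‖ := by linarith
  obtain ⟨hlow, hupp, hg⟩ := htail t ht x hxR
  have hq : 0 < 1 + ‖x‖ ^ 2 := by positivity
  have hqp : 0 < (1 + ‖x‖ ^ 2) ^ (1 / γ) := by positivity
  have hnp : 0 < n t x := hF.pos t (hJ ht) x
  have hK : 0 < K := by
    have := hnp.trans_le hupp
    exact pos_of_mul_pos_left this hqp.le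
  have hgp := norm_gradient_pressure_le_of_tail hγ hk hx1.le (hdiff t (hJ ht) x hnp) hlow hg
  have hgq : ‖gradQ γ W n t x‖ ≤ C₁ * ‖x‖ := by
    refine (norm_add_le _ _).trans ((add_le_add hgp (hWg x)).trans ?_)
    have : CW * (1 + ‖x‖) ≤ CW * (2 * ‖x‖) := mul_le_mul_of_nonneg_left (by linarith) hCW
    rw [hC₁]; linarith
  have hγb : 0 < γ * b := mul_pos_of_neg_of_neg hγ (by linarith)
  have hpb : n t x ^ (γ * b) ≤ K ^ (γ * b) * ‖x‖ ^ (2 * b) := by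
    calc n t x ^ (γ * b) ≤ (K * (1 + ‖x‖ ^ 2) ^ (1 / γ)) ^ (γ * b) :=
          Real.rpow_le_rpow hnp.le hupp hγb.le
      _ = K ^ (γ * b) * (1 + ‖x‖ ^ 2) ^ b := by
          rw [Real.mul_rpow hK.le hqp.le, ← Real.rpow_mul hq.le]
          congr 2
          have := hγ.ne
          field_simp
      _ ≤ K ^ (γ * b) * (‖x‖ ^ 2) ^ b := by
          refine mul_le_mul_of_nonneg_left ?_ (by positivity)
          exact Real.rpow_le_rpow_of_nonpos (by positivity) (by linarith) (by linarith)
      _ = _ := by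
          rw [← Real.rpow_natCast ‖x‖ 2, ← Real.rpow_mul hx0.le]
          norm_num
  rw [weightedGradSq_of_pos hγ.ne hnp]
  calc n t x ^ (γ * b) * ‖gradQ γ W n t x‖ ^ 2
      ≤ (K ^ (γ * b) * ‖x‖ ^ (2 * b)) * (C₁ * ‖x‖) ^ 2 := by gcongr
    _ = C₂ * (‖x‖ ^ (2 * b) * ‖x‖ ^ (2 : ℝ)) := by
        rw [hC₂, Real.rpow_two]; ring
    _ = C₂ * ‖x‖ ^ (-(-(2 * (b + 1)))) := by
        rw [← Real.rpow_add hx0]; ring_nf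
    _ < ε := hR₁ _ hxR₁

theorem IsWellBehaved.gradient_continuousOn (hn : IsWellBehaved γ W n) (hγ : γ ≠ 0) :
    ContinuousOn (fun z : ℝ × Space d => gradient (n z.1) z.2)
      {z | z.1 ∈ Ioi 0 ∧ 0 < n z.1 z.2} := by
  intro z hz
  apply ContinuousAt.continuousWithinAt
  have hz' : z ∈ posSet n := hz
  have h1 : (fun z : ℝ × Space d => gradient (n z.1) z.2) =ᶠ[𝓝 z] fun z => WithLp.toLp 2 fun i =>
      fderiv ℝ (fun z : ℝ × Space d => n z.1 z.2) z (0, EuclideanSpace.single i 1) := by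
    filter_upwards [(hn.isOpen_posSet hγ).mem_nhds hz'] with y hy
    ext i
    rw [gradient_apply]
    exact pd_slice_of_differentiableAt (L := fun z : ℝ × Space d => n z.1 z.2)
      (hn.differentiableAt hγ (z := (y.1, y.2)) hy) i
  refine ContinuousAt.congr ?_ h1.symm
  refine (PiLp.continuous_toLp 2 _).continuousAt.comp (continuousAt_pi.2 fun i => ?_)
  exact ((hn.contDiffAt hγ hz').continuousAt_fderiv (by simp)).clm_apply continuousAt_const

/-- The weighted gradient of a well-behaved solution is continuous and decays, for `t > 0`. -/
theorem IsWellBehaved.decaysOn (hn : IsWellBehaved γ W n)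
    (hcase : (0 < γ ∧ 0 < b) ∨ (γ < 0 ∧ b < -1)) (hW : Continuous (gradient W)) {CW : ℝ}
    (hWg : ∀ x, ‖gradient W x‖ ≤ CW * (1 + ‖x‖)) : DecaysOn (weightedGradSq γ b W n) (Ioi 0) := by
  have hγ : γ ≠ 0 := by rcases hcase with h | h; exacts [h.1.ne', h.1.ne]
  have hdiff : ∀ t ∈ Ioi (0 : ℝ), ∀ x, 0 < n t x → DifferentiableAt ℝ (n t) x := fun t ht x hx =>
    (hn.contDiffAt_slice hγ ⟨ht, hx⟩).differentiableAt (by simp)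
  rcases hcase with ⟨h1, h2⟩ | ⟨h1, h2⟩
  · refine decaysOn_of_slowBounds h1 h2 (fun t ht => ⟨Icc (t / 2) (t + 1), fun s hs => ?_,
      isCompact_Icc, mem_nhdsWithin_of_mem_nhds (Icc_mem_nhds ?_ ?_)⟩) (hn.slow h1).1
      (fun t ht x => hn.strong.nonneg t (le_of_lt ht) x) hdiff (hn.gradient_continuousOn hγ) hW
    · have : (0 : ℝ) < t := ht
      exact lt_of_lt_of_le (by linarith : (0 : ℝ) < t / 2) hs.1
    · have : (0 : ℝ) < t := ht
      linarith
    · linarith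
  · exact decaysOn_of_fastBounds h1 h2 (hn.fast h1).1 (hn.fast h1).2.continuousOn hdiff
      (hn.gradient_continuousOn hγ) hW hWg

/-- The weighted gradient of a solution that is regular up to `t = 0` is continuous and decays,
for `t ≥ 0`. -/
theorem IsRegularUpToZero.decaysOn (hr : IsRegularUpToZero γ n) (hn : IsWellBehaved γ W n)
    (hcase : (0 < γ ∧ 0 < b) ∨ (γ < 0 ∧ b < -1)) (hW : Continuous (gradient W)) {CW : ℝ}
    (hWg : ∀ x, ‖gradient W x‖ ≤ CW * (1 + ‖x‖)) : DecaysOn (weightedGradSq γ b W n) (Ici 0) := by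
  have hγ : γ ≠ 0 := by rcases hcase with h | h; exacts [h.1.ne', h.1.ne]
  have hdiff : ∀ t ∈ Ici (0 : ℝ), ∀ x, 0 < n t x → DifferentiableAt ℝ (n t) x := fun t ht x hx => by
    rcases eq_or_lt_of_le (show (0 : ℝ) ≤ t from ht) with h | h
    · subst h; exact hr.differentiable_initial x hx
    · exact (hn.contDiffAt_slice hγ ⟨h, hx⟩).differentiableAt (by simp)
  rcases hcase with ⟨h1, h2⟩ | ⟨h1, h2⟩
  · refine decaysOn_of_slowBounds h1 h2 (fun t ht => ⟨Icc 0 (t + 1), fun s hs => hs.1,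
      isCompact_Icc, ?_⟩) (hr.slow h1)
      (fun t ht x => hn.strong.nonneg t ht x) hdiff hr.gradient_continuousOn hW
    filter_upwards [self_mem_nhdsWithin, mem_nhdsWithin_of_mem_nhds
      (Iic_mem_nhds (show t < t + 1 by linarith))] with s hs1 hs2 using ⟨hs1, hs2⟩
  · exact decaysOn_of_fastBounds h1 h2 (hr.fast h1).1 (hr.fast h1).2 hdiff
      hr.gradient_continuousOn hW hWg

end Decay

/-! ### Decay estimates from differential inequalities -/

/-- If `∂ₜ w ≤ -c w^{1+θ}` at spatial maxima where `w ≥ C₁`, then `w ≤ C₁ + C t^{-1/θ}`. -/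
theorem DecaysOn.le_of_superlinear {d : ℕ} {w : ℝ → Space d → ℝ} (hw : DecaysOn w (Ioi 0))
    {c θ C₁ : ℝ} (hc : 0 < c) (hθ : 0 < θ) (hC₁ : 0 ≤ C₁)
    (htouch : ∀ t > 0, ∀ x, (∀ y, w t y ≤ w t x) → 0 < w t x → C₁ ≤ w t x →
      ∃ D, HasDerivAt (fun τ => w τ x) D t ∧ D ≤ -c * w t x ^ (1 + θ)) :
    ∀ t > 0, ∀ x, w t x ≤ C₁ + (2 / (c * θ)) ^ (1 / θ) * (t / 2) ^ (-(1 / θ)) := by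
  intro t ht x
  -- With this C the function Y = C(τ - t/2)^{-1/θ} solves Y' = -(c/2)Y^{1+θ}. Half the available
  -- rate is used, so that the inequality at a contact point is strict.
  set C := (2 / (c * θ)) ^ (1 / θ) with hC
  have hCpos : 0 < C := by positivity
  have hCθ : C ^ (-θ) = c * θ / 2 := by
    rw [hC, ← Real.rpow_mul (by positivity)]
    have : 1 / θ * -θ = -1 := by field_simp
    rw [this, Real.rpow_neg_one, inv_div]
  obtain ⟨m, hm, hmw⟩ := hw.bounded (s := t / 2) (T := t) fun s hs =>
    lt_of_lt_of_le (by linarith : (0 : ℝ) < t / 2) hs.1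
  -- The barrier blows up at time t/2. Starting at t/2 + σ, where it already exceeds the bound m for
  -- w on [t/2, t], makes the estimate independent of the initial size of w.
  set σ := min (t / 2) ((m / C) ^ (-θ)) with hσ
  have hσpos : 0 < σ := lt_min (by linarith) (by positivity)
  have hσt : σ ≤ t / 2 := min_le_left _ _
  set U : ℝ → ℝ := fun τ => C₁ + C * (τ - t / 2) ^ (-(1 / θ)) with hU
  set U' : ℝ → ℝ := fun τ => C * (-(1 / θ) * (τ - t / 2) ^ (-(1 / θ) - 1)) with hU'
  have hUd : ∀ τ, t / 2 < τ → HasDerivAt U (U' τ) τ := by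
    intro τ hτ
    have h1 : HasDerivAt (fun τ : ℝ => τ - t / 2) 1 τ := (hasDerivAt_id τ).sub_const _
    have h2 := (h1.rpow_const (p := -(1 / θ)) (Or.inl (by linarith))).const_mul C
    refine (h2.const_add C₁).congr_deriv ?_
    simp only [hU']; ring
  have hlt := hw.lt_of_touching (s := t / 2 + σ) (T := t) (U := U) (U' := U')
    (fun s hs => lt_of_lt_of_le (by linarith : (0 : ℝ) < t / 2 + σ) hs.1)
    (fun τ hτ => (hUd τ (by linarith [hτ.1])).continuousAt.continuousWithinAt)
    (fun τ hτ => by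
      have : 0 < τ - t / 2 := by linarith [hτ.1]
      simp only [hU]; positivity)
    (fun τ hτ => hUd τ (by linarith [hτ.1]))
    (fun y => by
      refine (hmw (t / 2 + σ) ⟨by linarith, by linarith⟩ y).trans_le ?_
      simp only [hU, add_sub_cancel_left]
      have h1 : ((m / C) ^ (-θ)) ^ (-(1 / θ)) ≤ σ ^ (-(1 / θ)) :=
        Real.rpow_le_rpow_of_nonpos hσpos (min_le_right _ _) (by
          have : 0 < 1 / θ := by positivity
          linarith)
      rw [← Real.rpow_mul (by positivity)] at h1
      have h2 : -θ * -(1 / θ) = 1 := by field_simp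
      rw [h2, Real.rpow_one, div_le_iff₀ hCpos] at h1
      linarith)
    (fun τ hτ y hmax hy => by
      have hτ0 : 0 < τ - t / 2 := by linarith [hτ.1]
      set Y := C * (τ - t / 2) ^ (-(1 / θ)) with hY
      have hYpos : 0 < Y := by positivity
      have hUY : U τ = C₁ + Y := rfl
      obtain ⟨D, hD, hDle⟩ := htouch τ (by linarith) y hmax (by rw [hy, hUY]; linarith)
        (by rw [hy, hUY]; linarith)
      refine ⟨D, hD, hDle.trans_lt ?_⟩
      have h1 : Y ^ (1 + θ) ≤ w τ y ^ (1 + θ) :=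
        Real.rpow_le_rpow hYpos.le (by rw [hy, hUY]; linarith) (by linarith)
      have h2 : U' τ = -(c / 2) * Y ^ (1 + θ) := by
        have e1 : Y ^ (1 + θ) = C * C ^ θ * (τ - t / 2) ^ (-(1 / θ) - 1) := by
          rw [hY, Real.mul_rpow hCpos.le (by positivity), ← Real.rpow_mul hτ0.le,
            Real.rpow_add hCpos, Real.rpow_one]
          congr 2
          field_simp
          ring
        have e2 : C ^ θ * (c * θ / 2) = 1 := by
          rw [← hCθ, ← Real.rpow_add hCpos]; simp
        have e3 : c / 2 * C ^ θ = 1 / θ := by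
          field_simp; linarith
        rw [e1]
        simp only [hU']
        calc C * (-(1 / θ) * (τ - t / 2) ^ (-(1 / θ) - 1))
            = -(C * (1 / θ) * (τ - t / 2) ^ (-(1 / θ) - 1)) := by ring
          _ = _ := by rw [← e3]; ring
      have h3 : 0 < Y ^ (1 + θ) := by positivity
      rw [h2]
      nlinarith)
    t ⟨by linarith, le_rfl⟩ x
  have : t - t / 2 = t / 2 := by ring
  simp only [hU, this] at hlt
  exact hlt.le

/-! ### Exponents and potentials -/

/-- The quantity equals (1 - γ²m) - (β - 1)². The strict hypotheses force the square root to be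
positive, so the radicand is positive without a separate assumption. -/
theorem discr_pos_of_abs_lt {γ β m : ℝ} (h1 : 1 - √(1 - γ ^ 2 * m) < β)
    (h2 : β < 1 + √(1 - γ ^ 2 * m)) : 0 < 2 * β - β ^ 2 - γ ^ 2 * m := by
  have hs : 0 < √(1 - γ ^ 2 * m) := by linarith
  have hsq := Real.sq_sqrt (Real.sqrt_pos.1 hs).le
  nlinarith

/-- With non-strict bounds and a negative radicand the square root would be 0 and β = 1 admissible,
so the sign of the radicand has to be assumed. -/
theorem discr_nonneg_of_abs_le {γ β m : ℝ} (h1 : 1 - √(1 - γ ^ 2 * m) ≤ β)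
    (h2 : β ≤ 1 + √(1 - γ ^ 2 * m)) (h : γ ^ 2 * m ≤ 1) : 0 ≤ 2 * β - β ^ 2 - γ ^ 2 * m := by
  have hsq := Real.sq_sqrt (sub_nonneg.2 h)
  nlinarith

theorem CoeffGeneric.cases {d : ℕ} {γ b : ℝ} (h : CoeffGeneric d γ b) :
    (0 < γ ∧ 0 < b) ∨ (γ < 0 ∧ b < -1) := by
  rcases h.2 with h | h
  · exact Or.inl ⟨h.1, h.2.1⟩
  · refine Or.inr ⟨h.1, ?_⟩
    have := h.2.2.2.1
    rw [abs_of_neg h.1] at this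
    nlinarith [h.1]

theorem CoeffGeneric.le_one {d : ℕ} {γ b : ℝ} (h : CoeffGeneric d γ b) : γ ≤ 1 := by
  rcases h.2 with h | h
  · have := h.2.2.1.trans ((min_le_right _ _).trans (min_le_right _ _))
    linarith
  · linarith [h.1]

theorem mul_pos_of_cases {γ b : ℝ} (h : (0 < γ ∧ 0 < b) ∨ (γ < 0 ∧ b < -1)) :
    0 < γ * b ∧ 0 < γ * b + γ ∧ γ ≠ 0 := by
  rcases h with ⟨h1, h2⟩ | ⟨h1, h2⟩
  · exact ⟨by positivity, by positivity, h1.ne'⟩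
  · exact ⟨by nlinarith, by nlinarith, h1.ne⟩

theorem continuous_gradient_of_continuous_fderiv {d : ℕ} {W : Space d → ℝ}
    (h : Continuous (fderiv ℝ W)) : Continuous (gradient W) :=
  (InnerProductSpace.toDual ℝ (Space d)).symm.continuous.comp h

theorem hasBoundedDerivatives_zero (d : ℕ) :
    HasBoundedDerivatives (fun _ : Space d => (0 : ℝ)) 0 0 := by
  have : ∀ x : Space d, gradient (fun _ : Space d => (0 : ℝ)) x = 0 := fun x => by
    simp [gradient]
  exact ⟨differentiable_const _, fun x => by simp [this], fun x y => by simp [this]⟩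

theorem gradient_zero_fun {d : ℕ} (x : Space d) :
    gradient (fun _ : Space d => (0 : ℝ)) x = 0 := by
  simp [gradient]

theorem pd_half_norm_sq {d : ℕ} (i : Fin d) (x : Space d) :
    pd i (fun x : Space d => ‖x‖ ^ 2 / 2) x = x i := by
  have h : (fun x : Space d => ‖x‖ ^ 2 / 2) = fun x => 1 / 2 * sqDist 0 x := by
    funext y; rw [sqDist_eq]; simp; ring
  rw [h, pd_const_mul (differentiable_of_contDiff (contDiff_sqDist 0) x), pd_sqDist]
  simp

theorem gradient_half_norm_sq {d : ℕ} (x : Space d) :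
    gradient (fun x : Space d => ‖x‖ ^ 2 / 2) x = x := by
  ext i; rw [gradient_apply, pd_half_norm_sq]

theorem pos_of_weightedGradSq_pos {d : ℕ} {γ b : ℝ} {W : Space d → ℝ} {n : ℝ → Space d → ℝ}
    (hγ : γ ≠ 0) (hb : b ≠ 0) {t : ℝ} {x : Space d} (hn : 0 ≤ n t x)
    (h : 0 < weightedGradSq γ b W n t x) : 0 < n t x := by
  rcases hn.lt_or_eq with h1 | h1
  · exact h1
  · rw [weightedGradSq, ← h1, pressure, Real.zero_rpow hγ, mul_zero, abs_zero,
      Real.zero_rpow hb, zero_mul] at h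
    exact absurd h (lt_irrefl _)

/-! ### Potentials with bounded derivatives -/

section Generic

variable {d : ℕ} {γ b : ℝ}

/-- When w is large, boundedness of n makes |∇q| large compared with |∇V|, so ⟨∇p, ∇q⟩ ≥ |∇q|²/2.
The good term is then quadratic in w and absorbs the linear error caused by D²V. -/
theorem exists_generic_touching (hcoeff : CoeffGeneric d γ b) (A B N : ℝ) :
    ∃ C₁ > 0, ∃ c > 0, ∀ (V : Space d → ℝ) (n : ℝ → Space d → ℝ),
      HasBoundedDerivatives V A B → IsWellBehaved γ V n → (∀ t > 0, ∀ x, n t x ≤ N) →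
        ∀ t > 0, ∀ x, (∀ y, weightedGradSq γ b V n t y ≤ weightedGradSq γ b V n t x) →
          C₁ ≤ weightedGradSq γ b V n t x →
            ∃ D, HasDerivAt (fun τ => weightedGradSq γ b V n τ x) D t ∧
              D ≤ -c * weightedGradSq γ b V n t x ^ (1 + (1 : ℝ)) := by
  obtain ⟨hβ, hβγ, hγ⟩ := mul_pos_of_cases hcoeff.cases
  have hb : b ≠ 0 := right_ne_zero_of_mul hβ.ne'
  set β := γ * b with hβdef
  set κ := (2 * β - β ^ 2 - γ ^ 2 * ((d : ℝ) - 1)) / 2 with hκdef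
  have hκ : 0 < κ := half_pos (discr_pos_of_abs_lt hcoeff.1.1 hcoeff.1.2)
  set N' := max N 1 with hN'
  have hN'0 : 0 < N' := lt_of_lt_of_le one_pos (le_max_right _ _)
  set A' := max A 0 with hA'
  have hA'0 : 0 ≤ A' := le_max_right _ _
  set B' := max B 0 with hB'
  have hB'0 : 0 ≤ B' := le_max_right _ _
  -- The good term is at most -2c w²: a factor 4 comes from squaring |g|²/2, and a factor 2 reserves
  -- half of it for the error E w.
  set c := κ * N' ^ (-(β + γ)) / (8 * |γ|) with hc
  have hc0 : 0 < c := by positivity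
  set E := (β * d + 2) * B' with hE
  have hE0 : 0 ≤ E := by positivity
  refine ⟨N' ^ β * (4 * A' ^ 2) + E / c + 1, by positivity, c, hc0, ?_⟩
  intro V n hV hn hnN t ht x hmax hle
  set w := weightedGradSq γ b V n t x with hw
  have hwpos : 0 < w := lt_of_lt_of_le (by positivity) hle
  have hnp : 0 < n t x :=
    pos_of_weightedGradSq_pos hγ hb (hn.strong.nonneg t ht.le x) hwpos
  obtain ⟨D, hD, hDle⟩ := hn.exists_hasDerivAt_le hγ hcoeff.le_one hβ.le (lam := 0) hV
    (fun x i => by simp) ⟨ht, hnp⟩ hmax hwpos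
  refine ⟨D, hD, hDle.trans ?_⟩
  set g := gradQ γ V n t x with hg
  have hwe : w = n t x ^ β * ‖g‖ ^ 2 := weightedGradSq_of_pos hγ hnp
  have hnN' : n t x ≤ N' := (hnN t ht x).trans (le_max_left _ _)
  have hnβ : 0 < n t x ^ β := by positivity
  -- A smaller gradient would give w ≤ N'^β · 4A'², which is below the threshold C₁.
  have hgA : 2 * A' ≤ ‖g‖ := by
    by_contra hlt
    push Not at hlt
    have h1 : n t x ^ β * ‖g‖ ^ 2 ≤ N' ^ β * (2 * A') ^ 2 := by gcongr
    rw [← hwe] at h1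
    have h2 : 0 ≤ E / c := by positivity
    have h3 : (2 * A') ^ 2 = 4 * A' ^ 2 := by ring
    rw [h3] at h1
    linarith
  have hinner : ‖g‖ ^ 2 / 2 ≤ inner ℝ (g - gradient V x) g := by
    rw [inner_sub_left, real_inner_self_eq_norm_sq]
    have h1 := real_inner_le_norm (gradient V x) g
    have h2 : ‖gradient V x‖ * ‖g‖ ≤ A' * ‖g‖ :=
      mul_le_mul_of_nonneg_right ((hV.gradient_le x).trans (le_max_left _ _)) (norm_nonneg _)
    nlinarith [norm_nonneg g]
  have hinner2 : (‖g‖ ^ 2 / 2) ^ 2 ≤ inner ℝ (g - gradient V x) g ^ 2 :=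
    pow_le_pow_left₀ (by positivity) hinner 2
  have hden : 0 < |γ| * n t x ^ γ := by positivity
  have h1 : n t x ^ β * (-κ * (inner ℝ (g - gradient V x) g ^ 2 / (|γ| * n t x ^ γ))) ≤
      -(2 * c) * w ^ 2 := by
    have e1 : (‖g‖ ^ 2 / 2) ^ 2 / (|γ| * n t x ^ γ) ≤
        inner ℝ (g - gradient V x) g ^ 2 / (|γ| * n t x ^ γ) := by gcongr
    have e2 : N' ^ (-(β + γ)) ≤ n t x ^ (-(β + γ)) :=
      Real.rpow_le_rpow_of_nonpos hnp hnN' (by linarith)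
    have e3 : n t x ^ β * ((‖g‖ ^ 2 / 2) ^ 2 / (|γ| * n t x ^ γ)) =
        n t x ^ (-(β + γ)) * w ^ 2 / (4 * |γ|) := by
      rw [hwe, Real.rpow_neg hnp.le, Real.rpow_add hnp]
      field_simp
      ring
    have e4 : 2 * c * w ^ 2 = κ * (N' ^ (-(β + γ)) * w ^ 2 / (4 * |γ|)) := by
      rw [hc]; field_simp; ring
    have e5 : N' ^ (-(β + γ)) * w ^ 2 / (4 * |γ|) ≤ n t x ^ (-(β + γ)) * w ^ 2 / (4 * |γ|) := by
      gcongr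
    have e6 := mul_le_mul_of_nonneg_left e1 (mul_pos hκ hnβ).le
    have e7 := mul_le_mul_of_nonneg_left e5 hκ.le
    rw [← e4, ← e3] at e7
    linarith
  have h2 : n t x ^ β * ((0 * (β * d - 2) + (β * d + 2) * B) * ‖g‖ ^ 2) ≤ E * w := by
    have : (β * d + 2) * B ≤ E := mul_le_mul_of_nonneg_left (le_max_left _ _) (by positivity)
    calc n t x ^ β * ((0 * (β * d - 2) + (β * d + 2) * B) * ‖g‖ ^ 2)
        = (β * d + 2) * B * w := by rw [hwe]; ring
      _ ≤ E * w := mul_le_mul_of_nonneg_right this hwpos.le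
  have h3 : E * w ≤ c * w ^ 2 := by
    have : E / c ≤ w := by
      have : 0 ≤ N' ^ β * (4 * A' ^ 2) := by positivity
      linarith
    rw [div_le_iff₀ hc0] at this
    nlinarith
  have h4 : w ^ (1 + (1 : ℝ)) = w ^ 2 := by rw [one_add_one_eq_two, Real.rpow_two]
  rw [h4, mul_add]
  simp only [← hβdef, ← hκdef]
  linarith

theorem HasBoundedDerivatives.norm_gradient_le_linear {V : Space d → ℝ} {A B : ℝ}
    (hV : HasBoundedDerivatives V A B) (x : Space d) : ‖gradient V x‖ ≤ |A| * (1 + ‖x‖) := by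
  refine (hV.gradient_le x).trans ((le_abs_self A).trans ?_)
  nlinarith [abs_nonneg A, norm_nonneg x, mul_nonneg (abs_nonneg A) (norm_nonneg x)]

theorem generic_estimate (hcoeff : CoeffGeneric d γ b) (A B N : ℝ) :
    (∃ C₁ > 0, ∃ C₂ > 0, ∀ (V : Space d → ℝ) (n : ℝ → Space d → ℝ),
        HasBoundedDerivatives V A B → IsWellBehaved γ V n → (∀ t > 0, ∀ x, n t x ≤ N) →
          ∀ t > 0, MaxLE γ b V n t (max C₁ (C₂ * t⁻¹))) ∧
      (∀ C₀ : ℝ, ∃ C > 0, ∀ (V : Space d → ℝ) (n : ℝ → Space d → ℝ),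
        HasBoundedDerivatives V A B → IsWellBehaved γ V n → (∀ t > 0, ∀ x, n t x ≤ N) →
          IsRegularUpToZero γ n → IsLUB (Set.range (weightedGradSq γ b V n 0)) C₀ →
            ∀ t > 0, MaxLE γ b V n t C) := by
  obtain ⟨C₁, hC₁, c, hc, htouch⟩ := exists_generic_touching hcoeff A B N
  -- The barrier gives C₁ + 4/(ct), which is at most twice the larger summand. The second part uses
  -- a constant barrier; adding 1 makes the initial inequality strict.
  refine ⟨⟨2 * C₁, by positivity, 8 / c, by positivity, ?_⟩, fun C₀ =>
    ⟨max C₁ C₀ + 1, by linarith [le_max_left C₁ C₀], ?_⟩⟩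
  · intro V n hV hn hnN t ht
    have hdec := hn.decaysOn hcoeff.cases
      (continuous_gradient_of_continuous_fderiv hV.continuous_fderiv) hV.norm_gradient_le_linear
    refine maxLE_of_forall_le hdec ht fun x => ?_
    have h := hdec.le_of_superlinear hc one_pos hC₁.le
      (fun t ht x hmax _ hle => htouch V n hV hn hnN t ht x hmax hle) t ht x
    refine h.trans ?_
    have e : (2 / (c * 1)) ^ (1 / (1 : ℝ)) * (t / 2) ^ (-(1 / (1 : ℝ))) = 4 / c * t⁻¹ := by
      rw [div_one, Real.rpow_one, Real.rpow_neg_one]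
      field_simp
      norm_num
    rw [e]
    have h8 : 8 / c * t⁻¹ = 2 * (4 / c * t⁻¹) := by ring
    rw [h8]
    rcases le_total C₁ (4 / c * t⁻¹) with h' | h'
    · exact le_max_of_le_right (by linarith)
    · exact le_max_of_le_left (by linarith)
  · intro V n hV hn hnN hr hlub t ht
    have hdec := hr.decaysOn hn hcoeff.cases
      (continuous_gradient_of_continuous_fderiv hV.continuous_fderiv) hV.norm_gradient_le_linear
    refine maxLE_of_forall_le hdec ht.le fun x => ?_
    have hCpos : 0 < max C₁ C₀ + 1 := by linarith [le_max_left C₁ C₀]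
    refine (hdec.lt_of_touching (s := 0) (T := t) (U := fun _ => max C₁ C₀ + 1) (U' := fun _ => 0)
      (fun s hs => hs.1) continuousOn_const (fun _ _ => hCpos)
      (fun τ _ => hasDerivAt_const τ _) (fun y => ?_) (fun τ hτ y hmax hy => ?_) t
      ⟨ht.le, le_rfl⟩ x).le
    · have := hlub.1 (mem_range_self y)
      linarith [le_max_right C₁ C₀]
    · obtain ⟨D, hD, hDle⟩ := htouch V n hV hn hnN τ hτ.1 y hmax
        (by rw [hy]; linarith [le_max_left C₁ C₀])
      refine ⟨D, hD, hDle.trans_lt ?_⟩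
      rw [hy]
      have : 0 < (max C₁ C₀ + 1) ^ (1 + (1 : ℝ)) := by positivity
      nlinarith

end Generic

/-! ### The quadratic potential -/

section Quadratic

variable {d : ℕ} {γ b : ℝ}

theorem CoeffQuadratic.cases (h : CoeffQuadratic d γ b) :
    (0 < γ ∧ 0 < b) ∨ (γ < 0 ∧ b < -1) := by
  rcases h.2 with h | h
  · exact Or.inl ⟨h.1, h.2.1⟩
  · refine Or.inr ⟨h.1, ?_⟩
    have := h.2.2.2.1
    rw [abs_of_neg h.1] at this
    nlinarith [h.1]

theorem CoeffQuadratic.le_one (hd : 2 ≤ d) (h : CoeffQuadratic d γ b) : γ ≤ 1 := by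
  rcases h.2 with h | h
  · have h1 := h.2.2.1.trans_le (min_le_right _ _)
    have h2 : (2 : ℝ) ≤ d := by exact_mod_cast hd
    have h3 : 2 / (d : ℝ) ≤ 1 := by rw [div_le_one (by linarith)]; exact h2
    linarith
  · linarith [h.1]

theorem CoeffQuadratic.mul_lt (hd : 2 ≤ d) (h : CoeffQuadratic d γ b) : γ * b * d < 2 := by
  have h2 : (0 : ℝ) < d := by exact_mod_cast (by omega : 0 < d)
  rw [← lt_div_iff₀ h2]
  rcases h.2 with h | h
  · exact h.2.2.2.trans_le (min_le_right _ _)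
  · exact h.2.2.2.2.trans_le (min_le_right _ _)

/-- It follows from |γ| < 2/d and 4(d - 1) ≤ d². -/
theorem CoeffQuadratic.sq_mul_le (hd : 2 ≤ d) (h : CoeffQuadratic d γ b) :
    γ ^ 2 * ((d : ℝ) - 1) ≤ 1 := by
  have h2 : (2 : ℝ) ≤ d := by exact_mod_cast hd
  have h0 : (0 : ℝ) < d := by linarith
  have h3 : |γ| < 2 / d := by
    rcases h.2 with h | h
    · rw [abs_of_pos h.1]; exact h.2.2.1.trans_le (min_le_right _ _)
    · exact h.2.2.1
  have h4 : γ ^ 2 ≤ (2 / d) ^ 2 := by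
    rw [← sq_abs]; exact pow_le_pow_left₀ (abs_nonneg _) h3.le 2
  have h5 : (2 / (d : ℝ)) ^ 2 * ((d : ℝ) - 1) ≤ 1 := by
    rw [div_pow, div_mul_eq_mul_div, div_le_one (by positivity)]
    nlinarith [sq_nonneg ((d : ℝ) - 2)]
  exact (mul_le_mul_of_nonneg_right h4 (by linarith)).trans h5

/-- With lam = 1 and B = 0 the evolution inequality becomes ∂ₜw ≤ -(2 - γbd) w, after discarding a
term of good sign. For this κ ≥ 0 suffices, so the endpoints of the exponent range are allowed. -/
theorem quadratic_estimate (hd : 2 ≤ d) (hcoeff : CoeffQuadratic d γ b) :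
    ∃ C > 0, ∀ n : ℝ → Space d → ℝ,
      IsWellBehaved γ (fun x => ‖x‖ ^ 2 / 2) n → IsRegularUpToZero γ n →
        ∀ C₀ : ℝ, IsLUB (Set.range (weightedGradSq γ b (fun x => ‖x‖ ^ 2 / 2) n 0)) C₀ →
          ∀ t > 0, MaxLE γ b (fun x => ‖x‖ ^ 2 / 2) n t (C₀ * Real.exp (-C * t)) := by
  obtain ⟨hβ, -, hγ⟩ := mul_pos_of_cases hcoeff.cases
  have hb : b ≠ 0 := right_ne_zero_of_mul hβ.ne'
  have hβd := hcoeff.mul_lt hd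
  have hκ := discr_nonneg_of_abs_le hcoeff.1.1 hcoeff.1.2 (hcoeff.sq_mul_le hd)
  -- Half of the decay rate is given up so that the barrier is touched strictly. Its initial value
  -- C₀ + ε makes the comparison strict at t = 0 as well, and ε tends to 0 at the end.
  refine ⟨(2 - γ * b * d) / 2, by linarith, ?_⟩
  intro n hn hr C₀ hlub t ht
  set C := (2 - γ * b * d) / 2 with hC
  have hCpos : 0 < C := by rw [hC]; linarith
  have hgc : Continuous (gradient fun x : Space d => ‖x‖ ^ 2 / 2) := by
    have : (gradient fun x : Space d => ‖x‖ ^ 2 / 2) = id := funext gradient_half_norm_sq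
    rw [this]; exact continuous_id
  have hdec := hr.decaysOn (b := b) (CW := 1) hn hcoeff.cases hgc (fun x => by
    rw [gradient_half_norm_sq]; linarith)
  have hC₀ : 0 ≤ C₀ := by
    refine le_trans ?_ (hlub.1 (mem_range_self 0))
    rw [weightedGradSq]; positivity
  refine maxLE_of_forall_le hdec ht.le fun x => ?_
  have key : ∀ ε > 0, weightedGradSq γ b (fun x => ‖x‖ ^ 2 / 2) n t x ≤
      (C₀ + ε) * Real.exp (-C * t) := by
    intro ε hε
    refine (hdec.lt_of_touching (s := 0) (T := t)
      (U := fun τ => (C₀ + ε) * Real.exp (-C * τ))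
      (U' := fun τ => (C₀ + ε) * (Real.exp (-C * τ) * (-C)))
      (fun s hs => hs.1) (by fun_prop) (fun τ _ => by positivity) (fun τ _ => ?_) (fun y => ?_)
      (fun τ hτ y hmax hy => ?_) t ⟨ht.le, le_rfl⟩ x).le
    · have h1 : HasDerivAt (fun τ : ℝ => -C * τ) (-C) τ := by
        simpa using (hasDerivAt_id τ).const_mul (-C)
      exact (h1.exp).const_mul _
    · have := hlub.1 (mem_range_self y)
      simp only [mul_zero, Real.exp_zero, mul_one]
      linarith
    · set w := weightedGradSq γ b (fun x => ‖x‖ ^ 2 / 2) n τ y with hw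
      have hwpos : 0 < w := by rw [hy]; positivity
      have hnp : 0 < n τ y :=
        pos_of_weightedGradSq_pos hγ hb (hn.strong.nonneg τ hτ.1.le y) hwpos
      obtain ⟨D, hD, hDle⟩ := hn.exists_hasDerivAt_le hγ (hcoeff.le_one hd) hβ.le (lam := 1)
        (hasBoundedDerivatives_zero d) (fun x i => by
          rw [pd_half_norm_sq, pd_const, one_mul, add_zero]) ⟨hτ.1, hnp⟩ hmax hwpos
      refine ⟨D, hD, hDle.trans_lt ?_⟩
      have hwe : w = n τ y ^ (γ * b) * ‖gradQ γ (fun x => ‖x‖ ^ 2 / 2) n τ y‖ ^ 2 :=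
        weightedGradSq_of_pos hγ hnp
      have h1 : 0 ≤ n τ y ^ (γ * b) * ((2 * (γ * b) - (γ * b) ^ 2 - γ ^ 2 * ((d : ℝ) - 1)) / 2 *
          (inner ℝ (gradQ γ (fun x => ‖x‖ ^ 2 / 2) n τ y -
            gradient (fun x => ‖x‖ ^ 2 / 2) y) (gradQ γ (fun x => ‖x‖ ^ 2 / 2) n τ y) ^ 2 /
              (|γ| * n τ y ^ γ))) := by positivity
      have h2 : n τ y ^ (γ * b) * ((1 * (γ * b * d - 2) + (γ * b * d + 2) * 0) *
          ‖gradQ γ (fun x => ‖x‖ ^ 2 / 2) n τ y‖ ^ 2) = -(2 * C) * w := by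
        rw [hwe, hC]; ring
      have h3 : (C₀ + ε) * (Real.exp (-C * τ) * (-C)) = -C * w := by rw [hy]; ring
      rw [h3, mul_add, h2]
      nlinarith
  have hlim : Tendsto (fun ε : ℝ => (C₀ + ε) * Real.exp (-C * t)) (𝓝[>] 0)
      (𝓝 (C₀ * Real.exp (-C * t))) := by
    have : Continuous fun ε : ℝ => (C₀ + ε) * Real.exp (-C * t) := by fun_prop
    have h := this.tendsto 0
    simp only [add_zero] at h
    exact h.mono_left nhdsWithin_le_nhds
  refine ge_of_tendsto hlim ?_
  filter_upwards [self_mem_nhdsWithin] with ε hε using key ε hε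

end Quadratic

/-! ### Truncated mass -/

section Truncation

/-- A smooth nondecreasing cutoff with `0 ≤ cutoff δ ≤ 1`, vanishing on `(-∞, δ]` and equal to `1`
on `[2δ, ∞)`. -/
def cutoff (δ s : ℝ) : ℝ := Real.smoothTransition ((s - δ) / δ)

/-- The primitive of `cutoff δ`, a smooth approximation of the positive part as `δ → 0`. -/
def truncation (δ s : ℝ) : ℝ := ∫ τ in (0 : ℝ)..s, cutoff δ τ

variable {δ s : ℝ}

theorem contDiff_cutoff : ContDiff ℝ ∞ (cutoff δ) :=
  Real.smoothTransition.contDiff.comp ((contDiff_id.sub contDiff_const).div_const δ)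

theorem cutoff_nonneg : 0 ≤ cutoff δ s := Real.smoothTransition.nonneg _

theorem cutoff_le_one : cutoff δ s ≤ 1 := Real.smoothTransition.le_one _

theorem cutoff_eq_zero (hδ : 0 < δ) (hs : s ≤ δ) : cutoff δ s = 0 :=
  Real.smoothTransition.zero_of_nonpos (div_nonpos_of_nonpos_of_nonneg (by linarith) hδ.le)

theorem cutoff_eq_one (hδ : 0 < δ) (hs : 2 * δ ≤ s) : cutoff δ s = 1 :=
  Real.smoothTransition.one_of_one_le ((one_le_div hδ).2 (by linarith))

theorem monotone_cutoff (hδ : 0 < δ) : Monotone (cutoff δ) := fun a b hab =>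
  Real.smoothTransition.monotone (by gcongr)

theorem hasDerivAt_truncation : HasDerivAt (truncation δ) (cutoff δ s) s :=
  intervalIntegral.integral_hasDerivAt_right
    (contDiff_cutoff.continuous.intervalIntegrable _ _)
    (contDiff_cutoff.continuous.stronglyMeasurableAtFilter _ _)
    contDiff_cutoff.continuous.continuousAt

theorem lipschitzWith_truncation : LipschitzWith 1 (truncation δ) :=
  lipschitzWith_of_nnnorm_deriv_le (fun _ => hasDerivAt_truncation.differentiableAt) fun s => by
    rw [hasDerivAt_truncation.deriv, ← NNReal.coe_le_coe, coe_nnnorm, Real.norm_eq_abs,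
      abs_of_nonneg cutoff_nonneg]
    exact cutoff_le_one

theorem continuous_truncation : Continuous (truncation δ) := lipschitzWith_truncation.continuous

@[simp] theorem truncation_zero : truncation δ 0 = 0 := by simp [truncation]

theorem abs_truncation_le : |truncation δ s| ≤ |s| := by
  simpa using lipschitzWith_truncation (δ := δ).dist_le_mul s 0

theorem monotone_truncation : Monotone (truncation δ) :=
  monotone_of_deriv_nonneg (fun _ => hasDerivAt_truncation.differentiableAt) fun s => by
    rw [hasDerivAt_truncation.deriv]; exact cutoff_nonneg

theorem truncation_nonneg (hs : 0 ≤ s) : 0 ≤ truncation δ s := by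
  simpa using monotone_truncation (δ := δ) hs

theorem truncation_eq_zero (hδ : 0 < δ) (hs : s ≤ δ) : truncation δ s = 0 := by
  rw [truncation, intervalIntegral.integral_congr (g := fun _ => (0 : ℝ)),
    intervalIntegral.integral_zero]
  intro τ hτ
  refine cutoff_eq_zero hδ (hτ.2.trans (sup_le hδ.le hs))

theorem sub_le_truncation (hδ : 0 < δ) (hs : 0 ≤ s) : s - 2 * δ ≤ truncation δ s := by
  rcases le_total s (2 * δ) with h | h
  · linarith [truncation_nonneg (δ := δ) hs]
  · have h1 : truncation δ s - truncation δ (2 * δ) = s - 2 * δ := by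
      rw [truncation, truncation, intervalIntegral.integral_interval_sub_left
        (contDiff_cutoff.continuous.intervalIntegrable _ _)
        (contDiff_cutoff.continuous.intervalIntegrable _ _),
        intervalIntegral.integral_congr (g := fun _ => (1 : ℝ)), intervalIntegral.integral_const,
        smul_eq_mul, mul_one]
      intro τ hτ
      rw [uIcc_of_le h] at hτ
      exact cutoff_eq_one hδ hτ.1
    linarith [truncation_nonneg (δ := δ) (by linarith : 0 ≤ 2 * δ)]

end Truncation

/-! ### Monotonicity of truncated masses, and its consequences. -/

section Mass

variable {d : ℕ} {γ : ℝ} {W : Space d → ℝ} {n : ℝ → Space d → ℝ}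

theorem IsWellBehaved.continuousOn (hn : IsWellBehaved γ W n) (hγ : γ ≠ 0) :
    ContinuousOn (fun z : ℝ × Space d => n z.1 z.2) (Ioi 0 ×ˢ univ) := by
  rcases lt_or_gt_of_ne hγ with h | h
  · exact (hn.fast h).2.continuousOn
  · exact (hn.slow h).1.continuousOn

theorem IsWellBehaved.continuousAt (hn : IsWellBehaved γ W n) (hγ : γ ≠ 0) {t : ℝ} (ht : 0 < t)
    (x : Space d) : ContinuousAt (fun z : ℝ × Space d => n z.1 z.2) (t, x) :=
  (hn.continuousOn hγ).continuousAt ((isOpen_Ioi.prod isOpen_univ).mem_nhds ⟨ht, mem_univ _⟩)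

theorem IsWellBehaved.continuous_slice (hn : IsWellBehaved γ W n) (hγ : γ ≠ 0) {t : ℝ}
    (ht : 0 < t) : Continuous (n t) :=
  continuous_iff_continuousAt.2 fun x =>
    (hn.continuousAt hγ ht x).comp (f := fun y : Space d => (t, y)) (by fun_prop)

/-- The sets where n > δ are thus bounded, uniformly on compact sets of times. Functions of n that
vanish below δ therefore have compact support inside the positivity set, where n is smooth. -/
theorem IsWellBehaved.exists_radius_le (hn : IsWellBehaved γ W n) (hγ : γ ≠ 0) {J : Set ℝ}
    (hJ : J ⊆ Ioi 0) (hJc : IsCompact J) {δ : ℝ} (hδ : 0 < δ) :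
    ∃ R : ℝ, ∀ t ∈ J, ∀ x, R < ‖x‖ → n t x ≤ δ := by
  rcases lt_or_gt_of_ne hγ with h | h
  · obtain ⟨k, K, c, R, -, -, htail⟩ := (hn.fast h).1.tail J hJ hJc
    have h1 : Tendsto (fun r : ℝ => K * (1 + r ^ 2) ^ (1 / γ)) atTop (𝓝 (K * 0)) := by
      refine Tendsto.const_mul K ?_
      have h2 : Tendsto (fun s : ℝ => s ^ (-(-(1 / γ)))) atTop (𝓝 0) :=
        tendsto_rpow_neg_atTop (by have := div_neg_of_pos_of_neg one_pos h; linarith)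
      rw [neg_neg] at h2
      exact h2.comp (tendsto_atTop_add_const_left _ _ (tendsto_pow_atTop two_ne_zero))
    rw [mul_zero] at h1
    obtain ⟨R', hR'⟩ := eventually_atTop.1 (h1.eventually (Iio_mem_nhds hδ))
    refine ⟨max R R', fun t ht x hx => ?_⟩
    exact ((htail t ht x (lt_of_le_of_lt (le_max_left _ _) hx)).2.1).trans
      (hR' ‖x‖ ((le_max_right _ _).trans hx.le)).le
  · obtain ⟨R, hR⟩ := (hn.slow h).1.support J hJ hJc
    refine ⟨R, fun t ht x hx => ?_⟩
    have h0 : n t x = 0 := image_eq_zero_of_notMem_tsupport fun h' => by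
      have := hR t ht h'
      rw [mem_closedBall_zero_iff] at this
      linarith
    rw [h0]
    exact hδ.le

theorem IsWellBehaved.tsupport_cutoff_subset (hn : IsWellBehaved γ W n) (hγ : γ ≠ 0) {t δ : ℝ}
    (ht : 0 < t) (hδ : 0 < δ) : tsupport (fun x => cutoff δ (n t x)) ⊆ {x | δ ≤ n t x} := by
  refine closure_minimal (fun x hx => ?_)
    (isClosed_le continuous_const (hn.continuous_slice hγ ht))
  by_contra h
  exact hx (cutoff_eq_zero hδ (not_le.1 h).le)

theorem IsWellBehaved.hasCompactSupport_comp (hn : IsWellBehaved γ W n) (hγ : γ ≠ 0) {t δ : ℝ}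
    (ht : 0 < t) (hδ : 0 < δ) {F : ℝ → ℝ} (hF : ∀ s ≤ δ, F s = 0) :
    HasCompactSupport (fun x => F (n t x)) := by
  obtain ⟨R, hR⟩ := hn.exists_radius_le hγ (J := {t}) (by simpa using ht) isCompact_singleton hδ
  refine HasCompactSupport.intro (isCompact_closedBall (0 : Space d) R) fun x hx => hF _ ?_
  rw [mem_closedBall_zero_iff, not_le] at hx
  exact hR t rfl x hx

theorem IsWellBehaved.contDiff_cutoff (hn : IsWellBehaved γ W n) (hγ : γ ≠ 0) {t δ : ℝ}
    (ht : 0 < t) (hδ : 0 < δ) : ContDiff ℝ ∞ (fun x => cutoff δ (n t x)) := by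
  rw [contDiff_iff_contDiffAt]
  intro x
  by_cases hx : 0 < n t x
  · exact NonlinearDiffusion.contDiff_cutoff.contDiffAt.comp x (hn.contDiffAt_slice hγ ⟨ht, hx⟩)
  · refine contDiffAt_const (c := (0 : ℝ)) |>.congr_of_eventuallyEq ?_
    filter_upwards [(hn.continuous_slice hγ ht).continuousAt.eventually
      (Iio_mem_nhds (lt_of_le_of_lt (not_lt.1 hx) hδ))] with y hy
    exact cutoff_eq_zero hδ (le_of_lt hy)

theorem IsWellBehaved.hasDerivAt_truncation (hn : IsWellBehaved γ W n) (hγ : γ ≠ 0) {t δ : ℝ}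
    (ht : 0 < t) (hδ : 0 < δ) (x : Space d) :
    HasDerivAt (fun τ => truncation δ (n τ x)) (fderiv ℝ (fun z : ℝ × Space d => n z.1 z.2)
      (t, x) (1, 0) * cutoff δ (n t x)) t := by
  by_cases hx : 0 < n t x
  · have h1 := (hn.differentiableAt hγ (z := (t, x)) ⟨ht, hx⟩).hasFDerivAt.comp_hasDerivAt t
      ((hasDerivAt_id t).prodMk (hasDerivAt_const t x))
    exact (NonlinearDiffusion.hasDerivAt_truncation.comp t h1).congr_deriv (mul_comm _ _)
  · rw [cutoff_eq_zero hδ ((not_lt.1 hx).trans hδ.le), mul_zero]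
    refine (hasDerivAt_const t (0 : ℝ)).congr_of_eventuallyEq ?_
    have h1 : ContinuousAt (fun τ => n τ x) t :=
      (hn.continuousAt hγ ht x).comp (f := fun τ : ℝ => (τ, x)) (by fun_prop)
    filter_upwards [h1.eventually (Iio_mem_nhds (lt_of_le_of_lt (not_lt.1 hx) hδ))] with y hy
    exact truncation_eq_zero hδ (le_of_lt hy)

theorem IsWellBehaved.integrable_truncation (hn : IsWellBehaved γ W n) (hγ : γ ≠ 0) {t δ : ℝ}
    (ht : 0 < t) (hδ : 0 < δ) : Integrable (fun x => truncation δ (n t x)) :=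
  (continuous_truncation.comp (hn.continuous_slice hγ ht)).integrable_of_hasCompactSupport
    (hn.hasCompactSupport_comp hγ ht hδ fun _ => truncation_eq_zero hδ)

/-- This is the dominating function for differentiating the truncated mass under the integral. The
time derivative of n is bounded on the compact set where n ≥ δ, and elsewhere the cutoff vanishes.
-/
theorem IsWellBehaved.exists_bound_deriv_truncation (hn : IsWellBehaved γ W n) (hγ : γ ≠ 0)
    {J : Set ℝ} (hJ : J ⊆ Ioi 0) (hJc : IsCompact J) {δ : ℝ} (hδ : 0 < δ) :
    ∃ R C : ℝ, ∀ t ∈ J, ∀ x, ‖fderiv ℝ (fun z : ℝ × Space d => n z.1 z.2) (t, x) (1, 0) *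
      cutoff δ (n t x)‖ ≤ (Metric.closedBall (0 : Space d) R).indicator (fun _ => C) x := by
  obtain ⟨R, hR⟩ := hn.exists_radius_le hγ hJ hJc hδ
  have hB : IsCompact (J ×ˢ Metric.closedBall (0 : Space d) R) :=
    hJc.prod (isCompact_closedBall _ _)
  have hBs : J ×ˢ Metric.closedBall (0 : Space d) R ⊆ Ioi 0 ×ˢ univ :=
    prod_mono hJ (subset_univ _)
  have hK : IsCompact ((J ×ˢ Metric.closedBall (0 : Space d) R) ∩
      (fun z : ℝ × Space d => n z.1 z.2) ⁻¹' Ici δ) := by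
    refine hB.of_isClosed_subset ?_ inter_subset_left
    exact ((hn.continuousOn hγ).mono hBs).preimage_isClosed_of_isClosed hB.isClosed isClosed_Ici
  have hc : ContinuousOn (fun z : ℝ × Space d =>
      fderiv ℝ (fun z : ℝ × Space d => n z.1 z.2) z (1, 0))
      ((J ×ˢ Metric.closedBall (0 : Space d) R) ∩
      (fun z : ℝ × Space d => n z.1 z.2) ⁻¹' Ici δ) := fun z hz =>
    (((hn.contDiffAt hγ (z := z) ⟨hJ hz.1.1, lt_of_lt_of_le hδ hz.2⟩).fderiv_right
      (m := 0) (by simp)).continuousAt.clm_apply continuousAt_const).continuousWithinAt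
  obtain ⟨C, hC⟩ := hK.exists_bound_of_continuousOn hc
  refine ⟨R, max C 0, fun t ht x => ?_⟩
  have hnn : 0 ≤ (Metric.closedBall (0 : Space d) R).indicator (fun _ => max C 0) x :=
    indicator_nonneg (fun _ _ => le_max_right _ _) x
  by_cases hx : δ ≤ n t x
  · by_cases hxR : x ∈ Metric.closedBall (0 : Space d) R
    · rw [indicator_of_mem hxR, norm_mul, Real.norm_of_nonneg cutoff_nonneg]
      refine (mul_le_of_le_one_right (norm_nonneg _) cutoff_le_one).trans ?_
      exact (hC (t, x) ⟨⟨ht, hxR⟩, hx⟩).trans (le_max_left _ _)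
    · rw [mem_closedBall_zero_iff, not_le] at hxR
      rw [cutoff_eq_zero hδ (hR t ht x hxR), mul_zero, norm_zero]
      exact hnn
  · rw [cutoff_eq_zero hδ (not_le.1 hx).le, mul_zero, norm_zero]
    exact hnn

theorem IsWellBehaved.hasDerivAt_integral_truncation (hn : IsWellBehaved γ W n) (hγ : γ ≠ 0)
    {t δ : ℝ} (ht : 0 < t) (hδ : 0 < δ) :
    HasDerivAt (fun τ => ∫ x, truncation δ (n τ x)) (∫ x, fderiv ℝ
      (fun z : ℝ × Space d => n z.1 z.2) (t, x) (1, 0) * cutoff δ (n t x)) t := by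
  have hJ : Icc (t / 2) (2 * t) ⊆ Ioi 0 := fun s hs =>
    lt_of_lt_of_le (by linarith : (0 : ℝ) < t / 2) hs.1
  obtain ⟨R, C, hRC⟩ := hn.exists_bound_deriv_truncation hγ hJ isCompact_Icc hδ
  have hcont : Continuous fun x => fderiv ℝ
      (fun z : ℝ × Space d => n z.1 z.2) (t, x) (1, 0) * cutoff δ (n t x) := by
    have := continuous_mul_of_tsupport (φ := fun x => cutoff δ (n t x)) (f := fun x => fderiv ℝ
      (fun z : ℝ × Space d => n z.1 z.2) (t, x) (1, 0))
      (hn.contDiff_cutoff hγ ht hδ).continuous fun x hx => by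
        have hx' : 0 < n t x := lt_of_lt_of_le hδ (hn.tsupport_cutoff_subset hγ ht hδ hx)
        have h1 : ContinuousAt (fun z : ℝ × Space d => fderiv ℝ
            (fun z : ℝ × Space d => n z.1 z.2) z (1, 0)) (t, x) :=
          ((hn.contDiffAt hγ (z := (t, x)) ⟨ht, hx'⟩).fderiv_right (m := 0)
            (by simp)).continuousAt.clm_apply continuousAt_const
        exact h1.comp (f := fun y : Space d => (t, y)) (by fun_prop)
    simpa only [mul_comm] using this
  refine (hasDerivAt_integral_of_dominated_loc_of_deriv_le
    (F' := fun τ x => fderiv ℝ (fun z : ℝ × Space d => n z.1 z.2) (τ, x) (1, 0) *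
      cutoff δ (n τ x))
    (bound := (Metric.closedBall (0 : Space d) R).indicator (fun _ => C))
    (Icc_mem_nhds (by linarith : t / 2 < t) (by linarith : t < 2 * t)) ?_
    (hn.integrable_truncation hγ ht hδ) hcont.aestronglyMeasurable
    (Eventually.of_forall fun x τ hτ => hRC τ hτ x) ?_
    (Eventually.of_forall fun x τ hτ => hn.hasDerivAt_truncation hγ (hJ hτ) hδ x)).2
  · filter_upwards [Ioi_mem_nhds ht] with τ hτ
    exact (hn.integrable_truncation hγ hτ hδ).aestronglyMeasurable
  · refine IntegrableOn.integrable_indicator ?_ Metric.isClosed_closedBall.measurableSet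
    exact integrableOn_const (isCompact_closedBall _ _).measure_lt_top.ne

/-- Testing the equation at time t with χ(n), where χ = `cutoff δ`, gives the derivative -∫ |γ| n^γ
χ'(n) |∇n|². It is nonpositive because χ is nondecreasing. -/
theorem IsWellBehaved.antitoneOn_integral_truncation
    (hn : IsWellBehaved γ (fun _ : Space d => (0 : ℝ)) n) (hγ : γ ≠ 0) {δ : ℝ} (hδ : 0 < δ) :
    AntitoneOn (fun τ => ∫ x, truncation δ (n τ x)) (Ioi 0) := by
  refine antitoneOn_of_deriv_nonpos (convex_Ioi 0)
    (fun t ht => (hn.hasDerivAt_integral_truncation hγ ht hδ).continuousAt.continuousWithinAt)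
    (fun t ht => (hn.hasDerivAt_integral_truncation hγ (interior_subset ht)
      hδ).differentiableAt.differentiableWithinAt) fun t ht => ?_
  replace ht : 0 < t := interior_subset ht
  rw [(hn.hasDerivAt_integral_truncation hγ ht hδ).deriv,
    hn.integral_slice hγ (fun i => by
      have : pd i (fun _ : Space d => (0 : ℝ)) = fun _ => 0 := funext fun x => pd_const 0 i
      rw [this]; exact continuous_const) ht
      (hn.contDiff_cutoff hγ ht hδ)
      (hn.hasCompactSupport_comp hγ ht hδ fun _ => cutoff_eq_zero hδ)
      (fun x hx => lt_of_lt_of_le hδ (hn.tsupport_cutoff_subset hγ ht hδ hx)), neg_nonpos]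
  refine integral_nonneg fun x => Finset.sum_nonneg fun i _ => ?_
  by_cases hx : 0 < n t x
  · have hd := (hn.contDiffAt_slice hγ (t := t) ⟨ht, hx⟩).differentiableAt (by simp)
    rw [gradQ_apply_of_pos hx hd, pd_comp
      ((NonlinearDiffusion.contDiff_cutoff.differentiable (by simp) (n t x)).hasDerivAt) hd]
    have h1 : 0 ≤ deriv (cutoff δ) (n t x) := (monotone_cutoff hδ).deriv_nonneg
    have h2 : pd i (fun _ : Space d => (0 : ℝ)) x = 0 := by simp [pd]
    rw [h2, add_zero]
    have h3 : n t x * (|γ| * n t x ^ (γ - 1) * pd i (n t) x) *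
        (deriv (cutoff δ) (n t x) * pd i (n t) x) =
        n t x * |γ| * n t x ^ (γ - 1) * deriv (cutoff δ) (n t x) * pd i (n t) x ^ 2 := by ring
    rw [h3]
    positivity
  · rw [le_antisymm (not_lt.1 hx) (hn.strong.nonneg t ht.le x), zero_mul, zero_mul]

/-- Truncated masses do not exceed their initial values. -/
theorem IsWellBehaved.integral_truncation_le
    (hn : IsWellBehaved γ (fun _ : Space d => (0 : ℝ)) n) (hγ : γ ≠ 0) {t δ : ℝ} (ht : 0 < t)
    (hδ : 0 < δ) : ∫ x, truncation δ (n t x) ≤ ∫ x, truncation δ (n 0 x) := by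
  have hintg : Integrable fun x => truncation δ (n 0 x) :=
    hn.strong.integrable_initial.mono
      (continuous_truncation.comp_aestronglyMeasurable
        hn.strong.integrable_initial.aestronglyMeasurable)
      (Eventually.of_forall fun x => abs_truncation_le)
  -- Truncation is 1-Lipschitz, so L¹ convergence to the initial datum passes to the truncated
  -- masses.
  have hle : ∀ᶠ s in 𝓝[>] (0 : ℝ), edist (∫ x, truncation δ (n s x)) (∫ x, truncation δ (n 0 x)) ≤
      eLpNorm (fun x => n s x - n 0 x) 1 volume := by
    filter_upwards [self_mem_nhdsWithin] with s hs
    rw [edist_eq_enorm_sub, ← integral_sub (hn.integrable_truncation hγ hs hδ) hintg,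
      eLpNorm_one_eq_lintegral_enorm]
    refine (enorm_integral_le_lintegral_enorm _).trans (lintegral_mono fun x => ?_)
    rw [← edist_eq_enorm_sub, ← edist_eq_enorm_sub]
    simpa using lipschitzWith_truncation (δ := δ) (n s x) (n 0 x)
  have hlim : Tendsto (fun s => ∫ x, truncation δ (n s x)) (𝓝[>] 0)
      (𝓝 (∫ x, truncation δ (n 0 x))) :=
    tendsto_iff_edist_tendsto_0.2 (tendsto_of_tendsto_of_tendsto_of_le_of_le' tendsto_const_nhds
      hn.strong.initial (Eventually.of_forall fun _ => zero_le) hle)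
  refine ge_of_tendsto hlim ?_
  filter_upwards [Ioo_mem_nhdsGT ht] with s hs
  exact hn.antitoneOn_integral_truncation hγ hδ hs.1 ht hs.2.le

/-- Chebyshev's inequality is applied to the truncated density and then δ → 0. Integrability of n at
time t is not needed. -/
theorem IsWellBehaved.measureReal_mul_le
    (hn : IsWellBehaved γ (fun _ : Space d => (0 : ℝ)) n) (hγ : γ ≠ 0) {t c : ℝ} (ht : 0 < t)
    {S : Set (Space d)} (hS : MeasurableSet S) (hSf : volume S ≠ ⊤)
    (hc : ∀ x ∈ S, c ≤ n t x) : volume.real S * c ≤ ∫ x, n 0 x := by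
  have key : ∀ δ > 0, volume.real S * (c - 2 * δ) ≤ ∫ x, n 0 x := fun δ hδ => by
    have hintg := hn.integrable_truncation hγ ht hδ
    calc volume.real S * (c - 2 * δ) = ∫ _ in S, (c - 2 * δ) := by
          rw [setIntegral_const, smul_eq_mul]
      _ ≤ ∫ x in S, truncation δ (n t x) :=
          setIntegral_mono_on (integrableOn_const hSf) hintg.integrableOn hS fun x hx => by
            have := sub_le_truncation hδ (hn.strong.nonneg t ht.le x)
            linarith [hc x hx]
      _ ≤ ∫ x, truncation δ (n t x) := setIntegral_le_integral hintg
          (Eventually.of_forall fun x => truncation_nonneg (hn.strong.nonneg t ht.le x))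
      _ ≤ ∫ x, truncation δ (n 0 x) := hn.integral_truncation_le hγ ht hδ
      _ ≤ ∫ x, n 0 x := integral_mono_of_nonneg
          (Eventually.of_forall fun x => truncation_nonneg (hn.strong.nonneg 0 le_rfl x))
          hn.strong.integrable_initial (Eventually.of_forall fun x => by
            have h := hn.strong.nonneg 0 le_rfl x
            have := (le_abs_self _).trans (abs_truncation_le (δ := δ) (s := n 0 x))
            rwa [abs_of_nonneg h] at this)
  have hlim : Tendsto (fun δ : ℝ => volume.real S * (c - 2 * δ)) (𝓝[>] 0)
      (𝓝 (volume.real S * (c - 2 * 0))) :=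
    (Continuous.tendsto (by fun_prop) 0).mono_left nhdsWithin_le_nhds
  rw [mul_zero, sub_zero] at hlim
  exact le_of_tendsto hlim (eventually_mem_nhdsWithin.mono key)

/-- Truncating at δ = N makes the initial truncated mass zero. It stays zero, and a truncation
vanishing at s ≥ 0 forces s ≤ 2δ. The factor 2 comes from the width of the cutoff. -/
theorem IsWellBehaved.le_two_mul_of_initial_le
    (hn : IsWellBehaved γ (fun _ : Space d => (0 : ℝ)) n) (hγ : γ ≠ 0) {t N : ℝ} (ht : 0 < t)
    (hN : 0 < N) (h0 : ∀ᵐ x, n 0 x ≤ N) (x : Space d) : n t x ≤ 2 * N := by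
  have h1 : ∫ x, truncation N (n 0 x) = 0 :=
    integral_eq_zero_of_ae (h0.mono fun x hx => truncation_eq_zero hN hx)
  have h2 := hn.integral_truncation_le hγ ht hN
  have hnn : 0 ≤ fun x => truncation N (n t x) := fun x =>
    truncation_nonneg (hn.strong.nonneg t ht.le x)
  have h3 : ∫ x, truncation N (n t x) = 0 := le_antisymm (h2.trans h1.le) (integral_nonneg hnn)
  rw [integral_eq_zero_iff_of_nonneg hnn (hn.integrable_truncation hγ ht hN)] at h3
  have h5 := (Continuous.ae_eq_iff_eq volume
    (continuous_truncation.comp (hn.continuous_slice hγ ht)) continuous_const).1 h3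
  have h6 := sub_le_truncation hN (hn.strong.nonneg t ht.le x)
  have h7 : truncation N (n t x) = 0 := congrFun h5 x
  linarith

end Mass

/-! ### The trivial potential -/

section Trivial

variable {d : ℕ} {γ b : ℝ}

theorem CoeffTrivial.cases (h : CoeffTrivial d γ b) : (0 < γ ∧ 0 < b) ∨ (γ < 0 ∧ b < -1) :=
  h.2.imp (fun h => ⟨h.1, h.2.1⟩) fun h => ⟨h.1, h.2.1⟩

theorem CoeffTrivial.lt_one (hd : 2 ≤ d) (h : CoeffTrivial d γ b) : γ < 1 := by
  rcases h.2 with h | h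
  · refine h.2.2.trans_le ?_
    have h2 : (2 : ℝ) ≤ d := by exact_mod_cast hd
    have h3 : 1 ≤ √((d : ℝ) - 1) := Real.one_le_sqrt.2 (by linarith)
    exact (div_le_one (by linarith)).2 h3
  · linarith [h.1]

theorem CoeffTrivial.two_add_pos (hd : 2 ≤ d) (h : CoeffTrivial d γ b) :
    0 < (d : ℝ) * γ + 2 := by
  have h0 : (0 : ℝ) < d := by exact_mod_cast (by omega : 0 < d)
  rcases h.2 with h | h
  · have := h.1
    positivity
  · have h1 := h.2.2
    rw [abs_of_neg h.1, lt_div_iff₀ h0] at h1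
    linarith

/-- The differential inequality at spatial maxima for the trivial potential. -/
theorem IsWellBehaved.exists_hasDerivAt_le_of_trivial {n : ℝ → Space d → ℝ}
    (hn : IsWellBehaved γ (fun _ : Space d => (0 : ℝ)) n) (hγ : γ ≠ 0) (hγ1 : γ ≤ 1)
    (hβ : 0 < γ * b) {t : ℝ} (ht : 0 < t) {x : Space d}
    (hmax : ∀ y, weightedGradSq γ b (fun _ => 0) n t y ≤ weightedGradSq γ b (fun _ => 0) n t x)
    (hpos : 0 < weightedGradSq γ b (fun _ => 0) n t x) :
    ∃ D, HasDerivAt (fun τ => weightedGradSq γ b (fun _ => 0) n τ x) D t ∧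
      D ≤ -((2 * (γ * b) - (γ * b) ^ 2 - γ ^ 2 * ((d : ℝ) - 1)) / 2 / |γ|) *
        n t x ^ (-(γ * b + γ)) * weightedGradSq γ b (fun _ => 0) n t x ^ 2 := by
  have hb : b ≠ 0 := right_ne_zero_of_mul hβ.ne'
  have hnp : 0 < n t x := pos_of_weightedGradSq_pos hγ hb (hn.strong.nonneg t ht.le x) hpos
  obtain ⟨D, hD, hDle⟩ := hn.exists_hasDerivAt_le hγ hγ1 hβ.le (lam := 0)
    (hasBoundedDerivatives_zero d) (fun x i => by simp) ⟨ht, hnp⟩ hmax hpos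
  refine ⟨D, hD, hDle.trans_eq ?_⟩
  have hγ' : 0 < |γ| := abs_pos.2 hγ
  rw [gradient_zero_fun, sub_zero, real_inner_self_eq_norm_sq, weightedGradSq_of_pos hγ hnp,
    Real.rpow_neg hnp.le, Real.rpow_add hnp]
  field_simp
  ring

/-- As β + γ > 0, the bound n ≤ 2N' turns the evolution inequality into ∂ₜw ≤ -c w², and the barrier
argument with θ = 1 applies. -/
theorem trivial_estimate_of_initial_le (hd : 2 ≤ d) (hcoeff : CoeffTrivial d γ b) (N : ℝ) :
    ∃ C > 0, ∀ n : ℝ → Space d → ℝ,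
        IsWellBehaved γ (fun _ => 0) n → (∀ᵐ x, n 0 x ≤ N) →
          ∀ t > 0, MaxLE γ b (fun _ => 0) n t (C * t⁻¹) := by
  obtain ⟨hβ, hβγ, hγ⟩ := mul_pos_of_cases hcoeff.cases
  have hb : b ≠ 0 := right_ne_zero_of_mul hβ.ne'
  set κ := (2 * (γ * b) - (γ * b) ^ 2 - γ ^ 2 * ((d : ℝ) - 1)) / 2 / |γ| with hκdef
  have hκ : 0 < κ :=
    div_pos (half_pos (discr_pos_of_abs_lt hcoeff.1.1 hcoeff.1.2)) (abs_pos.2 hγ)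
  set N' := max N 1 with hN'
  have hN'0 : 0 < N' := lt_of_lt_of_le one_pos (le_max_right _ _)
  set c := κ * (2 * N') ^ (-(γ * b + γ)) with hc
  have hc0 : 0 < c := by positivity
  refine ⟨4 / c, by positivity, fun n hn h0 t ht => ?_⟩
  have hdec := hn.decaysOn hcoeff.cases
    (continuous_gradient_of_continuous_fderiv (hasBoundedDerivatives_zero d).continuous_fderiv)
    (hasBoundedDerivatives_zero d).norm_gradient_le_linear
  refine maxLE_of_forall_le hdec ht fun x => ?_
  have h := hdec.le_of_superlinear hc0 one_pos le_rfl (fun t ht x hmax hpos _ => by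
    obtain ⟨D, hD, hDle⟩ := hn.exists_hasDerivAt_le_of_trivial hγ (hcoeff.lt_one hd).le hβ ht
      hmax hpos
    refine ⟨D, hD, hDle.trans ?_⟩
    have hnp : 0 < n t x := pos_of_weightedGradSq_pos hγ hb (hn.strong.nonneg t ht.le x) hpos
    have hnN : n t x ≤ 2 * N' := hn.le_two_mul_of_initial_le hγ ht hN'0
      (h0.mono fun x hx => hx.trans (le_max_left _ _)) x
    have e2 : (2 * N') ^ (-(γ * b + γ)) ≤ n t x ^ (-(γ * b + γ)) :=
      Real.rpow_le_rpow_of_nonpos hnp hnN (by linarith)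
    rw [one_add_one_eq_two, Real.rpow_two, ← hκdef, hc, neg_mul, neg_mul, neg_mul, neg_le_neg_iff]
    gcongr) t ht x
  refine h.trans_eq ?_
  rw [zero_add, mul_one, div_one, Real.rpow_one, Real.rpow_neg_one]
  field_simp
  norm_num

/-- A continuous function varies by at most `a` on a ball of radius `r`, if its derivative has norm
less than `a / r` wherever it differs from the value at the centre by at most `a`. -/
theorem abs_sub_le_of_norm_fderiv_mul_lt {E : Type*} [NormedAddCommGroup E] [NormedSpace ℝ E]
    {f : E → ℝ} (hf : Continuous f) {x₁ : E} {r a : ℝ} (ha : 0 ≤ a)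
    (h : ∀ x, |f x - f x₁| ≤ a → DifferentiableAt ℝ f x ∧ ‖fderiv ℝ f x‖ * r < a) {x : E}
    (hx : ‖x - x₁‖ ≤ r) : |f x - f x₁| ≤ a := by
  set φ : ℝ → ℝ := fun s => f (x₁ + s • (x - x₁)) with hφ
  have hφc : Continuous φ := by fun_prop
  -- Continuous induction along the segment: as long as the oscillation is at most a·s the
  -- derivative bound is available, and its strictness carries the inequality a little further.
  have hsub : Icc (0 : ℝ) 1 ⊆ {s | |φ s - f x₁| ≤ a * s} := by
    refine IsClosed.Icc_subset_of_forall_exists_gt ?_ (by simp [hφ]) ?_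
    · exact (isClosed_le (by fun_prop) (by fun_prop)).inter isClosed_Icc
    · rintro s ⟨hs, hs0, hs1⟩ y hy
      have hs' : |φ s - f x₁| ≤ a * s := hs
      obtain ⟨hd, hlt⟩ := h (x₁ + s • (x - x₁)) (hs'.trans (mul_le_of_le_one_right ha hs1.le))
      have hline : HasDerivAt (fun s : ℝ => x₁ + s • (x - x₁)) (x - x₁) s := by
        simpa using ((hasDerivAt_id s).smul_const (x - x₁)).const_add x₁
      have hφd : HasDerivAt φ (fderiv ℝ f (x₁ + s • (x - x₁)) (x - x₁)) s :=
        hd.hasFDerivAt.comp_hasDerivAt s hline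
      have hnorm : ‖fderiv ℝ f (x₁ + s • (x - x₁)) (x - x₁)‖ < a :=
        ((ContinuousLinearMap.le_opNorm _ _).trans
          (mul_le_mul_of_nonneg_left hx (norm_nonneg _))).trans_lt hlt
      have hev := (hφd.hasDerivWithinAt (s := Ioi s)).limsup_norm_slope_le hnorm
      obtain ⟨z, hz1, hz2⟩ := (hev.and (Ioc_mem_nhdsGT hy)).exists
      refine ⟨z, ?_, hz2⟩
      have hzs : 0 < z - s := sub_pos.2 hz2.1
      rw [Real.norm_of_nonneg hzs.le, inv_mul_lt_iff₀ hzs, Real.norm_eq_abs] at hz1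
      have := abs_sub_le (φ z) (φ s) (f x₁)
      change |φ z - f x₁| ≤ a * z
      nlinarith
  have := hsub (right_mem_Icc.2 zero_le_one)
  simpa [hφ] using this

theorem rpow_le_two_rpow_abs {y e : ℝ} (h1 : 1 / 2 ≤ y) (h2 : y ≤ 2) : y ^ e ≤ 2 ^ |e| := by
  have hy : 0 < y := by linarith
  rcases le_total 0 e with he | he
  · rw [abs_of_nonneg he]
    exact Real.rpow_le_rpow hy.le h2 he
  · rw [abs_of_nonpos he, Real.rpow_neg zero_le_two, ← Real.inv_rpow zero_le_two]
    exact Real.rpow_le_rpow_of_nonpos (by norm_num) (by linarith) he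

theorem two_rpow_neg_abs_le {y e : ℝ} (h1 : 1 / 2 ≤ y) (h2 : y ≤ 2) : 2 ^ (-|e|) ≤ y ^ e := by
  have hy : 0 < y := by linarith
  have h := rpow_le_two_rpow_abs (e := -e) h1 h2
  rw [abs_neg, Real.rpow_neg hy.le] at h
  rw [Real.rpow_neg zero_le_two]
  exact inv_le_of_inv_le₀ (by positivity) h

/-- At a spatial maximum of the weighted gradient, the pressure is controlled by the mass and the
value of the maximum. -/
theorem IsWellBehaved.rpow_le_of_max {n : ℝ → Space d → ℝ}
    (hn : IsWellBehaved γ (fun _ : Space d => (0 : ℝ)) n) (hγ : γ ≠ 0)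
    {t : ℝ} (ht : 0 < t) {x : Space d} (hx : 0 < n t x) {U : ℝ} (hU : 0 < U)
    (hmax : ∀ y, weightedGradSq γ b (fun _ => 0) n t y ≤ U) :
    volume.real (Metric.ball (0 : Space d) 1) * (1 / (4 * 2 ^ (|b| / 2))) ^ (d : ℝ) *
      2 ^ (-|1 / γ|) * (n t x ^ γ) ^ ((1 + b / 2) * d + 1 / γ) ≤
        (∫ x, n 0 x) * U ^ ((d : ℝ) / 2) := by
  set π := n t x ^ γ with hπdef
  have hπ : 0 < π := by positivity
  set p : Space d → ℝ := fun y => pressure γ (n t y) with hp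
  -- While |p| stays within a factor 2 of π, the bound w ≤ U gives |∇p| ≤ 2^{|b|/2} π^{-b/2}
  -- U^{1/2}. With this c₁ the product |∇p| r is at most π/4, below the permitted oscillation π/2.
  set c₁ : ℝ := 1 / (4 * 2 ^ (|b| / 2)) with hc₁
  have hc₁0 : 0 < c₁ := by positivity
  set r := c₁ * π ^ (1 + b / 2) * U ^ (-(1 / 2) : ℝ) with hr
  have hr0 : 0 < r := by positivity
  have hpc : Continuous p := by
    refine continuous_const.mul (continuous_iff_continuousAt.2 fun y => ?_)
    refine (hn.continuous_slice hγ ht).continuousAt.rpow_const ?_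
    rcases lt_or_gt_of_ne hγ with h | h
    · exact Or.inl ((hn.fast h).1.pos t ht y).ne'
    · exact Or.inr h.le
  have hrange : ∀ y, |p y - p x| ≤ π / 2 → 0 < n t y ∧ 1 / 2 ≤ n t y ^ γ / π ∧
      n t y ^ γ / π ≤ 2 := by
    intro y hy
    have h1 : |p y| = n t y ^ γ := abs_pressure hγ (hn.strong.nonneg t ht.le y)
    have h2 : |p x| = π := abs_pressure hγ hx.le
    have h3 := abs_le.1 ((abs_abs_sub_abs_le_abs_sub (p y) (p x)).trans hy)
    rw [h1, h2] at h3
    refine ⟨?_, ?_, ?_⟩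
    · refine (hn.strong.nonneg t ht.le y).lt_of_ne fun h0 => ?_
      rw [← h0, Real.zero_rpow hγ] at h3
      linarith
    · rw [le_div_iff₀ hπ]; linarith
    · rw [div_le_iff₀ hπ]; linarith
  have hball : ∀ y ∈ Metric.closedBall x r, |p y - p x| ≤ π / 2 := by
    intro y hy
    refine abs_sub_le_of_norm_fderiv_mul_lt hpc (by positivity) (fun z hz => ?_)
      (by simpa [dist_eq_norm] using hy)
    obtain ⟨hz0, hz1, hz2⟩ := hrange z hz
    have hzd := (hn.contDiffAt_slice hγ (t := t) ⟨ht, hz0⟩).differentiableAt (by simp)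
    refine ⟨(hasDerivAt_pressure hz0).differentiableAt.comp z hzd, ?_⟩
    have hg : ‖gradQ γ (fun _ => 0) n t z‖ = ‖fderiv ℝ p z‖ := by
      rw [gradQ, gradient_zero_fun, add_zero, norm_gradient]
    have hw := hmax z
    rw [weightedGradSq, abs_pressure hγ hz0.le, hg] at hw
    have hz3 : 0 < n t z ^ γ := by positivity
    have hq : (n t z ^ γ) ^ (-b) ≤ 2 ^ |b| * π ^ (-b) := by
      have := rpow_le_two_rpow_abs (e := -b) hz1 hz2
      rwa [abs_neg, Real.div_rpow hz3.le hπ.le, div_le_iff₀ (by positivity)] at this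
    have hsq : ‖fderiv ℝ p z‖ ^ 2 ≤ U * (2 ^ |b| * π ^ (-b)) := by
      calc ‖fderiv ℝ p z‖ ^ 2
          = (n t z ^ γ) ^ b * ‖fderiv ℝ p z‖ ^ 2 * (n t z ^ γ) ^ (-b) := by
            rw [Real.rpow_neg hz3.le]; field_simp
        _ ≤ U * (2 ^ |b| * π ^ (-b)) := by gcongr
    have hrsq : r ^ 2 = (1 / 16) * (2 ^ |b|)⁻¹ * (π ^ 2 * π ^ b) * U⁻¹ := by
      have e1 : ((2 : ℝ) ^ (|b| / 2)) ^ 2 = 2 ^ |b| := by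
        rw [← Real.rpow_natCast, ← Real.rpow_mul zero_le_two]; congr 1; push_cast; ring
      have e2 : (π ^ (1 + b / 2)) ^ 2 = π ^ 2 * π ^ b := by
        rw [← Real.rpow_natCast, ← Real.rpow_mul hπ.le, ← Real.rpow_natCast, ← Real.rpow_add hπ]
        congr 1; push_cast; ring
      have e3 : (U ^ (-(1 / 2) : ℝ)) ^ 2 = U⁻¹ := by
        rw [← Real.rpow_natCast, ← Real.rpow_mul hU.le, ← Real.rpow_neg_one]
        congr 1; push_cast; ring
      rw [hr, mul_pow, mul_pow, e2, e3, hc₁, div_pow, mul_pow, e1]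
      field_simp
      norm_num
    have hprod : (‖fderiv ℝ p z‖ * r) ^ 2 ≤ (π / 4) ^ 2 := by
      rw [mul_pow]
      calc ‖fderiv ℝ p z‖ ^ 2 * r ^ 2 ≤ U * (2 ^ |b| * π ^ (-b)) * r ^ 2 := by gcongr
        _ = (π / 4) ^ 2 := by
          rw [hrsq, Real.rpow_neg hπ.le]
          field_simp
          norm_num
    have := (sq_le_sq₀ (by positivity) (by positivity)).1 hprod
    linarith
  -- On the ball of radius r the density is at least 2^{-|1/γ|} π^{1/γ}. Comparing the mass in this
  -- ball with the initial mass gives the estimate.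
  have hmass := hn.measureReal_mul_le hγ ht (c := 2 ^ (-|1 / γ|) * π ^ (1 / γ))
    (S := Metric.closedBall x r) Metric.isClosed_closedBall.measurableSet
    (isCompact_closedBall _ _).measure_lt_top.ne fun y hy => by
      obtain ⟨hy0, hy1, hy2⟩ := hrange y (hball y hy)
      have h1 := two_rpow_neg_abs_le (e := 1 / γ) hy1 hy2
      rw [Real.div_rpow (by positivity) hπ.le, le_div_iff₀ (by positivity),
        ← Real.rpow_mul hy0.le, mul_one_div_cancel hγ, Real.rpow_one] at h1
      exact h1
  rw [Measure.addHaar_real_closedBall _ _ hr0.le, finrank_euclideanSpace_fin,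
    ← Real.rpow_natCast, hr, Real.mul_rpow (by positivity) (by positivity),
    Real.mul_rpow (by positivity) (by positivity), ← Real.rpow_mul hπ.le,
    ← Real.rpow_mul hU.le] at hmass
  have e1 : U ^ (-(1 / 2) * (d : ℝ)) * U ^ ((d : ℝ) / 2) = 1 := by
    rw [← Real.rpow_add hU]
    convert Real.rpow_zero U using 2
    ring
  have h2 := mul_le_mul_of_nonneg_right hmass (Real.rpow_nonneg hU.le ((d : ℝ) / 2))
  refine le_trans (le_of_eq ?_) h2
  rw [Real.rpow_add hπ]
  linear_combination (-(volume.real (Metric.ball (0 : Space d) 1) * c₁ ^ (d : ℝ) *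
    2 ^ (-|1 / γ|) * π ^ ((1 + b / 2) * d) * π ^ (1 / γ))) * e1

/-- The mass bound controls (n^γ)^e by a multiple of w^{d/2} at the maximum. Hence n^{-(β+γ)} is
bounded below by a power of w, and the quadratic inequality becomes ∂ₜw ≤ -c w^{1+θ}. -/
theorem trivial_estimate_of_mass_le (hd : 2 ≤ d) (hcoeff : CoeffTrivial d γ b) (M : ℝ) :
    ∃ C > 0, ∀ n : ℝ → Space d → ℝ,
        IsWellBehaved γ (fun _ => 0) n → (∫ x, n 0 x) ≤ M →
          ∀ t > 0, MaxLE γ b (fun _ => 0) n t (C * t ^ (-1 - γ * d * (b + 1) * alpha d γ)) := by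
  obtain ⟨hβ, hβγ, hγ⟩ := mul_pos_of_cases hcoeff.cases
  have hb : b ≠ 0 := right_ne_zero_of_mul hβ.ne'
  have hd0 : (0 : ℝ) < d := by exact_mod_cast (by omega : 0 < d)
  have hα := hcoeff.two_add_pos hd
  set κ := (2 * (γ * b) - (γ * b) ^ 2 - γ ^ 2 * ((d : ℝ) - 1)) / 2 / |γ| with hκdef
  have hκ : 0 < κ :=
    div_pos (half_pos (discr_pos_of_abs_lt hcoeff.1.1 hcoeff.1.2)) (abs_pos.2 hγ)
  set M' := max M 1 with hM'
  have hM'0 : 0 < M' := lt_of_lt_of_le one_pos (le_max_right _ _)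
  set m := volume.real (Metric.ball (0 : Space d) 1) * (1 / (4 * 2 ^ (|b| / 2))) ^ (d : ℝ) *
      2 ^ (-|1 / γ|) with hm
  have hm0 : 0 < m := by
    have : 0 < volume.real (Metric.ball (0 : Space d) 1) :=
      ENNReal.toReal_pos (Metric.measure_ball_pos _ _ one_pos).ne' measure_ball_lt_top.ne
    positivity
  have hden : 0 < (d : ℝ) * γ + 2 + d * (γ * b + γ) := by positivity
  set e := (1 + b / 2) * d + 1 / γ with he
  have heγ : e * γ = ((d : ℝ) * γ + 2 + d * (γ * b + γ)) / 2 := by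
    rw [he]; field_simp; ring
  have heγ0 : 0 < e * γ := by rw [heγ]; positivity
  have he0 : e ≠ 0 := left_ne_zero_of_mul heγ0.ne'
  -- This is the power for which (n^{γe})^{-ρ} = n^{-(γb+γ)}. Since U^{d/2} is raised to -ρ, the
  -- exponent 2 of w drops to 1 + θ with θ = 1 - dρ/2.
  set ρ := (γ * b + γ) / (e * γ) with hρ
  have hρ0 : 0 < ρ := by positivity
  set θ := 1 - (d : ℝ) / 2 * ρ with hθ
  have hθe : θ = ((d : ℝ) * γ + 2) / (d * γ + 2 + d * (γ * b + γ)) := by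
    rw [hθ, hρ, heγ, div_div_eq_mul_div, eq_div_iff hden.ne', sub_mul, one_mul, mul_assoc,
      div_mul_cancel₀ _ hden.ne']
    ring
  have hθ0 : 0 < θ := by rw [hθe]; positivity
  set c := κ * (M' / m) ^ (-ρ) with hc
  have hc0 : 0 < c := by positivity
  have h2θ : (2 / (c * θ)) ^ (1 / θ) * 2 ^ (1 / θ) > 0 := by positivity
  refine ⟨_, h2θ, fun n hn h0 t ht => ?_⟩
  have hdec := hn.decaysOn hcoeff.cases
    (continuous_gradient_of_continuous_fderiv (hasBoundedDerivatives_zero d).continuous_fderiv)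
    (hasBoundedDerivatives_zero d).norm_gradient_le_linear
  refine maxLE_of_forall_le hdec ht fun x => ?_
  have h := hdec.le_of_superlinear hc0 hθ0 le_rfl (fun t ht x hmax hpos _ => by
    obtain ⟨D, hD, hDle⟩ := hn.exists_hasDerivAt_le_of_trivial hγ (hcoeff.lt_one hd).le hβ ht
      hmax hpos
    refine ⟨D, hD, hDle.trans ?_⟩
    set U := weightedGradSq γ b (fun _ => 0) n t x with hU
    have hnp : 0 < n t x := pos_of_weightedGradSq_pos hγ hb (hn.strong.nonneg t ht.le x) hpos
    have h1 := hn.rpow_le_of_max hγ ht hnp hpos hmax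
    rw [← hm, ← he] at h1
    have h2 : (n t x ^ γ) ^ e ≤ M' / m * U ^ ((d : ℝ) / 2) := by
      rw [div_mul_eq_mul_div, le_div_iff₀ hm0, mul_comm]
      refine h1.trans ?_
      gcongr
      exact h0.trans (le_max_left _ _)
    have h3 : (M' / m) ^ (-ρ) * U ^ (θ - 1) ≤ n t x ^ (-(γ * b + γ)) := by
      have h4 := Real.rpow_le_rpow_of_nonpos (by positivity) h2 (neg_nonpos.2 hρ0.le)
      rw [Real.mul_rpow (by positivity) (by positivity), ← Real.rpow_mul hpos.le,
        ← Real.rpow_mul hnp.le, ← Real.rpow_mul hnp.le] at h4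
      convert h4 using 2
      · congr 1
        rw [hθ]; ring
      · rw [hρ]; field_simp
    have h5 : U ^ (1 + θ) = U ^ (θ - 1) * U ^ 2 := by
      rw [← Real.rpow_two, ← Real.rpow_add hpos]; congr 1; ring
    rw [h5, ← hκdef]
    have h6 := mul_le_mul_of_nonneg_right (mul_le_mul_of_nonneg_left h3 hκ.le) (sq_nonneg U)
    rw [hc]
    linarith) t ht x
  refine h.trans_eq ?_
  have hexp : -(1 / θ) = -1 - γ * d * (b + 1) * alpha d γ := by
    rw [hθe, alpha]; field_simp; ring
  rw [zero_add, Real.div_rpow ht.le zero_le_two, hexp, ← hexp, Real.rpow_neg zero_le_two, hexp]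
  field_simp

end Trivial

/-! ### Barenblatt solutions -/

/-! ### Powers of the positive part. -/

section PositivePartPower

variable {m y : ℝ}

theorem hasDerivAt_max_zero_rpow (h : 0 < y ∨ 1 < m) :
    HasDerivAt (fun y : ℝ => (max 0 y) ^ m) (m * (max 0 y) ^ (m - 1)) y := by
  rcases lt_trichotomy y 0 with hy | rfl | hy
  · have hm : 1 < m := h.resolve_left hy.not_gt
    rw [max_eq_left hy.le, Real.zero_rpow (by linarith), mul_zero]
    refine (hasDerivAt_const y (0 : ℝ)).congr_of_eventuallyEq ?_
    filter_upwards [Iio_mem_nhds hy] with z hz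
    rw [max_eq_left (le_of_lt hz), Real.zero_rpow (by linarith)]
  · have hm : 1 < m := h.resolve_left (lt_irrefl 0)
    rw [max_self, Real.zero_rpow (by linarith : m - 1 ≠ 0), mul_zero]
    have h1 : HasDerivWithinAt (fun y : ℝ => (max 0 y) ^ m) 0 (Iic 0) 0 := by
      refine (hasDerivWithinAt_const (0 : ℝ) (Iic 0) (0 : ℝ)).congr (fun z hz => ?_) ?_
      · rw [max_eq_left hz, Real.zero_rpow (by linarith)]
      · rw [max_self, Real.zero_rpow (by linarith)]
    have h2 : HasDerivWithinAt (fun y : ℝ => (max 0 y) ^ m) 0 (Ici 0) 0 := by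
      have h3 := (Real.hasDerivAt_rpow_const (x := 0) (p := m) (Or.inr hm.le)).hasDerivWithinAt
        (s := Ici 0)
      rw [Real.zero_rpow (by linarith : m - 1 ≠ 0), mul_zero] at h3
      exact h3.congr (fun z hz => by rw [max_eq_right hz]) (by rw [max_self])
    have h4 := h1.union h2
    rwa [Iic_union_Ici, hasDerivWithinAt_univ] at h4
  · rw [max_eq_right hy.le]
    refine (Real.hasDerivAt_rpow_const (p := m) (Or.inl hy.ne')).congr_of_eventuallyEq ?_
    filter_upwards [Ioi_mem_nhds hy] with z hz
    rw [max_eq_right (le_of_lt hz)]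

theorem contDiffAt_max_zero_rpow_of_pos (hy : 0 < y) {k : WithTop ℕ∞} :
    ContDiffAt ℝ k (fun y : ℝ => (max 0 y) ^ m) y := by
  refine (Real.contDiffAt_rpow_const_of_ne (p := m) hy.ne').congr_of_eventuallyEq ?_
  filter_upwards [Ioi_mem_nhds hy] with z hz
  rw [max_eq_right (le_of_lt hz)]

theorem contDiffAt_max_zero_rpow (h : 0 < y ∨ 1 < m) :
    ContDiffAt ℝ 1 (fun y : ℝ => (max 0 y) ^ m) y := by
  rcases h with h | h
  · exact contDiffAt_max_zero_rpow_of_pos h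
  · refine ContDiff.contDiffAt (contDiff_one_iff_deriv.2
      ⟨fun z => (hasDerivAt_max_zero_rpow (Or.inr h)).differentiableAt, ?_⟩)
    have : deriv (fun y : ℝ => (max 0 y) ^ m) = fun y => m * (max 0 y) ^ (m - 1) :=
      funext fun z => (hasDerivAt_max_zero_rpow (Or.inr h)).deriv
    rw [this]
    exact continuous_const.mul
      ((continuous_const.max continuous_id).rpow_const fun _ => Or.inr (by linarith))

/-- With R = √(c/k) the positive part equals c - k min(r, R)². Its increments factor, and min(r, R)
≤ R bounds the first factor by 2kR = 2√(ck). -/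
theorem abs_max_zero_sub_mul_sq_sub_le {c k r s : ℝ} (hc : 0 < c) (hk : 0 < k) (hr : 0 ≤ r)
    (hs : 0 ≤ s) :
    |max 0 (c - k * r ^ 2) - max 0 (c - k * s ^ 2)| ≤ 2 * √(c * k) * |r - s| := by
  set R := √(c / k) with hR
  have hR0 : 0 ≤ R := Real.sqrt_nonneg _
  have hkR : k * R ^ 2 = c := by
    rw [hR, Real.sq_sqrt (by positivity)]; field_simp
  have hkR' : k * R = √(c * k) := by
    rw [← Real.sqrt_sq (by positivity : 0 ≤ k * R)]
    congr 1
    nlinarith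
  have key : ∀ r, 0 ≤ r → max 0 (c - k * r ^ 2) = c - k * min r R ^ 2 := by
    intro r hr
    rcases le_total r R with h | h
    · rw [min_eq_left h, max_eq_right]
      have : r ^ 2 ≤ R ^ 2 := pow_le_pow_left₀ hr h 2
      nlinarith
    · rw [min_eq_right h, hkR, sub_self, max_eq_left]
      have : R ^ 2 ≤ r ^ 2 := pow_le_pow_left₀ hR0 h 2
      nlinarith
  rw [key r hr, key s hs]
  have e : c - k * min r R ^ 2 - (c - k * min s R ^ 2) =
      k * (min s R + min r R) * (min s R - min r R) := by ring
  have h1 : 0 ≤ min s R := le_min hs hR0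
  have h2 : 0 ≤ min r R := le_min hr hR0
  have h3 : |min s R - min r R| ≤ |r - s| := by
    have := abs_min_sub_min_le_max s R r R
    simpa [abs_sub_comm] using this
  rw [e, abs_mul, abs_of_nonneg (by positivity), ← hkR']
  have h4 : k * (min s R + min r R) ≤ 2 * (k * R) := by
    nlinarith [min_le_right s R, min_le_right r R]
  exact mul_le_mul h4 h3 (abs_nonneg _) (by positivity)

end PositivePartPower

/-! ### Self-similar form, derivatives and flux of the Barenblatt profile. -/

section Barenblatt

variable {d : ℕ} {γ c : ℝ}

/-- The argument `c - sign(γ) α |x t^{-α}|²/2` of the power in the Barenblatt solution. -/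
def barenblattArg (d : ℕ) (γ c t : ℝ) (x : Space d) : ℝ :=
  c - Real.sign γ * alpha d γ * t ^ (-(2 * alpha d γ)) * (‖x‖ ^ 2 / 2)

theorem norm_rpow_neg_smul_sq {t : ℝ} (ht : 0 < t) (a : ℝ) (x : Space d) :
    ‖t ^ (-a) • x‖ ^ 2 = t ^ (-(2 * a)) * ‖x‖ ^ 2 := by
  rw [norm_smul, mul_pow, Real.norm_of_nonneg (by positivity), ← Real.rpow_natCast,
    ← Real.rpow_mul ht.le]
  congr 2
  push_cast; ring

theorem barenblatt_eq {t : ℝ} (ht : 0 < t) (x : Space d) :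
    barenblatt d γ c t x =
      t ^ (-(alpha d γ * d)) * (max 0 (barenblattArg d γ c t x)) ^ (1 / γ) := by
  rw [barenblatt, barenblattArg, norm_rpow_neg_smul_sq ht]
  congr 3
  ring

theorem barenblatt_nonneg {t : ℝ} (ht : 0 < t) (x : Space d) : 0 ≤ barenblatt d γ c t x := by
  rw [barenblatt]; positivity

theorem alpha_pos (ha : 0 < (d : ℝ) * γ + 2) : 0 < alpha d γ := one_div_pos.2 ha

theorem alpha_mul (ha : 0 < (d : ℝ) * γ + 2) : alpha d γ * (d * γ + 2) = 1 :=
  one_div_mul_cancel ha.ne'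

theorem le_barenblattArg_of_neg (ha : 0 < (d : ℝ) * γ + 2) (hγ : γ < 0) {t : ℝ} (ht : 0 < t)
    (x : Space d) : c ≤ barenblattArg d γ c t x := by
  have := alpha_pos ha
  rw [barenblattArg, Real.sign_of_neg hγ]
  have : 0 ≤ alpha d γ * t ^ (-(2 * alpha d γ)) * (‖x‖ ^ 2 / 2) := by positivity
  linarith

theorem barenblattArg_pos_or (ha : 0 < (d : ℝ) * γ + 2) (hγ : γ ≠ 0) (hγ1 : γ < 1) (hc : 0 < c)
    {t : ℝ} (ht : 0 < t) (x : Space d) : 0 < barenblattArg d γ c t x ∨ 1 < 1 / γ := by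
  rcases lt_or_gt_of_ne hγ with h | h
  · exact Or.inl (hc.trans_le (le_barenblattArg_of_neg ha h ht x))
  · exact Or.inr ((one_lt_div h).2 hγ1)

theorem barenblatt_pos_iff (hγ : γ ≠ 0) {t : ℝ} (ht : 0 < t) (x : Space d) :
    0 < barenblatt d γ c t x ↔ 0 < barenblattArg d γ c t x := by
  rw [barenblatt_eq ht]
  constructor
  · intro h
    by_contra h'
    rw [max_eq_left (not_lt.1 h'), Real.zero_rpow (one_div_ne_zero hγ), mul_zero] at h
    exact lt_irrefl _ h
  · intro h
    rw [max_eq_right h.le]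
    positivity

theorem contDiffAt_barenblattArg (τ : ℝ) {z : ℝ × Space d} (hz : 0 < z.1 + τ) :
    ContDiffAt ℝ ∞ (fun z : ℝ × Space d => barenblattArg d γ c (z.1 + τ) z.2) z := by
  have h1 : ContDiffAt ℝ ∞ (fun z : ℝ × Space d => (z.1 + τ) ^ (-(2 * alpha d γ))) z :=
    (contDiffAt_fst.add contDiffAt_const).rpow_const_of_ne hz.ne'
  have h2 : ContDiffAt ℝ ∞ (fun z : ℝ × Space d => ‖z.2‖ ^ 2 / 2) z :=
    (contDiffAt_snd.norm_sq ℝ).div_const 2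
  exact contDiffAt_const.sub ((contDiffAt_const.mul h1).mul h2)

theorem barenblatt_eventuallyEq (τ : ℝ) {z : ℝ × Space d} (hz : 0 < z.1 + τ) :
    (fun z : ℝ × Space d => barenblatt d γ c (z.1 + τ) z.2) =ᶠ[𝓝 z] fun z =>
      (z.1 + τ) ^ (-(alpha d γ * d)) * (max 0 (barenblattArg d γ c (z.1 + τ) z.2)) ^ (1 / γ) := by
  have h : ContinuousAt (fun z : ℝ × Space d => z.1 + τ) z := by fun_prop
  filter_upwards [h.eventually (Ioi_mem_nhds hz)] with w hw
  exact barenblatt_eq hw _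

theorem contDiffAt_barenblatt_of_pos (τ : ℝ) {z : ℝ × Space d} (hz : 0 < z.1 + τ)
    (hp : 0 < barenblattArg d γ c (z.1 + τ) z.2) :
    ContDiffAt ℝ ∞ (fun z : ℝ × Space d => barenblatt d γ c (z.1 + τ) z.2) z := by
  have h1 : ContDiffAt ℝ ∞ (fun z : ℝ × Space d => (z.1 + τ) ^ (-(alpha d γ * d))) z :=
    (contDiffAt_fst.add contDiffAt_const).rpow_const_of_ne hz.ne'
  exact (h1.mul ((contDiffAt_max_zero_rpow_of_pos hp).comp z
    (contDiffAt_barenblattArg τ hz))).congr_of_eventuallyEq (barenblatt_eventuallyEq τ hz)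

theorem contDiffAt_barenblatt (ha : 0 < (d : ℝ) * γ + 2) (hγ : γ ≠ 0) (hγ1 : γ < 1) (hc : 0 < c)
    (τ : ℝ) {z : ℝ × Space d} (hz : 0 < z.1 + τ) :
    ContDiffAt ℝ 1 (fun z : ℝ × Space d => barenblatt d γ c (z.1 + τ) z.2) z := by
  have h1 : ContDiffAt ℝ 1 (fun z : ℝ × Space d => (z.1 + τ) ^ (-(alpha d γ * d))) z :=
    (contDiffAt_fst.add contDiffAt_const).rpow_const_of_ne hz.ne'
  exact (h1.mul ((contDiffAt_max_zero_rpow (barenblattArg_pos_or ha hγ hγ1 hc hz z.2)).comp z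
    ((contDiffAt_barenblattArg τ hz).of_le (by simp)))).congr_of_eventuallyEq
      (barenblatt_eventuallyEq τ hz)

theorem differentiableAt_half_norm_sq (x : Space d) :
    DifferentiableAt ℝ (fun x : Space d => ‖x‖ ^ 2 / 2) x :=
  ((contDiff_norm_sq ℝ (n := 1)).div_const 2).differentiable (by simp) x

theorem differentiableAt_barenblattArg (t : ℝ) (x : Space d) :
    DifferentiableAt ℝ (barenblattArg d γ c t) x :=
  ((differentiableAt_half_norm_sq x).const_mul _).const_sub c

theorem pd_barenblattArg (t : ℝ) (x : Space d) (i : Fin d) :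
    pd i (barenblattArg d γ c t) x =
      -(Real.sign γ * alpha d γ * t ^ (-(2 * alpha d γ))) * x i := by
  have h : barenblattArg d γ c t = fun y =>
      c - Real.sign γ * alpha d γ * t ^ (-(2 * alpha d γ)) * (‖y‖ ^ 2 / 2) := rfl
  rw [h, pd_sub (differentiableAt_const c) ((differentiableAt_half_norm_sq x).const_mul _),
    pd_const_mul (differentiableAt_half_norm_sq x), pd_half_norm_sq, pd_const]
  ring

theorem pd_barenblatt (ha : 0 < (d : ℝ) * γ + 2) (hγ : γ ≠ 0) (hγ1 : γ < 1) (hc : 0 < c)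
    {t : ℝ} (ht : 0 < t) (x : Space d) (i : Fin d) :
    pd i (barenblatt d γ c t) x = -(t ^ (-(alpha d γ * d)) *
      (1 / γ * (max 0 (barenblattArg d γ c t x)) ^ (1 / γ - 1)) *
        (Real.sign γ * alpha d γ * t ^ (-(2 * alpha d γ)))) * x i := by
  have h : barenblatt d γ c t = fun y =>
      t ^ (-(alpha d γ * d)) * (max 0 (barenblattArg d γ c t y)) ^ (1 / γ) :=
    funext fun y => barenblatt_eq ht y
  have hd := hasDerivAt_max_zero_rpow (barenblattArg_pos_or ha hγ hγ1 hc ht x)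
  rw [h, pd_const_mul (f := fun y => (max 0 (barenblattArg d γ c t y)) ^ (1 / γ))
    (hd.differentiableAt.comp x (differentiableAt_barenblattArg t x)),
    pd_comp hd (differentiableAt_barenblattArg t x), pd_barenblattArg]
  ring

/-- The Barenblatt solution solves the transport equation with velocity `αx/t`. -/
theorem hasDerivAt_barenblatt (ha : 0 < (d : ℝ) * γ + 2) (hγ : γ ≠ 0) (hγ1 : γ < 1) (hc : 0 < c)
    (τ : ℝ) {t : ℝ} (ht : 0 < t + τ) (x : Space d) :
    HasDerivAt (fun s => barenblatt d γ c (s + τ) x)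
      (-(alpha d γ / (t + τ)) * (d * barenblatt d γ c (t + τ) x +
        ∑ i, x i * pd i (barenblatt d γ c (t + τ)) x)) t := by
  set T := t + τ with hT
  set a := alpha d γ with hadef
  have hs : HasDerivAt (fun s : ℝ => s + τ) 1 t := (hasDerivAt_id t).add_const τ
  have h1 : ∀ q : ℝ, HasDerivAt (fun s : ℝ => (s + τ) ^ q) (q * T ^ (q - 1)) t := fun q => by
    simpa using hs.rpow_const (p := q) (Or.inl ht.ne')
  have h2 : HasDerivAt (fun s => barenblattArg d γ c (s + τ) x)
      (-(Real.sign γ * a * (-(2 * a) * T ^ (-(2 * a) - 1)) * (‖x‖ ^ 2 / 2))) t :=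
    (((h1 (-(2 * a))).const_mul (Real.sign γ * a)).mul_const (‖x‖ ^ 2 / 2)).const_sub c
  have hd := hasDerivAt_max_zero_rpow (barenblattArg_pos_or ha hγ hγ1 hc ht x)
  have h3 := (h1 (-(a * d))).mul (hd.comp t h2)
  have h4 : (fun s => barenblatt d γ c (s + τ) x) =ᶠ[𝓝 t] fun s =>
      (s + τ) ^ (-(a * d)) * (max 0 (barenblattArg d γ c (s + τ) x)) ^ (1 / γ) := by
    filter_upwards [hs.continuousAt.eventually (Ioi_mem_nhds ht)] with s hs using barenblatt_eq hs x
  refine (h3.congr_of_eventuallyEq h4).congr_deriv ?_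
  have h5 : ∑ i, x i * pd i (barenblatt d γ c T) x = -(T ^ (-(a * d)) *
      (1 / γ * (max 0 (barenblattArg d γ c T x)) ^ (1 / γ - 1)) *
        (Real.sign γ * a * T ^ (-(2 * a)))) * ‖x‖ ^ 2 := by
    rw [norm_sq_eq_sum, Finset.mul_sum]
    refine Finset.sum_congr rfl fun i _ => ?_
    rw [pd_barenblatt ha hγ hγ1 hc ht]
    ring
  rw [h5, barenblatt_eq ht, Real.rpow_sub_one ht.ne', Real.rpow_sub_one ht.ne']
  simp only [Function.comp_apply, ← hT, ← hadef]
  field_simp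
  ring

theorem pressure_barenblatt_of_pos (hγ : γ ≠ 0) {t : ℝ} (ht : 0 < t) {x : Space d}
    (hx : 0 < barenblattArg d γ c t x) : pressure γ (barenblatt d γ c t x) =
      Real.sign γ * (t ^ (-(alpha d γ * d * γ)) * barenblattArg d γ c t x) := by
  rw [pressure, barenblatt_eq ht, max_eq_right hx.le, Real.mul_rpow (by positivity) (by positivity),
    ← Real.rpow_mul ht.le, ← Real.rpow_mul hx.le, one_div_mul_cancel hγ, Real.rpow_one, neg_mul]

/-- On the positivity set p is a constant minus a multiple of |x|². The powers of t combine to 1/t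
because α(dγ + 2) = 1. -/
theorem gradient_pressure_barenblatt (ha : 0 < (d : ℝ) * γ + 2) (hγ : γ ≠ 0) {t : ℝ} (ht : 0 < t)
    {x : Space d} (hx : 0 < barenblattArg d γ c t x) :
    gradient (fun y => pressure γ (barenblatt d γ c t y)) x = -(alpha d γ / t) • x := by
  have hev : (fun y => pressure γ (barenblatt d γ c t y)) =ᶠ[𝓝 x] fun y =>
      Real.sign γ * t ^ (-(alpha d γ * d * γ)) * barenblattArg d γ c t y := by
    filter_upwards [(differentiableAt_barenblattArg t x).continuousAt.eventually
      (Ioi_mem_nhds hx)] with y hy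
    rw [pressure_barenblatt_of_pos hγ ht hy]
    ring
  ext i
  rw [gradient_apply, pd_congr hev fun y hy => hy,
    pd_const_mul (differentiableAt_barenblattArg t x),
    pd_barenblattArg, PiLp.smul_apply, smul_eq_mul]
  have hσ : Real.sign γ * Real.sign γ = 1 := by
    rw [← abs_mul_abs_self, abs_sign_of_ne_zero hγ, one_mul]
  have ht1 : t ^ (-(alpha d γ * d * γ)) * t ^ (-(2 * alpha d γ)) = t⁻¹ := by
    rw [← Real.rpow_add ht, ← Real.rpow_neg_one]
    congr 1
    linarith [alpha_mul ha]
  rw [div_eq_mul_inv, ← ht1]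
  linear_combination (-(t ^ (-(alpha d γ * d * γ)) * t ^ (-(2 * alpha d γ)) * alpha d γ * x i)) * hσ

/-- The identity also holds across the free boundary, since both sides carry the factor n. The flux
is therefore C¹ even where p is not differentiable. -/
theorem flux_barenblatt (ha : 0 < (d : ℝ) * γ + 2) (hγ : γ ≠ 0) (τ : ℝ) {t : ℝ} (ht : 0 < t + τ)
    (x : Space d) : barenblatt d γ c (t + τ) x •
      gradQ γ (fun _ => 0) (fun s => barenblatt d γ c (s + τ)) t x =
        (-(alpha d γ / (t + τ)) * barenblatt d γ c (t + τ) x) • x := by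
  by_cases hx : 0 < barenblattArg d γ c (t + τ) x
  · rw [gradQ, gradient_zero_fun, add_zero, gradient_pressure_barenblatt ha hγ ht hx, smul_smul,
      mul_comm]
  · have h0 : barenblatt d γ c (t + τ) x = 0 :=
      le_antisymm (not_lt.1 fun h => hx ((barenblatt_pos_iff hγ ht x).1 h))
        (barenblatt_nonneg ht x)
    rw [h0, zero_smul, mul_zero, zero_smul]

end Barenblatt

/-! ### Support, tail and Lipschitz bounds, locally uniform in time. -/

section BarenblattBounds

variable {d : ℕ} {γ c : ℝ}

/-- The fraction in the hypothesis is the squared support radius at time T. Adding 1 makes ‖x‖²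
exceed it without taking a root. -/
theorem barenblatt_eq_zero_of_lt_norm (ha : 0 < (d : ℝ) * γ + 2) (hγ : 0 < γ) (hc : 0 < c)
    {t T : ℝ} (ht : 0 < t) (htT : t ≤ T) {x : Space d}
    (hx : 1 + 2 * c * T ^ (2 * alpha d γ) / alpha d γ < ‖x‖) : barenblatt d γ c t x = 0 := by
  have hα := alpha_pos ha
  have hT : 0 < T := ht.trans_le htT
  have h0 : 0 ≤ 2 * c * T ^ (2 * alpha d γ) / alpha d γ := by positivity
  have hx2 : 2 * c * T ^ (2 * alpha d γ) / alpha d γ ≤ ‖x‖ ^ 2 := by nlinarith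
  have h1 : T ^ (-(2 * alpha d γ)) ≤ t ^ (-(2 * alpha d γ)) :=
    Real.rpow_le_rpow_of_nonpos ht htT (by linarith)
  have h2 : c ≤ alpha d γ * t ^ (-(2 * alpha d γ)) * (‖x‖ ^ 2 / 2) := by
    calc c = alpha d γ * T ^ (-(2 * alpha d γ)) *
          (2 * c * T ^ (2 * alpha d γ) / alpha d γ / 2) := by
          rw [Real.rpow_neg hT.le]; field_simp
      _ ≤ _ := by gcongr
  rw [barenblatt_eq ht, barenblattArg, Real.sign_of_pos hγ, one_mul, max_eq_left (by linarith),
    Real.zero_rpow (by positivity), mul_zero]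

theorem max_zero_barenblattArg_le (ha : 0 < (d : ℝ) * γ + 2) (hγ : 0 < γ) (hc : 0 < c)
    {t : ℝ} (ht : 0 < t) (x : Space d) : max 0 (barenblattArg d γ c t x) ≤ c := by
  have hα := alpha_pos ha
  refine max_le hc.le ?_
  rw [barenblattArg, Real.sign_of_pos hγ, one_mul]
  have : 0 ≤ alpha d γ * t ^ (-(2 * alpha d γ)) * (‖x‖ ^ 2 / 2) := by positivity
  linarith

theorem barenblatt_le_of_pos (ha : 0 < (d : ℝ) * γ + 2) (hγ : 0 < γ) (hc : 0 < c)
    {t T : ℝ} (hT : 0 < T) (hTt : T ≤ t) (x : Space d) :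
    barenblatt d γ c t x ≤ T ^ (-(alpha d γ * d)) * c ^ (1 / γ) := by
  have hα := alpha_pos ha
  have ht : 0 < t := hT.trans_le hTt
  rw [barenblatt_eq ht]
  have h1 := max_zero_barenblattArg_le ha hγ hc ht x
  have h2 : t ^ (-(alpha d γ * d)) ≤ T ^ (-(alpha d γ * d)) :=
    Real.rpow_le_rpow_of_nonpos hT hTt (by
      have : 0 ≤ alpha d γ * d := by positivity
      linarith)
  gcongr

theorem exists_barenblattArg_bounds (ha : 0 < (d : ℝ) * γ + 2) (hγ : γ < 0) (hc : 0 < c)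
    {T₀ T₁ : ℝ} (hT₀ : 0 < T₀) (hT : T₀ ≤ T₁) : ∃ m > 0, ∃ M > 0, ∀ t ∈ Icc T₀ T₁,
      ∀ x : Space d, m * (1 + ‖x‖ ^ 2) ≤ barenblattArg d γ c t x ∧
        barenblattArg d γ c t x ≤ M * (1 + ‖x‖ ^ 2) := by
  have hα := alpha_pos ha
  have hT₁ : 0 < T₁ := hT₀.trans_le hT
  refine ⟨min c (alpha d γ * T₁ ^ (-(2 * alpha d γ)) / 2), lt_min hc (by positivity),
    max c (alpha d γ * T₀ ^ (-(2 * alpha d γ)) / 2), lt_max_of_lt_left hc, fun t ht x => ?_⟩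
  have ht0 : 0 < t := hT₀.trans_le ht.1
  have h1 : T₁ ^ (-(2 * alpha d γ)) ≤ t ^ (-(2 * alpha d γ)) :=
    Real.rpow_le_rpow_of_nonpos ht0 ht.2 (by linarith)
  have h2 : t ^ (-(2 * alpha d γ)) ≤ T₀ ^ (-(2 * alpha d γ)) :=
    Real.rpow_le_rpow_of_nonpos hT₀ ht.1 (by linarith)
  have e : barenblattArg d γ c t x = c + alpha d γ * t ^ (-(2 * alpha d γ)) / 2 * ‖x‖ ^ 2 := by
    rw [barenblattArg, Real.sign_of_neg hγ]; ring
  rw [e, mul_add, mul_add, mul_one, mul_one]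
  refine ⟨add_le_add (min_le_left _ _) ?_, add_le_add (le_max_left _ _) ?_⟩
  · refine mul_le_mul_of_nonneg_right ((min_le_right _ _).trans ?_) (sq_nonneg _)
    gcongr
  · refine mul_le_mul_of_nonneg_right (le_trans ?_ (le_max_right _ _)) (sq_nonneg _)
    gcongr

theorem exists_barenblatt_bounds (ha : 0 < (d : ℝ) * γ + 2) (hγ : γ < 0) (hc : 0 < c)
    {T₀ T₁ : ℝ} (hT₀ : 0 < T₀) (hT : T₀ ≤ T₁) : ∃ k > 0, ∃ K, ∀ t ∈ Icc T₀ T₁,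
      ∀ x : Space d, k * (1 + ‖x‖ ^ 2) ^ (1 / γ) ≤ barenblatt d γ c t x ∧
        barenblatt d γ c t x ≤ K * (1 + ‖x‖ ^ 2) ^ (1 / γ) := by
  have hα := alpha_pos ha
  have hT₁ : 0 < T₁ := hT₀.trans_le hT
  have hγ' : 1 / γ ≤ 0 := (div_neg_of_pos_of_neg one_pos hγ).le
  obtain ⟨m, hm, M, hM, h⟩ := exists_barenblattArg_bounds (d := d) ha hγ hc hT₀ hT
  refine ⟨T₁ ^ (-(alpha d γ * d)) * M ^ (1 / γ), by positivity,
    T₀ ^ (-(alpha d γ * d)) * m ^ (1 / γ), fun t ht x => ?_⟩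
  have ht0 : 0 < t := hT₀.trans_le ht.1
  have hαd : -(alpha d γ * d) ≤ 0 := by
    have : 0 ≤ alpha d γ * d := by positivity
    linarith
  have h1 : T₁ ^ (-(alpha d γ * d)) ≤ t ^ (-(alpha d γ * d)) :=
    Real.rpow_le_rpow_of_nonpos ht0 ht.2 hαd
  have h2 : t ^ (-(alpha d γ * d)) ≤ T₀ ^ (-(alpha d γ * d)) :=
    Real.rpow_le_rpow_of_nonpos hT₀ ht.1 hαd
  obtain ⟨h3, h4⟩ := h t ht x
  have h5 : 0 < barenblattArg d γ c t x := lt_of_lt_of_le (by positivity) h3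
  rw [barenblatt_eq ht0, max_eq_right h5.le, mul_assoc, mul_assoc,
    ← Real.mul_rpow hM.le (by positivity), ← Real.mul_rpow hm.le (by positivity)]
  constructor
  · exact mul_le_mul h1 (Real.rpow_le_rpow_of_nonpos h5 h4 hγ') (by positivity) (by positivity)
  · exact mul_le_mul h2 (Real.rpow_le_rpow_of_nonpos (by positivity) h3 hγ') (by positivity)
      (by positivity)

/-- For γ < 0 the tail (1 + |x|²)^{1/γ} is integrable because 2/|γ| > d, that is dγ + 2 > 0. For γ >
0 the supports lie in a common ball. -/
theorem exists_integrable_barenblatt_le (ha : 0 < (d : ℝ) * γ + 2) (hγ : γ ≠ 0) (hc : 0 < c)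
    {T₀ T₁ : ℝ} (hT₀ : 0 < T₀) (hT : T₀ ≤ T₁) : ∃ G : Space d → ℝ, Integrable G ∧
      ∀ t ∈ Icc T₀ T₁, ∀ x, barenblatt d γ c t x ≤ G x := by
  rcases lt_or_gt_of_ne hγ with h | h
  · obtain ⟨k, -, K, hK⟩ := exists_barenblatt_bounds (d := d) ha h hc hT₀ hT
    refine ⟨fun x => K * (1 + ‖x‖ ^ 2) ^ (1 / γ), Integrable.const_mul ?_ K,
      fun t ht x => (hK t ht x).2⟩
    have hr : (Module.finrank ℝ (Space d) : ℝ) < -2 / γ := by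
      rw [finrank_euclideanSpace_fin, lt_div_iff_of_neg h]
      linarith
    have e : -(-2 / γ) / 2 = 1 / γ := by field_simp
    have := integrable_rpow_neg_one_add_norm_sq (μ := (volume : Measure (Space d))) hr
    rwa [e] at this
  · set R := 1 + 2 * c * T₁ ^ (2 * alpha d γ) / alpha d γ with hR
    refine ⟨(Metric.closedBall (0 : Space d) R).indicator
      fun _ => T₀ ^ (-(alpha d γ * d)) * c ^ (1 / γ), IntegrableOn.integrable_indicator
        (integrableOn_const (isCompact_closedBall _ _).measure_lt_top.ne)
        Metric.isClosed_closedBall.measurableSet, fun t ht x => ?_⟩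
    by_cases hx : x ∈ Metric.closedBall (0 : Space d) R
    · rw [indicator_of_mem hx]
      exact barenblatt_le_of_pos ha h hc hT₀ ht.1 x
    · rw [indicator_of_notMem hx]
      rw [mem_closedBall_zero_iff, not_le] at hx
      exact (barenblatt_eq_zero_of_lt_norm ha h hc (hT₀.trans_le ht.1) ht.2 hx).le

theorem exists_norm_gradient_barenblatt_le (ha : 0 < (d : ℝ) * γ + 2) (hγ : γ < 0) (hc : 0 < c)
    {T₀ T₁ : ℝ} (hT₀ : 0 < T₀) (hT : T₀ ≤ T₁) : ∃ C, ∀ t ∈ Icc T₀ T₁,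
      ∀ x : Space d, 1 < ‖x‖ → ‖gradient (barenblatt d γ c t) x‖ ≤ C * ‖x‖ ^ (2 / γ - 1) := by
  have hα := alpha_pos ha
  have hγ' : 1 / γ < 0 := div_neg_of_pos_of_neg one_pos hγ
  obtain ⟨m, hm, M, hM, h⟩ := exists_barenblattArg_bounds (d := d) ha hγ hc hT₀ hT
  refine ⟨T₀ ^ (-(alpha d γ * d)) * (-(1 / γ) * m ^ (1 / γ - 1)) *
    (alpha d γ * T₀ ^ (-(2 * alpha d γ))), fun t ht x hx => ?_⟩
  have ht0 : 0 < t := hT₀.trans_le ht.1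
  have hx0 : 0 < ‖x‖ := by linarith
  have hαd : 0 ≤ alpha d γ * d := by positivity
  have h1 : t ^ (-(2 * alpha d γ)) ≤ T₀ ^ (-(2 * alpha d γ)) :=
    Real.rpow_le_rpow_of_nonpos hT₀ ht.1 (by linarith)
  have h2 : t ^ (-(alpha d γ * d)) ≤ T₀ ^ (-(alpha d γ * d)) :=
    Real.rpow_le_rpow_of_nonpos hT₀ ht.1 (by linarith)
  obtain ⟨h3, -⟩ := h t ht x
  have h5 : 0 < barenblattArg d γ c t x := lt_of_lt_of_le (by positivity) h3
  have h6 : barenblattArg d γ c t x ^ (1 / γ - 1) ≤ m ^ (1 / γ - 1) * ‖x‖ ^ (2 / γ - 2) := by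
    have h7 : m * ‖x‖ ^ 2 ≤ barenblattArg d γ c t x := by nlinarith
    refine (Real.rpow_le_rpow_of_nonpos (by positivity) h7 (by linarith)).trans_eq ?_
    rw [Real.mul_rpow hm.le (by positivity), ← Real.rpow_natCast, ← Real.rpow_mul hx0.le]
    congr 2
    push_cast; ring
  have hgrad : gradient (barenblatt d γ c t) x = -(t ^ (-(alpha d γ * d)) *
      (1 / γ * barenblattArg d γ c t x ^ (1 / γ - 1)) *
        (-1 * alpha d γ * t ^ (-(2 * alpha d γ)))) • x := by
    ext i
    rw [gradient_apply, pd_barenblatt ha hγ.ne (by linarith) hc ht0, PiLp.smul_apply, smul_eq_mul,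
      max_eq_right h5.le, Real.sign_of_neg hγ]
  have hnn : -(t ^ (-(alpha d γ * d)) * (1 / γ * barenblattArg d γ c t x ^ (1 / γ - 1)) *
        (-1 * alpha d γ * t ^ (-(2 * alpha d γ)))) =
      -(t ^ (-(alpha d γ * d)) * (-(1 / γ) * barenblattArg d γ c t x ^ (1 / γ - 1)) *
        (alpha d γ * t ^ (-(2 * alpha d γ)))) := by ring
  have hg' : 0 ≤ -(1 / γ) := by linarith
  rw [hgrad, norm_smul, hnn, norm_neg, Real.norm_of_nonneg (by positivity)]
  have hsplit : ‖x‖ ^ (2 / γ - 1) = ‖x‖ ^ (2 / γ - 2) * ‖x‖ := by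
    rw [← Real.rpow_add_one hx0.ne']; congr 1; ring
  calc t ^ (-(alpha d γ * d)) * (-(1 / γ) * barenblattArg d γ c t x ^ (1 / γ - 1)) *
        (alpha d γ * t ^ (-(2 * alpha d γ))) * ‖x‖
      ≤ T₀ ^ (-(alpha d γ * d)) * (-(1 / γ) * (m ^ (1 / γ - 1) * ‖x‖ ^ (2 / γ - 2))) *
        (alpha d γ * T₀ ^ (-(2 * alpha d γ))) * ‖x‖ := by gcongr
    _ = _ := by rw [hsplit]; ring

theorem pressure_barenblatt_of_pos_exponent (hγ : 0 < γ) {t : ℝ} (ht : 0 < t) (x : Space d) :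
    pressure γ (barenblatt d γ c t x) =
      t ^ (-(alpha d γ * d * γ)) * max 0 (barenblattArg d γ c t x) := by
  have h0 : 0 ≤ max 0 (barenblattArg d γ c t x) := le_max_left _ _
  rw [pressure, barenblatt_eq ht, Real.sign_of_pos hγ, one_mul,
    Real.mul_rpow (by positivity) (by positivity), ← Real.rpow_mul ht.le, ← Real.rpow_mul h0,
    one_div_mul_cancel hγ.ne', Real.rpow_one, neg_mul]

theorem exists_lipschitzWith_pressure_barenblatt (ha : 0 < (d : ℝ) * γ + 2) (hγ : 0 < γ)
    (hc : 0 < c) {T₀ : ℝ} (hT₀ : 0 < T₀) : ∃ L : NNReal, ∀ t ≥ T₀,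
      (∀ x : Space d, |pressure γ (barenblatt d γ c t x)| ≤ L) ∧
        LipschitzWith L (fun x : Space d => pressure γ (barenblatt d γ c t x)) := by
  have hα := alpha_pos ha
  set q := T₀ ^ (-(alpha d γ * d * γ)) with hq
  set k₀ := alpha d γ * T₀ ^ (-(2 * alpha d γ)) / 2 with hk₀
  have hk₀0 : 0 < k₀ := by positivity
  have hq0 : 0 < q := by positivity
  have hL : 0 ≤ q * c + q * (2 * √(c * k₀)) := by positivity
  refine ⟨⟨_, hL⟩, fun t ht => ?_⟩
  have ht0 : 0 < t := hT₀.trans_le ht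
  have hqt : t ^ (-(alpha d γ * d * γ)) ≤ q := Real.rpow_le_rpow_of_nonpos hT₀ ht (by
    have : 0 ≤ alpha d γ * d * γ := by positivity
    linarith)
  set k := alpha d γ * t ^ (-(2 * alpha d γ)) / 2 with hk
  have hk0 : 0 < k := by positivity
  have hkk : k ≤ k₀ := by
    have : t ^ (-(2 * alpha d γ)) ≤ T₀ ^ (-(2 * alpha d γ)) :=
      Real.rpow_le_rpow_of_nonpos hT₀ ht (by linarith)
    rw [hk, hk₀]
    gcongr
  have harg : ∀ x : Space d, barenblattArg d γ c t x = c - k * ‖x‖ ^ 2 := fun x => by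
    rw [barenblattArg, Real.sign_of_pos hγ, hk]; ring
  constructor
  · intro x
    rw [pressure_barenblatt_of_pos_exponent hγ ht0, abs_of_nonneg (by positivity)]
    have h1 := max_zero_barenblattArg_le ha hγ hc ht0 x
    calc t ^ (-(alpha d γ * d * γ)) * max 0 (barenblattArg d γ c t x) ≤ q * c := by gcongr
      _ ≤ q * c + q * (2 * √(c * k₀)) := le_add_of_nonneg_right (by positivity)
  · refine LipschitzWith.of_dist_le_mul fun x y => ?_
    rw [pressure_barenblatt_of_pos_exponent hγ ht0, pressure_barenblatt_of_pos_exponent hγ ht0,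
      Real.dist_eq, ← mul_sub, abs_mul, abs_of_nonneg (by positivity), harg, harg, dist_eq_norm]
    have h1 := abs_max_zero_sub_mul_sq_sub_le hc hk0 (norm_nonneg x) (norm_nonneg y)
    have h2 := abs_norm_sub_norm_le x y
    have h3 : √(c * k) ≤ √(c * k₀) := Real.sqrt_le_sqrt (by gcongr)
    calc t ^ (-(alpha d γ * d * γ)) *
          |max 0 (c - k * ‖x‖ ^ 2) - max 0 (c - k * ‖y‖ ^ 2)|
        ≤ q * (2 * √(c * k₀) * ‖x - y‖) := by
          refine mul_le_mul hqt (h1.trans ?_) (abs_nonneg _) hq0.le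
          gcongr
      _ ≤ (q * c + q * (2 * √(c * k₀))) * ‖x - y‖ := by
          have : 0 ≤ q * c * ‖x - y‖ := by positivity
          linarith

end BarenblattBounds

/-! ### Continuity, integrability and the initial trace. -/

section BarenblattSolution

variable {d : ℕ} {γ c τ : ℝ}

theorem continuousOn_barenblatt (ha : 0 < (d : ℝ) * γ + 2) (hγ : γ ≠ 0) (hγ1 : γ < 1) (hc : 0 < c)
    (τ : ℝ) : ContinuousOn (fun z : ℝ × Space d => barenblatt d γ c (z.1 + τ) z.2)
      {z | 0 < z.1 + τ} := fun _ hz =>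
  (contDiffAt_barenblatt ha hγ hγ1 hc τ hz).continuousAt.continuousWithinAt

theorem continuous_barenblatt (ha : 0 < (d : ℝ) * γ + 2) (hγ : γ ≠ 0) (hγ1 : γ < 1) (hc : 0 < c)
    {t : ℝ} (ht : 0 < t) : Continuous (barenblatt d γ c t) :=
  continuous_iff_continuousAt.2 fun x => by
    have h := (contDiffAt_barenblatt ha hγ hγ1 hc t (z := ((0 : ℝ), x)) (by simpa)).continuousAt
    simpa [Function.comp_def] using h.comp (f := fun y : Space d => ((0 : ℝ), y)) (by fun_prop)

theorem continuousAt_barenblatt_time (ha : 0 < (d : ℝ) * γ + 2) (hγ : γ ≠ 0) (hγ1 : γ < 1)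
    (hc : 0 < c) {t : ℝ} (ht : 0 < t) (x : Space d) :
    ContinuousAt (fun s => barenblatt d γ c (s + t) x) 0 := by
  have h := (contDiffAt_barenblatt ha hγ hγ1 hc t (z := ((0 : ℝ), x)) (by simpa)).continuousAt
  exact h.comp (f := fun s : ℝ => (s, x)) (by fun_prop)

theorem integrable_barenblatt (ha : 0 < (d : ℝ) * γ + 2) (hγ : γ ≠ 0) (hγ1 : γ < 1) (hc : 0 < c)
    {t : ℝ} (ht : 0 < t) : Integrable (barenblatt d γ c t) := by
  obtain ⟨G, hG, hle⟩ := exists_integrable_barenblatt_le (d := d) ha hγ hc ht le_rfl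
  refine hG.mono' (continuous_barenblatt ha hγ hγ1 hc ht).aestronglyMeasurable
    (Eventually.of_forall fun x => ?_)
  rw [Real.norm_of_nonneg (barenblatt_nonneg ht x)]
  exact hle t ⟨le_rfl, le_rfl⟩ x

theorem tendsto_eLpNorm_barenblatt_sub (ha : 0 < (d : ℝ) * γ + 2) (hγ : γ ≠ 0) (hγ1 : γ < 1)
    (hc : 0 < c) (hτ : 0 < τ) :
    Tendsto (fun t => eLpNorm (fun x : Space d =>
      barenblatt d γ c (t + τ) x - barenblatt d γ c (0 + τ) x) 1 volume) (𝓝[>] 0) (𝓝 0) := by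
  obtain ⟨G, hG, hle⟩ := exists_integrable_barenblatt_le (d := d) ha hγ hc hτ
    (by linarith : τ ≤ 1 + τ)
  simp only [eLpNorm_one_eq_lintegral_enorm]
  have h0 : (0 : ENNReal) = ∫⁻ _ : Space d, 0 := by simp
  rw [h0]
  have hcont : ∀ t, 0 < t → Continuous (barenblatt d γ c t) := fun t ht =>
    continuous_barenblatt ha hγ hγ1 hc ht
  have hτ' : 0 < 0 + τ := by simpa
  refine tendsto_lintegral_filter_of_dominated_convergence
    (fun x => ‖G x‖ₑ) ?_ ?_ hG.2.ne (Eventually.of_forall fun x => ?_)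
  · filter_upwards [self_mem_nhdsWithin] with t ht
    have ht' : 0 < t + τ := add_pos ht hτ
    exact ((hcont _ ht').sub (hcont _ hτ')).measurable.enorm
  · filter_upwards [Ioo_mem_nhdsGT one_pos] with t ht
    refine Eventually.of_forall fun x => ?_
    have ht' : 0 < t + τ := by linarith [ht.1]
    have h1 := hle (t + τ) ⟨by linarith [ht.1], by linarith [ht.2]⟩ x
    have h2 := hle (0 + τ) ⟨by linarith, by linarith⟩ x
    have h3 := barenblatt_nonneg (γ := γ) (c := c) ht' x
    have h4 := barenblatt_nonneg (γ := γ) (c := c) hτ' x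
    rw [enorm_le_iff_norm_le, Real.norm_of_nonneg (h3.trans h1), Real.norm_eq_abs, abs_le]
    constructor <;> linarith
  · have h1 : Tendsto (fun t => barenblatt d γ c (t + τ) x - barenblatt d γ c (0 + τ) x) (𝓝 0)
        (𝓝 (barenblatt d γ c (0 + τ) x - barenblatt d γ c (0 + τ) x)) :=
      (continuousAt_barenblatt_time ha hγ hγ1 hc hτ x).tendsto.sub tendsto_const_nhds
    rw [sub_self] at h1
    simpa using (h1.mono_left nhdsWithin_le_nhds).enorm

end BarenblattSolution

/-! ### The Barenblatt solutions solve the equation and attain the decay rate. -/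

section BarenblattWellBehaved

variable {d : ℕ} {γ c τ : ℝ}

theorem contDiffAt_flux_barenblatt (ha : 0 < (d : ℝ) * γ + 2) (hγ : γ ≠ 0) (hγ1 : γ < 1)
    (hc : 0 < c) (τ : ℝ) (i : Fin d) {z : ℝ × Space d} (hz : 0 < z.1 + τ) :
    ContDiffAt ℝ 1 (fun z : ℝ × Space d =>
      -(alpha d γ / (z.1 + τ)) * barenblatt d γ c (z.1 + τ) z.2 * z.2 i) z := by
  have h1 : ContDiffAt ℝ 1 (fun z : ℝ × Space d => -(alpha d γ / (z.1 + τ))) z :=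
    (contDiffAt_const.div (contDiffAt_fst.add contDiffAt_const) hz.ne').neg
  have h2 : ContDiffAt ℝ 1 (fun z : ℝ × Space d => z.2 i) z :=
    ((contDiff_coord i).of_le (by simp)).contDiffAt.comp z contDiffAt_snd
  exact (h1.mul (contDiffAt_barenblatt ha hγ hγ1 hc τ hz)).mul h2

theorem fderiv_barenblatt_time (ha : 0 < (d : ℝ) * γ + 2) (hγ : γ ≠ 0) (hγ1 : γ < 1)
    (hc : 0 < c) (τ : ℝ) {z : ℝ × Space d} (hz : 0 < z.1 + τ) :
    fderiv ℝ (fun z : ℝ × Space d => barenblatt d γ c (z.1 + τ) z.2) z (1, 0) =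
      ∑ i, fderiv ℝ (fun z : ℝ × Space d =>
        -(alpha d γ / (z.1 + τ)) * barenblatt d γ c (z.1 + τ) z.2 * z.2 i) z
          (0, EuclideanSpace.single i 1) := by
  obtain ⟨t, x⟩ := z
  have hB := (contDiffAt_barenblatt ha hγ hγ1 hc τ hz).differentiableAt (by simp)
  have hBs : DifferentiableAt ℝ (barenblatt d γ c (t + τ)) x :=
    hB.comp (f := fun y : Space d => (t, y)) x (by fun_prop)
  rw [(hasDerivAt_slice hB).unique (hasDerivAt_barenblatt ha hγ hγ1 hc τ hz x)]
  have h : ∀ i, fderiv ℝ (fun z : ℝ × Space d =>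
        -(alpha d γ / (z.1 + τ)) * barenblatt d γ c (z.1 + τ) z.2 * z.2 i) (t, x)
          (0, EuclideanSpace.single i 1) =
      -(alpha d γ / (t + τ)) * (barenblatt d γ c (t + τ) x +
        x i * pd i (barenblatt d γ c (t + τ)) x) := fun i => by
    rw [← pd_slice_of_differentiableAt
      ((contDiffAt_flux_barenblatt ha hγ hγ1 hc τ i hz).differentiableAt (by simp))]
    simp only
    rw [pd_mul (hBs.const_mul _) (differentiable_of_contDiff (contDiff_coord i) x),
      pd_const_mul hBs, pd_coord, if_pos rfl]
    ring
  rw [Finset.sum_congr rfl fun i _ => h i, ← Finset.mul_sum, Finset.sum_add_distrib,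
    Finset.sum_const, Finset.card_univ, Fintype.card_fin, nsmul_eq_mul]

/-- For γ > 0 the exponent 1/γ exceeds 1, so density and flux are C¹ across the free boundary; for γ
< 0 the density is positive and smooth. The equation thus holds classically, and both weak
identities are integrations by parts with f = ∂ₜn. -/
theorem isStrongSolution_barenblatt (ha : 0 < (d : ℝ) * γ + 2) (hγ : γ ≠ 0) (hγ1 : γ < 1)
    (hc : 0 < c) (hτ : 0 < τ) :
    IsStrongSolution γ (fun _ : Space d => 0) (fun t => barenblatt d γ c (t + τ)) := by
  have hsub : (Ioi 0 ×ˢ univ : Set (ℝ × Space d)) ⊆ {z | 0 < z.1 + τ} := fun z hz =>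
    add_pos hz.1 hτ
  have hmeas : MeasurableSet (Ioi 0 ×ˢ univ : Set (ℝ × Space d)) :=
    measurableSet_Ioi.prod MeasurableSet.univ
  have hfd : ∀ v, ContinuousOn (fun z : ℝ × Space d =>
      fderiv ℝ (fun z : ℝ × Space d => barenblatt d γ c (z.1 + τ) z.2) z v) (Ioi 0 ×ˢ univ) :=
    fun v z hz => (((contDiffAt_barenblatt ha hγ hγ1 hc τ (hsub hz)).fderiv_right (m := 0)
      (by simp)).continuousAt.clm_apply continuousAt_const).continuousWithinAt
  have hhaar := isAddHaarMeasure_volume_prod d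
  refine ⟨fun t ht x => barenblatt_nonneg (by linarith) x, ?_,
    tendsto_eLpNorm_barenblatt_sub ha hγ hγ1 hc hτ,
    ((continuousOn_barenblatt ha hγ hγ1 hc τ).mono hsub).locallyIntegrableOn hmeas, ?_,
    _, (hfd (1, 0)).locallyIntegrableOn hmeas, fun φ hφ hφc hφt => ⟨?_, ?_⟩⟩
  · exact integrable_barenblatt ha hγ hγ1 hc (by simpa)
  · refine ContinuousOn.locallyIntegrableOn ?_ hmeas
    have h1 : ContinuousOn (fun z : ℝ × Space d =>
        (-(alpha d γ / (z.1 + τ)) * barenblatt d γ c (z.1 + τ) z.2) • z.2) (Ioi 0 ×ˢ univ) := by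
      refine ContinuousOn.smul (ContinuousOn.mul ?_ ((continuousOn_barenblatt ha hγ hγ1 hc τ).mono
        hsub)) continuousOn_snd
      exact (continuousOn_const.div (by fun_prop) fun z hz => (hsub hz).ne').neg
    exact h1.congr fun z hz => flux_barenblatt ha hγ τ (hsub hz) z.2
  · rw [← integral_mul_fderiv_of_tsupport (hφ.of_le (by simp)) hφc
      fun z hz => contDiffAt_barenblatt ha hγ hγ1 hc τ (hsub (hφt hz))]
    refine integral_congr_ae (Eventually.of_forall fun z => ?_)
    simp only
    rw [(hasDerivAt_slice (hφ.differentiable (by simp) (z.1, z.2))).deriv]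
  · have hzero : ∀ z ∉ tsupport φ, ∀ v, fderiv ℝ φ z v = 0 := fun z hz v => by
      rw [image_eq_zero_of_notMem_tsupport fun h => hz (tsupport_fderiv_subset ℝ h)]; rfl
    have hF : ∀ i : Fin d, ∀ z ∈ tsupport φ, ContDiffAt ℝ 1 (fun z : ℝ × Space d =>
        -(alpha d γ / (z.1 + τ)) * barenblatt d γ c (z.1 + τ) z.2 * z.2 i) z := fun i z hz =>
      contDiffAt_flux_barenblatt ha hγ hγ1 hc τ i (hsub (hφt hz))
    have hint1 : ∀ i : Fin d, Integrable fun z : ℝ × Space d =>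
        (-(alpha d γ / (z.1 + τ)) * barenblatt d γ c (z.1 + τ) z.2 * z.2 i) *
          fderiv ℝ φ z (0, EuclideanSpace.single i 1) := fun i => by
      have hc1 : HasCompactSupport fun z => fderiv ℝ φ z (0, EuclideanSpace.single i (1 : ℝ)) :=
        hφc.fderiv_apply ℝ _
      have h1 := continuous_mul_of_tsupport
        (φ := fun z => fderiv ℝ φ z (0, EuclideanSpace.single i (1 : ℝ)))
        ((hφ.continuous_fderiv (by simp)).clm_apply continuous_const)
        fun z hz => (hF i z (tsupport_fderiv_apply_subset' φ _ hz)).continuousAt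
      exact (h1.integrable_of_hasCompactSupport hc1.mul_right).congr
        (Eventually.of_forall fun z => mul_comm _ _)
    have hint2 : ∀ i : Fin d, Integrable fun z : ℝ × Space d => fderiv ℝ (fun z : ℝ × Space d =>
        -(alpha d γ / (z.1 + τ)) * barenblatt d γ c (z.1 + τ) z.2 * z.2 i) z
          (0, EuclideanSpace.single i 1) * φ z := fun i => by
      have h1 := continuous_mul_of_tsupport hφ.continuous fun z hz =>
        (((hF i z hz).fderiv_right (m := 0) (by simp)).continuousAt.clm_apply
          (continuousAt_const (y := ((0 : ℝ), EuclideanSpace.single i (1 : ℝ)))))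
      exact (h1.integrable_of_hasCompactSupport hφc.mul_right).congr
        (Eventually.of_forall fun z => mul_comm _ _)
    calc ∫ z : ℝ × Space d, inner ℝ (barenblatt d γ c (z.1 + τ) z.2 •
          gradQ γ (fun _ => 0) (fun t => barenblatt d γ c (t + τ)) z.1 z.2)
          (gradient (fun y => φ (z.1, y)) z.2)
        = ∫ z : ℝ × Space d, ∑ i,
          (-(alpha d γ / (z.1 + τ)) * barenblatt d γ c (z.1 + τ) z.2 * z.2 i) *
            fderiv ℝ φ z (0, EuclideanSpace.single i 1) := by
          refine integral_congr_ae (Eventually.of_forall fun z => ?_)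
          simp only
          have hpd : ∀ i, gradient (fun y => φ (z.1, y)) z.2 i =
              fderiv ℝ φ z (0, EuclideanSpace.single i 1) := fun i => by
            rw [gradient_apply, pd_slice_of_differentiableAt (hφ.differentiable (by simp) _)]
          rw [PiLp.inner_apply]
          refine Finset.sum_congr rfl fun i _ => ?_
          rw [hpd i]
          by_cases hz : z ∈ tsupport φ
          · rw [flux_barenblatt ha hγ τ (hsub (hφt hz)), PiLp.smul_apply, smul_eq_mul]
            simp [mul_comm]
          · rw [hzero z hz, mul_zero, inner_zero_right]
      _ = ∑ i, ∫ z : ℝ × Space d,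
          (-(alpha d γ / (z.1 + τ)) * barenblatt d γ c (z.1 + τ) z.2 * z.2 i) *
            fderiv ℝ φ z (0, EuclideanSpace.single i 1) := integral_finsetSum _ fun i _ => hint1 i
      _ = ∑ i, -∫ z : ℝ × Space d, fderiv ℝ (fun z : ℝ × Space d =>
          -(alpha d γ / (z.1 + τ)) * barenblatt d γ c (z.1 + τ) z.2 * z.2 i) z
            (0, EuclideanSpace.single i 1) * φ z :=
          Finset.sum_congr rfl fun i _ =>
            integral_mul_fderiv_of_tsupport (hφ.of_le (by simp)) hφc (hF i) _
      _ = -∫ z : ℝ × Space d, ∑ i, fderiv ℝ (fun z : ℝ × Space d =>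
          -(alpha d γ / (z.1 + τ)) * barenblatt d γ c (z.1 + τ) z.2 * z.2 i) z
            (0, EuclideanSpace.single i 1) * φ z := by
          rw [Finset.sum_neg_distrib, integral_finsetSum _ fun i _ => hint2 i]
      _ = _ := by
          congr 1
          refine integral_congr_ae (Eventually.of_forall fun z => ?_)
          simp only
          rw [← Finset.sum_mul]
          by_cases hz : z ∈ tsupport φ
          · rw [fderiv_barenblatt_time ha hγ hγ1 hc τ (hsub (hφt hz))]
          · rw [image_eq_zero_of_notMem_tsupport hz, mul_zero, mul_zero]

/-- Time shifts of Barenblatt solutions are well-behaved. -/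
theorem isWellBehaved_barenblatt (ha : 0 < (d : ℝ) * γ + 2) (hγ : γ ≠ 0) (hγ1 : γ < 1)
    (hc : 0 < c) (hτ : 0 < τ) :
    IsWellBehaved γ (fun _ : Space d => 0) (fun t => barenblatt d γ c (t + τ)) := by
  have hsub : (Ioi 0 ×ˢ univ : Set (ℝ × Space d)) ⊆ {z | 0 < z.1 + τ} := fun z hz =>
    add_pos hz.1 hτ
  have hK : ∀ K ⊆ Ioi (0 : ℝ), IsCompact K → ∃ T, τ ≤ T ∧ ∀ t ∈ K, t + τ ∈ Icc τ T := by
    intro K hK hKc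
    obtain ⟨M, hM⟩ := hKc.bddAbove
    refine ⟨max M 0 + τ, by linarith [le_max_right M 0], fun t ht => ⟨?_, ?_⟩⟩
    · have : (0 : ℝ) < t := hK ht
      linarith
    · have : t ≤ max M 0 := (hM ht).trans (le_max_left _ _)
      linarith
  refine ⟨isStrongSolution_barenblatt ha hγ hγ1 hc hτ, fun h => ⟨⟨?_, ?_, ?_⟩, ?_⟩,
    fun h => ⟨⟨?_, ?_⟩, ?_⟩⟩
  · exact (continuousOn_barenblatt ha hγ hγ1 hc τ).mono hsub
  · intro K hKI hKc
    obtain ⟨T, -, hT⟩ := hK K hKI hKc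
    refine ⟨1 + 2 * c * T ^ (2 * alpha d γ) / alpha d γ, fun t ht =>
      closure_minimal (fun x hx => ?_) Metric.isClosed_closedBall⟩
    rw [mem_closedBall_zero_iff]
    by_contra hlt
    exact hx (barenblatt_eq_zero_of_lt_norm ha h hc (hτ.trans_le (hT t ht).1) (hT t ht).2
      (not_le.1 hlt))
  · intro K hKI hKc
    obtain ⟨T, -, hT⟩ := hK K hKI hKc
    obtain ⟨L, hL⟩ := exists_lipschitzWith_pressure_barenblatt (d := d) ha h hc hτ
    exact ⟨L, fun t ht => hL _ (hT t ht).1⟩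
  · intro z hz
    have hz0 : 0 < z.1 + τ := add_pos hz.1 hτ
    exact (contDiffAt_barenblatt_of_pos τ hz0
      ((barenblatt_pos_iff hγ hz0 z.2).1 hz.2)).contDiffWithinAt
  · intro t ht x
    have ht0 : 0 < t + τ := add_pos ht hτ
    exact (barenblatt_pos_iff hγ ht0 x).2 (hc.trans_le (le_barenblattArg_of_neg ha h ht0 x))
  · intro K hKI hKc
    obtain ⟨T, hτT, hT⟩ := hK K hKI hKc
    obtain ⟨k, hk, K', hkK⟩ := exists_barenblatt_bounds (d := d) ha h hc hτ hτT
    obtain ⟨C, hC⟩ := exists_norm_gradient_barenblatt_le (d := d) ha h hc hτ hτT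
    exact ⟨k, K', C, 1, hk, one_pos, fun t ht x hx =>
      ⟨(hkK _ (hT t ht) x).1, (hkK _ (hT t ht) x).2, hC _ (hT t ht) x hx⟩⟩
  · intro z hz
    exact (contDiffAt_barenblatt_of_pos τ (hsub hz)
      (hc.trans_le (le_barenblattArg_of_neg ha h (hsub hz) z.2))).contDiffWithinAt

/-- In the variable ξ = x t^{-α} the weighted gradient is a power of t times a fixed profile, so the
decay of its maximum is exact. -/
theorem weightedGradSq_barenblatt {b : ℝ} (ha : 0 < (d : ℝ) * γ + 2) (hγ : γ ≠ 0) (hb : b ≠ 0)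
    {t : ℝ} (ht : 0 < t) (x : Space d) :
    weightedGradSq γ b (fun _ => 0) (barenblatt d γ c) t x =
      t ^ (-1 - γ * d * (b + 1) * alpha d γ) *
        ((max 0 (c - Real.sign γ * alpha d γ * ‖t ^ (-alpha d γ) • x‖ ^ 2 / 2)) ^ b *
          alpha d γ ^ 2 * ‖t ^ (-alpha d γ) • x‖ ^ 2) := by
  have harg : c - Real.sign γ * alpha d γ * ‖t ^ (-alpha d γ) • x‖ ^ 2 / 2 =
      barenblattArg d γ c t x := by
    rw [barenblattArg, norm_rpow_neg_smul_sq ht]; ring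
  have hα := alpha_pos ha
  rw [harg, weightedGradSq]
  by_cases hx : 0 < barenblattArg d γ c t x
  · rw [max_eq_right hx.le, gradQ, gradient_zero_fun, add_zero,
      gradient_pressure_barenblatt ha hγ ht hx, pressure_barenblatt_of_pos hγ ht hx, abs_mul,
      abs_sign_of_ne_zero hγ, one_mul, abs_of_nonneg (by positivity),
      Real.mul_rpow (by positivity) hx.le, ← Real.rpow_mul ht.le, norm_smul, norm_neg,
      Real.norm_of_nonneg (by positivity), norm_rpow_neg_smul_sq ht, mul_pow, div_pow]
    have e : t ^ (-(alpha d γ * d * γ) * b) = t ^ (-1 - γ * d * (b + 1) * alpha d γ) *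
        t ^ (-(2 * alpha d γ)) * t ^ 2 := by
      rw [← Real.rpow_natCast t 2, ← Real.rpow_add ht, ← Real.rpow_add ht]
      congr 1
      push_cast
      linarith [alpha_mul ha]
    rw [e]
    field_simp
  · have h0 : barenblatt d γ c t x = 0 :=
      le_antisymm (not_lt.1 fun h => hx ((barenblatt_pos_iff hγ ht x).1 h))
        (barenblatt_nonneg ht x)
    rw [h0, pressure, Real.zero_rpow hγ, mul_zero, abs_zero, Real.zero_rpow hb,
      max_eq_left (not_lt.1 hx), Real.zero_rpow hb]
    ring

/-- The decay rate is attained by Barenblatt solutions. -/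
theorem exists_isGreatest_barenblatt {b : ℝ} (hd : 2 ≤ d) (hcoeff : CoeffTrivial d γ b)
    (hc : 0 < c) : ∃ κ > 0, ∀ t > 0, IsGreatest
      (Set.range (weightedGradSq γ b (fun _ => 0) (barenblatt d γ c) t))
      (κ * t ^ (-1 - γ * d * (b + 1) * alpha d γ)) := by
  obtain ⟨hβ, hβγ, hγ⟩ := mul_pos_of_cases hcoeff.cases
  have hb : b ≠ 0 := right_ne_zero_of_mul hβ.ne'
  have ha := hcoeff.two_add_pos hd
  have hα := alpha_pos ha
  have hhalf : (0 : ℝ) < 1 / 2 := by norm_num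
  -- That the maximum at time 1 is attained is read off from the decay estimate for the shift by
  -- 1/2, evaluated at time 1/2. Self-similarity transfers it to every t.
  obtain ⟨C, -, hC⟩ := trivial_estimate_of_mass_le hd hcoeff
    (∫ x : Space d, barenblatt d γ c (0 + 1 / 2) x)
  obtain ⟨κ, hκ, -⟩ := hC _ (isWellBehaved_barenblatt ha hγ (hcoeff.lt_one hd) hc hhalf) le_rfl
    (1 / 2) hhalf
  have hκ' : IsGreatest (range (weightedGradSq γ b (fun _ => 0) (barenblatt d γ c) 1)) κ := by
    have e : weightedGradSq γ b (fun _ : Space d => 0)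
        (fun t => barenblatt d γ c (t + 1 / 2)) (1 / 2) =
        weightedGradSq γ b (fun _ => 0) (barenblatt d γ c) 1 := by
      funext x
      simp only [weightedGradSq, gradQ, add_halves]
    rwa [e] at hκ
  have hscale : ∀ t > 0, ∀ x : Space d,
      weightedGradSq γ b (fun _ => 0) (barenblatt d γ c) t x =
        t ^ (-1 - γ * d * (b + 1) * alpha d γ) *
          weightedGradSq γ b (fun _ => 0) (barenblatt d γ c) 1 (t ^ (-alpha d γ) • x) := by
    intro t ht x
    rw [weightedGradSq_barenblatt ha hγ hb ht, weightedGradSq_barenblatt ha hγ hb one_pos,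
      Real.one_rpow, Real.one_rpow, one_mul, one_smul]
  refine ⟨κ, ?_, fun t ht => ⟨?_, ?_⟩⟩
  -- At |x|² = c/α the argument of the power is c(1 - sign(γ)/2) > 0, so the maximum is positive.
  · set x : Space d := EuclideanSpace.single ⟨0, by omega⟩ √(c / alpha d γ) with hx
    have hxn : ‖x‖ ^ 2 = c / alpha d γ := by
      rw [hx, PiLp.norm_single, Real.norm_of_nonneg (Real.sqrt_nonneg _),
        Real.sq_sqrt (by positivity)]
    refine lt_of_lt_of_le ?_ (hκ'.2 (mem_range_self x))
    rw [weightedGradSq_barenblatt ha hγ hb one_pos, Real.one_rpow, Real.one_rpow, one_mul,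
      one_smul, hxn]
    have hσ := abs_le.1 (abs_sign_of_ne_zero hγ).le
    have h1 : 0 < c - Real.sign γ * alpha d γ * (c / alpha d γ) / 2 := by
      have : Real.sign γ * alpha d γ * (c / alpha d γ) / 2 = Real.sign γ * c / 2 := by field_simp
      rw [this]
      nlinarith [hσ.2]
    rw [max_eq_right h1.le]
    positivity
  · obtain ⟨x, hx⟩ := hκ'.1
    refine ⟨t ^ alpha d γ • x, ?_⟩
    rw [hscale t ht, smul_smul, ← Real.rpow_add ht, neg_add_cancel, Real.rpow_zero, one_smul, hx,
      mul_comm]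
  · rintro _ ⟨x, rfl⟩
    rw [hscale t ht, mul_comm κ]
    exact mul_le_mul_of_nonneg_left (hκ'.2 (mem_range_self _)) (by positivity)

end BarenblattWellBehaved

end NonlinearDiffusion

end

open NonlinearDiffusion in
theorem proposition1 (d : ℕ) (hd : 2 ≤ d) (γ b : ℝ) :
    -- potentials with bounded first and second derivatives
    (CoeffGeneric d γ b → ∀ A B N : ℝ,
      (∃ C₁ > 0, ∃ C₂ > 0, ∀ (V : Space d → ℝ) (n : ℝ → Space d → ℝ),
        HasBoundedDerivatives V A B → IsWellBehaved γ V n → (∀ t > 0, ∀ x, n t x ≤ N) →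
          ∀ t > 0, MaxLE γ b V n t (max C₁ (C₂ * t⁻¹))) ∧
      (∀ C₀ : ℝ, ∃ C > 0, ∀ (V : Space d → ℝ) (n : ℝ → Space d → ℝ),
        HasBoundedDerivatives V A B → IsWellBehaved γ V n → (∀ t > 0, ∀ x, n t x ≤ N) →
          IsRegularUpToZero γ n → IsLUB (Set.range (weightedGradSq γ b V n 0)) C₀ →
            ∀ t > 0, MaxLE γ b V n t C)) ∧
    -- the quadratic potential
    (CoeffQuadratic d γ b → ∃ C > 0, ∀ n : ℝ → Space d → ℝ,
      IsWellBehaved γ (fun x => ‖x‖ ^ 2 / 2) n → IsRegularUpToZero γ n →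
        ∀ C₀ : ℝ, IsLUB (Set.range (weightedGradSq γ b (fun x => ‖x‖ ^ 2 / 2) n 0)) C₀ →
          ∀ t > 0, MaxLE γ b (fun x => ‖x‖ ^ 2 / 2) n t (C₀ * Real.exp (-C * t))) ∧
    -- the trivial potential
    (CoeffTrivial d γ b →
      (∀ M : ℝ, ∃ C > 0, ∀ n : ℝ → Space d → ℝ,
        IsWellBehaved γ (fun _ => 0) n → (∫ x, n 0 x) ≤ M →
          ∀ t > 0, MaxLE γ b (fun _ => 0) n t (C * t ^ (-1 - γ * d * (b + 1) * alpha d γ))) ∧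
      -- sharpness: equality for the Barenblatt solutions, whose time shifts are well-behaved
      (∀ c > 0,
        (∃ κ > 0, ∀ t > 0, IsGreatest
          (Set.range (weightedGradSq γ b (fun _ => 0) (barenblatt d γ c) t))
          (κ * t ^ (-1 - γ * d * (b + 1) * alpha d γ))) ∧
        ∀ τ > 0, IsWellBehaved γ (fun _ => 0) (fun t => barenblatt d γ c (t + τ))) ∧
      (∀ N : ℝ, ∃ C > 0, ∀ n : ℝ → Space d → ℝ,
        IsWellBehaved γ (fun _ => 0) n → (∀ᵐ x, n 0 x ≤ N) →
          ∀ t > 0, MaxLE γ b (fun _ => 0) n t (C * t⁻¹))) := by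
  refine ⟨fun h A B N => generic_estimate h A B N, quadratic_estimate hd, fun h =>
    ⟨trivial_estimate_of_mass_le hd h, fun c hc => ⟨exists_isGreatest_barenblatt hd h hc,
      fun τ hτ => isWellBehaved_barenblatt (h.two_add_pos hd) (mul_pos_of_cases h.cases).2.2
        (h.lt_one hd) hc hτ⟩, trivial_estimate_of_initial_le hd h⟩⟩
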